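/- **Setting.** Let $p$ be an odd prime, $k=\overline{\mathbb F}_p$, $R=W(k)$ (the $p$-adic completion of the maximal unramified extension of $\mathbb Z_p$), $K=\mathrm{Frac}(R)$, and let $\pi\in \overline K$ be a prime element of a finite Galois extension of $\mathbb Q_p$; put $R_\pi=R[\pi]$, so $R_\pi/\pi R_\pi=k$. A higher $\pi$-Frobenius lift of degree $s\ge 1$ on an $R_\pi$-algebra is a ring endomorphism $\phi$ with $\phi(a)\equiv a^{p^s}$ mod $\pi$; the attached higher $\pi$-derivation is $\delta a=(\phi(a)-a^{p^s})/\pi$. Fix $c,n\geq 1$ and, for each $s\in c\mathbb N=\{c,2c,3c,\dots\}$, distinct Frobenius lifts $\phi^{(s)}_1,\dots,\phi^{(s)}_n$ of degree $s$ on $R_\pi$ such that $\phi_i^{(s)}\phi_j^{(r)}$ is always one of the $\phi_k^{(s+r)}$. Let $\mathfrak d\subset \mathrm{End}_{\mathbb Z}(R_\pi)$ be the $\mathbb Z$-span of all $\phi_i^{(s)}$, an associative algebra without identity and also a Lie algebra under the commutator. Let $\delta^{(c)}_i$ and $\delta^{(2c)}_{ij}$ be the derivations attached to $\phi_i^{(c)}$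 and $\phi_i^{(c)}\phi_j^{(c)}$. Let $\ell^{k(c)}_{ij}=\alpha^{k}_{ji}-\alpha^{k}_{ij}$, where $\alpha^{k}_{ji}$ is $1$ if $\phi_i^{(c)}\phi_j^{(c)}=\phi_k^{(2c)}$ and $0$ otherwise. Let $x$ be an $n\times n$ matrix of indeterminates, $\mathcal A$ the $p$-adic completion of $R_\pi[x,\det(x)^{-1}]$, and $\mathcal M=(\pi,x-1)\subset\mathcal A$. For a matrix $a=(a_{ij})$ write $a^{(p^s)}=(a_{ij}^{p^s})$. A graded $\pi$-connection is a family of Frobenius lifts $(\phi_i^{(s)})^G$ of degree $s$ on $\mathcal A$ extending $\phi_i^{(s)}$ ($s\in c\mathbb N$, $1\le i\le n$); it induces a $\mathbb Z$-linear map $\nabla:\mathfrak d\to\mathrm{End}_{\mathbb Z}(\mathcal A)$, $\nabla_{\phi_i^{(s)}}=(\phi_i^{(s)})^G$. Put $\Lambda_i^{(s)}=(x^{(p^s)})^{-1}(\phi_i^{(s)})^G(x)$ and let $\Gamma^{k(s)}_{ij}$ be the $kj$-entry of $(x^{(p^s)})^{-1}(\delta_i^{(s)})^G(x)$, where $(\delta_i^{(s)})^G$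 is attached to $(\phi_i^{(s)})^G$. A metric is a symmetric matrix in $\mathrm{GL}_n(R_\pi)$. A torsion symbol is an $n$-tuple $L=(L^k)$ of antisymmetric $n\times n$ matrices over the $p$-adic completion of $R_\pi[y_1,\dots,y_n]$, each $y_m$ being an $n\times n$ matrix of indeterminates; $L(1)$ is obtained by setting all $y_m=1$. Given metrics $q^{(s)}$ and torsion symbols $L^{(s)}$ ($s\in c\mathbb N$), the graded connection is the graded Levi-Civita connection attached to them if for all $s$ and all $i,j,k$: $\mathcal H\circ\phi_{i,0}^{(s)}=(\phi_i^{(s)})^G\circ \mathcal H$, where $\mathcal H$ is the $R_\pi$-algebra map $x\mapsto x^tq^{(s)}x$ and $\phi_{i,0}^{(s)}$ is the extension of $\phi_i^{(s)}$ with $x\mapsto x^{(p^s)}$; and $\Gamma^{k(s)}_{ij}-\Gamma^{k(s)}_{ji}=L^{k(s)}_{ij}(\Lambda^{(s)})$. For any graded connection put $\mathcal S(X,Y)=\nabla_X\nabla_Y-\nabla_{XY}$ and $\mathcal R(X,Y)=[\nabla_X,\nabla_Y]-\nabla_{[X,Y]}$ ($X,Y\in\mathfrak d$). Let $\mathfrak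 l$ be the $\mathbb Z$-span of all products of the $(\phi_i^{(s)})^G$, and $\mathfrak n$ the kernel of the restriction map $\mathfrak l\to\mathfrak d$. The Hochschild class $h_\nabla\in H^2_{\rm Hoch}(\mathfrak d,\mathfrak n/\mathfrak n^2)$ and the Lie class $\kappa_\nabla\in H^2_{\rm Lie}(\mathfrak d,\mathfrak n/\mathfrak n^2)$ are the classes of $\mathcal S$ and $\mathcal R$, that is, of the extension $0\to\mathfrak n/\mathfrak n^2\to\mathfrak l/\mathfrak n^2\to\mathfrak d\to0$. All elements of $\mathfrak l$ act on $\mathcal M/\mathcal M^2$; write $\overline F$ for the action of $F$, and let $[\pi]\in\mathcal M/\mathcal M^2$ be the class of $\pi$. Let $\mathfrak a^{(s)}$ be the set of $\mathrm{Fr}^s$-linear endomorphisms of $\mathcal M/\mathcal M^2$ with image in $k\cdot[\pi]$ and vanishing on $k\cdot[\pi]$, and $\mathfrak a^{(\ge 2c)}=\bigoplus_{s\in c\mathbb N,\,s\geq 2c}\mathfrak a^{(s)}$, a $\mathfrak d$-bimodule by $X\cdot u=\overline{\nabla_X}\circ u$ and $u\cdot X=0$. The reduced classes $\overline h_\nabla\in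 H^2_{\rm Hoch}(\mathfrak d,\mathfrak a^{(\geq 2c)})$ and $\overline\kappa_\nabla\in H^2_{\rm Lie}(\mathfrak d,\mathfrak a^{(\geq 2c)})$ are the classes of $\overline{\mathcal S}$ and $\overline{\mathcal R}$. The reduced conormal $\mathfrak d$-module $\overline{\mathfrak n}_\nabla$ is the image of $\mathfrak n$ in $\mathrm{End}_{\mathbb Z}(\mathcal M/\mathcal M^2)$, with the same action. A $\mathfrak d$-module is called trivial if $\mathfrak d$ acts on it as zero. **Theorem.** Assume $\ell^{(c)}=0$ (equivalently, the $\phi_i^{(c)}$ commute pairwise). (A) Let $\nabla$ be the graded Levi-Civita connection attached to metrics $q^{(s)}$ and torsion symbols $L^{(s)}$ with $L^{(c)}(1)=0$, put $q=q^{(c)}$, and let $i,j\in\{1,\dots,n\}$. Assume that for some $k,l$ $$\delta_{jl}^{(2c)}q_{ik}-\delta_{jk}^{(2c)}q_{il}-\delta_{il}^{(2c)}q_{jk}+\delta_{ik}^{(2c)}q_{jl}\not\equiv0\mod \pi.\qquad(*)$$ Then: (1) $\overline{\mathcal R}(\phi_i^{(c)},\phi_j^{(c)})\neq0$; (2) $\overline\kappa_\nabla$,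 $\kappa_\nabla$, $h_\nabla$, $\overline h_\nabla$ are all non-zero; (3) the $\mathfrak d$-modules $\overline{\mathfrak n}_\nabla$ and $\mathfrak n/\mathfrak n^2$ are non-trivial. (B) Assume $n\ge2$. For $a\in k$ let $[a]\in R$ be its Teichmüller lift. For every metric $q$ there are unique matrices $c_0,c_1$ over $k$ with $q_{ij}\equiv[c_{0,ij}]+[c_{1,ij}]\pi$ mod $\pi^2$ for all $i,j$. The pairs that occur are exactly those with $c_0$ symmetric and invertible and $c_1$ symmetric. There are a matrix $\epsilon$ over $k$ with non-zero entries satisfying $[\epsilon_{ij}]^{p^{2c}}\equiv\delta_i^{(c)}\pi\cdot(\delta_j^{(c)}\pi)^{p^c}$ mod $\pi$, and a linear subspace $V\subset\mathrm{Mat}_n(k)$, $$V=\{a:\ \epsilon_{jl}a_{ik}-\epsilon_{jk}a_{il}-\epsilon_{il}a_{jk}+\epsilon_{ik}a_{jl}=0\ \text{ for all } i,j,k,l\},$$ not containing all symmetric matrices, such that a metric $q$ with coefficients $(c_0,c_1)$ satisfies $(*)$ for some $i,j,k,l$ if and only if $c_1\notin V$. Consequently, for the graded Levi-Civita connection attached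 to any metrics $q^{(s)}$ and torsion symbols $L^{(s)}$ such that $L^{(c)}(1)=0$ and the coefficient $c_1$ of $q^{(c)}$ is not in $V$, the conclusions (1), (2), (3) hold for some $i,j$. -/

import Mathlib

/-! ### Bimodules over non-unital rings and low degree cohomology -/

/-- A bimodule over an associative `ℤ`-algebra that need not have an identity: an abelian group
with a left module structure and a right module structure that commute with each other. -/
structure NonUnitalBimodule (C M : Type*) [NonUnitalRing C] [AddCommGroup M] where
  left : C →ₙ+* AddMonoid.End M
  right : Cᵐᵒᵖ →ₙ+* AddMonoid.End M
  left_right : ∀ (x y : C) (m : M),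
    left x (right (MulOpposite.op y) m) = right (MulOpposite.op y) (left x m)

/-- A module over a Lie `ℤ`-algebra. -/
structure LieModuleStr (L M : Type*) [LieRing L] [AddCommGroup M] where
  act : L →+ AddMonoid.End M
  act_lie : ∀ (x y : L) (m : M), act ⁅x, y⁆ m = act x (act y m) - act y (act x m)

/-- The Lie `ℤ`-algebra with the commutator bracket on an associative `ℤ`-algebra. -/
abbrev commutatorLieRing (C : Type*) [NonUnitalRing C] : LieRing C where
  bracket x y := x * y - y * x
  add_lie x y z := by simp only [add_mul, mul_add]; abel
  lie_add x y z := by simp only [add_mul, mul_add]; abel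
  lie_self x := sub_self _
  leibniz_lie x y z := by simp only [mul_sub, sub_mul, mul_assoc]; abel

namespace LieModuleStr

variable {L M : Type*} [LieRing L] [AddCommGroup M] (ρ : LieModuleStr L M)

/-- Lie `2`-cocycles: alternating biadditive maps satisfying the cocycle identity. -/
def cocycles : AddSubgroup (L →+ L →+ M) where
  carrier := {f | (∀ x, f x x = 0) ∧ ∀ x y z,
    f ⁅x, y⁆ z + f ⁅y, z⁆ x + f ⁅z, x⁆ y =
      ρ.act x (f y z) + ρ.act y (f z x) + ρ.act z (f x y)}
  zero_mem' := by simp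
  add_mem' := by
    rintro f g ⟨hf, hf'⟩ ⟨hg, hg'⟩
    refine ⟨fun x => by simp [hf x, hg x], fun x y z => ?_⟩
    have h := congrArg₂ (· + ·) (hf' x y z) (hg' x y z)
    simp only [AddMonoidHom.add_apply, map_add]
    calc _ = _ := by abel
      _ = _ := h
      _ = _ := by abel
  neg_mem' := by
    rintro f ⟨hf, hf'⟩
    refine ⟨fun x => by simp [hf x], fun x y z => ?_⟩
    have h := congrArg (- ·) (hf' x y z)
    simp only [AddMonoidHom.neg_apply, map_neg]
    calc _ = _ := by abel
      _ = _ := h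
      _ = _ := by abel

/-- Lie `2`-coboundaries. -/
def coboundaries : AddSubgroup (L →+ L →+ M) where
  carrier := {f | ∃ g : L →+ M, ∀ x y, f x y = ρ.act x (g y) - ρ.act y (g x) - g ⁅x, y⁆}
  zero_mem' := ⟨0, by intro x y; simp⟩
  add_mem' := by
    rintro f f' ⟨g, hg⟩ ⟨g', hg'⟩
    refine ⟨g + g', fun x y => ?_⟩
    simp only [AddMonoidHom.add_apply, map_add, hg, hg']; abel
  neg_mem' := by
    rintro f ⟨g, hg⟩
    refine ⟨-g, fun x y => ?_⟩
    simp only [AddMonoidHom.neg_apply, map_neg, hg]; abel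

/-- The second Chevalley-Eilenberg cohomology group. -/
abbrev H2 : Type _ := ↥ρ.cocycles ⧸ ρ.coboundaries.addSubgroupOf ρ.cocycles

end LieModuleStr

namespace NonUnitalBimodule

variable {C M : Type*} [NonUnitalRing C] [AddCommGroup M] (β : NonUnitalBimodule C M)

theorem left_sub (x y : C) (m : M) : β.left (x - y) m = β.left x m - β.left y m := by
  rw [map_sub]; rfl

theorem left_mul (x y : C) (m : M) : β.left (x * y) m = β.left x (β.left y m) := by
  rw [map_mul]; rfl

theorem right_sub (x y : C) (m : M) : β.right (MulOpposite.op (x - y)) m =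
    β.right (MulOpposite.op x) m - β.right (MulOpposite.op y) m := by
  rw [MulOpposite.op_sub, map_sub]; rfl

theorem right_mul (x y : C) (m : M) : β.right (MulOpposite.op (x * y)) m =
    β.right (MulOpposite.op y) (β.right (MulOpposite.op x) m) := by
  rw [MulOpposite.op_mul, map_mul]; rfl

/-- Hochschild `2`-cocycles. -/
def hochCocycles : AddSubgroup (C →+ C →+ M) where
  carrier := {f | ∀ x y z, β.left x (f y z) - f (x * y) z + f x (y * z)
    - β.right (MulOpposite.op z) (f x y) = 0}
  zero_mem' := by intro x y z; simp
  add_mem' := by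
    intro f g hf hg x y z
    have h := congrArg₂ (· + ·) (hf x y z) (hg x y z)
    simp only [add_zero] at h
    rw [← h]; simp only [AddMonoidHom.add_apply, map_add]; abel
  neg_mem' := by
    intro f hf x y z
    have h := congrArg (- ·) (hf x y z)
    simp only [neg_zero] at h
    rw [← h]; simp only [AddMonoidHom.neg_apply, map_neg]; abel

/-- Hochschild `2`-coboundaries. -/
def hochCoboundaries : AddSubgroup (C →+ C →+ M) where
  carrier := {f | ∃ g : C →+ M, ∀ x y, f x y =
    β.left x (g y) - g (x * y) + β.right (MulOpposite.op y) (g x)}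
  zero_mem' := ⟨0, by intro x y; simp⟩
  add_mem' := by
    rintro f f' ⟨g, hg⟩ ⟨g', hg'⟩
    refine ⟨g + g', fun x y => ?_⟩
    simp only [AddMonoidHom.add_apply, map_add, hg, hg']; abel
  neg_mem' := by
    rintro f ⟨g, hg⟩
    refine ⟨-g, fun x y => ?_⟩
    simp only [AddMonoidHom.neg_apply, map_neg, hg]; abel

/-- The second Hochschild cohomology group. -/
abbrev HochH2 : Type _ := ↥β.hochCocycles ⧸ β.hochCoboundaries.addSubgroupOf β.hochCocycles

/-- The Lie module attached to a bimodule: `x` acts by `m ↦ x m - m x`. -/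
def toLie : @LieModuleStr C M (commutatorLieRing C) _ :=
  letI := commutatorLieRing C
  { act := AddMonoidHom.mk' (fun x => β.left x - β.right (MulOpposite.op x)) (by
      intro x y; simp only [map_add, MulOpposite.op_add]; abel)
    act_lie := by
      intro x y m
      have h1 := β.left_right x y m
      have h2 := β.left_right y x m
      change β.left (x * y - y * x) m - β.right (MulOpposite.op (x * y - y * x)) m =
        (β.left x (β.left y m - β.right (MulOpposite.op y) m) -
          β.right (MulOpposite.op x) (β.left y m - β.right (MulOpposite.op y) m)) -
        (β.left y (β.left x m - β.right (MulOpposite.op x) m) -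
          β.right (MulOpposite.op y) (β.left x m - β.right (MulOpposite.op x) m))
      rw [left_sub, right_sub, left_mul, right_mul, left_mul, right_mul]
      simp only [map_sub, h1, h2]
      abel }

/-- The second Lie cohomology group of `C`, viewed as a Lie `ℤ`-algebra, with values in the Lie
module attached to the bimodule. -/
abbrev LieH2 : Type _ :=
  letI := commutatorLieRing C
  β.toLie.H2

/-- The Lie `2`-cocycle `(x, y) ↦ f (x, y) - f (y, x)` attached to a Hochschild `2`-cocycle `f`. -/
def lieCocycle (f : ↥β.hochCocycles) :
    letI := commutatorLieRing C
    ↥β.toLie.cocycles :=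
  letI := commutatorLieRing C
  ⟨f.1 - f.1.flip, fun x => sub_self _, fun x y z => by
    have e1 := f.2 x y z
    have e2 := f.2 y z x
    have e3 := f.2 z x y
    have e4 := f.2 y x z
    have e5 := f.2 x z y
    have e6 := f.2 z y x
    change (f.1 (x * y - y * x) z - f.1 z (x * y - y * x)) +
      (f.1 (y * z - z * y) x - f.1 x (y * z - z * y)) +
      (f.1 (z * x - x * z) y - f.1 y (z * x - x * z)) =
      (β.left x (f.1 y z - f.1 z y) - β.right (MulOpposite.op x) (f.1 y z - f.1 z y)) +
      (β.left y (f.1 z x - f.1 x z) - β.right (MulOpposite.op y) (f.1 z x - f.1 x z)) +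
      (β.left z (f.1 x y - f.1 y x) - β.right (MulOpposite.op z) (f.1 x y - f.1 y x))
    simp only [map_sub, AddMonoidHom.sub_apply]
    rw [← sub_eq_zero, ← neg_eq_zero]
    have tot : (β.left x (f.1 y z) - f.1 (x * y) z + f.1 x (y * z)
        - β.right (MulOpposite.op z) (f.1 x y))
      + (β.left y (f.1 z x) - f.1 (y * z) x + f.1 y (z * x)
        - β.right (MulOpposite.op x) (f.1 y z))
      + (β.left z (f.1 x y) - f.1 (z * x) y + f.1 z (x * y)
        - β.right (MulOpposite.op y) (f.1 z x))
      - (β.left y (f.1 x z) - f.1 (y * x) z + f.1 y (x * z)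
        - β.right (MulOpposite.op z) (f.1 y x))
      - (β.left x (f.1 z y) - f.1 (x * z) y + f.1 x (z * y)
        - β.right (MulOpposite.op y) (f.1 x z))
      - (β.left z (f.1 y x) - f.1 (z * y) x + f.1 z (y * x)
        - β.right (MulOpposite.op x) (f.1 z y)) = 0 := by
      rw [e1, e2, e3, e4, e5, e6]; simp
    rw [← tot]
    abel⟩

/-- The class of a Hochschild `2`-cocycle. -/
def hochClass (f : ↥β.hochCocycles) : β.HochH2 := QuotientAddGroup.mk f

/-- The class of the Lie `2`-cocycle attached to a Hochschild `2`-cocycle. -/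
def lieClass (f : ↥β.hochCocycles) : β.LieH2 := QuotientAddGroup.mk (β.lieCocycle f)

end NonUnitalBimodule

/-! ### Extensions by an ideal, the conormal bimodule and the attached cocycle -/

/-- An ideal `N` of an associative `ℤ`-algebra `B` together with an additive map `C → B` which is
multiplicative modulo `N`. -/
structure IdealSection {B : Type*} [NonUnitalRing B] (N : AddSubgroup B)
    (C : Type*) [NonUnitalRing C] where
  mul_left : ∀ (b : B), ∀ a ∈ N, b * a ∈ N
  mul_right : ∀ a ∈ N, ∀ (b : B), a * b ∈ N
  sec : C →+ B
  sec_mul : ∀ x y : C, sec x * sec y - sec (x * y) ∈ N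

/-- The square `N ^ 2` of an ideal: the additive subgroup generated by all products. -/
def idealSq {B : Type*} [NonUnitalRing B] (N : AddSubgroup B) : AddSubgroup B :=
  AddSubgroup.closure {x | ∃ a ∈ N, ∃ b ∈ N, x = a * b}

/-- `N / N ^ 2`. -/
abbrev Conormal {B : Type*} [NonUnitalRing B] (N : AddSubgroup B) : Type _ :=
  ↥N ⧸ (idealSq N).addSubgroupOf N

namespace IdealSection

variable {B C : Type*} [NonUnitalRing B] [NonUnitalRing C] {N : AddSubgroup B}
  (σ : IdealSection N C)

theorem sq_mul_left (σ : IdealSection N C) (b : B) {a : B} (ha : a ∈ idealSq N) : b * a ∈ idealSq N := by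
  unfold idealSq at ha
  induction ha using AddSubgroup.closure_induction with
  | mem x hx =>
    obtain ⟨u, hu, v, hv, rfl⟩ := hx
    rw [← mul_assoc]
    exact AddSubgroup.subset_closure ⟨b * u, σ.mul_left b u hu, v, hv, rfl⟩
  | zero => rw [mul_zero]; exact zero_mem _
  | add x y _ _ hx hy => rw [mul_add]; exact add_mem hx hy
  | neg x _ hx => rw [mul_neg]; exact neg_mem hx

theorem sq_mul_right (σ : IdealSection N C) (b : B) {a : B} (ha : a ∈ idealSq N) : a * b ∈ idealSq N := by
  unfold idealSq at ha
  induction ha using AddSubgroup.closure_induction with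
  | mem x hx =>
    obtain ⟨u, hu, v, hv, rfl⟩ := hx
    rw [mul_assoc]
    exact AddSubgroup.subset_closure ⟨u, hu, v * b, σ.mul_right v hv b, rfl⟩
  | zero => rw [zero_mul]; exact zero_mem _
  | add x y _ _ hx hy => rw [add_mul]; exact add_mem hx hy
  | neg x _ hx => rw [neg_mul]; exact neg_mem hx

/-- Left multiplication by `b` on `N / N ^ 2`. -/
def lmul (b : B) : AddMonoid.End (Conormal N) :=
  QuotientAddGroup.map _ _
    (AddMonoidHom.mk' (fun a : ↥N => (⟨b * a, σ.mul_left b a a.2⟩ : ↥N))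
      (fun x y => Subtype.ext (mul_add b x y)))
    (fun _ ha => σ.sq_mul_left b ha)

/-- Right multiplication by `b` on `N / N ^ 2`. -/
def rmul (b : B) : AddMonoid.End (Conormal N) :=
  QuotientAddGroup.map _ _
    (AddMonoidHom.mk' (fun a : ↥N => (⟨a * b, σ.mul_right a a.2 b⟩ : ↥N))
      (fun x y => Subtype.ext (add_mul (x : B) y b)))
    (fun _ ha => σ.sq_mul_right b ha)

theorem mk_eq_mk {a b : ↥N} (h : (a : B) - b ∈ idealSq N) :
    (QuotientAddGroup.mk a : Conormal N) = QuotientAddGroup.mk b :=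
  QuotientAddGroup.eq_iff_sub_mem.2 h

theorem end_ext {f g : AddMonoid.End (Conormal N)}
    (h : ∀ a : ↥N, f (QuotientAddGroup.mk a) = g (QuotientAddGroup.mk a)) : f = g :=
  AddMonoidHom.ext fun m => QuotientAddGroup.induction_on m h

/-- The `C`-bimodule structure on `N / N ^ 2`, where `x` acts through multiplication by the lift
`sec x` (any other lift acts in the same way). -/
def bimodule : NonUnitalBimodule C (Conormal N) where
  left :=
    { toFun := fun x => σ.lmul (σ.sec x)
      map_zero' := by
        refine end_ext fun a => congrArg QuotientAddGroup.mk (Subtype.ext ?_)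
        change σ.sec 0 * (a : B) = 0
        rw [map_zero, zero_mul]
      map_add' := by
        intro x y; refine end_ext fun a => congrArg QuotientAddGroup.mk (Subtype.ext ?_)
        change σ.sec (x + y) * (a : B) = σ.sec x * a + σ.sec y * a
        rw [map_add, add_mul]
      map_mul' := by
        intro x y; refine end_ext fun a => (mk_eq_mk ?_).symm
        change σ.sec x * (σ.sec y * (a : B)) - σ.sec (x * y) * a ∈ idealSq N
        rw [← mul_assoc, ← sub_mul]
        exact AddSubgroup.subset_closure ⟨_, σ.sec_mul x y, a, a.2, rfl⟩ }
  right :=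
    { toFun := fun x => σ.rmul (σ.sec x.unop)
      map_zero' := by
        refine end_ext fun a => congrArg QuotientAddGroup.mk (Subtype.ext ?_)
        change (a : B) * σ.sec 0 = 0
        rw [map_zero, mul_zero]
      map_add' := by
        intro x y; refine end_ext fun a => congrArg QuotientAddGroup.mk (Subtype.ext ?_)
        change (a : B) * σ.sec (x.unop + y.unop) = a * σ.sec x.unop + a * σ.sec y.unop
        rw [map_add, mul_add]
      map_mul' := by
        intro x y; refine end_ext fun a => (mk_eq_mk ?_).symm
        change ((a : B) * σ.sec y.unop) * σ.sec x.unop - a * σ.sec (y.unop * x.unop) ∈ idealSq N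
        rw [mul_assoc, ← mul_sub]
        exact AddSubgroup.subset_closure ⟨a, a.2, _, σ.sec_mul _ _, rfl⟩ }
  left_right := by
    intro x y m
    induction m using QuotientAddGroup.induction_on with
    | H a =>
      refine congrArg QuotientAddGroup.mk (Subtype.ext ?_)
      exact (mul_assoc _ _ _).symm

/-- The biadditive map `(x, y) ↦ sec x * sec y - sec (x * y)` with values in `N`. -/
def defect : C →+ C →+ ↥N :=
  AddMonoidHom.mk' (fun x => AddMonoidHom.mk'
    (fun y => (⟨σ.sec x * σ.sec y - σ.sec (x * y), σ.sec_mul x y⟩ : ↥N))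
    (fun y z => Subtype.ext (by
      change σ.sec x * σ.sec (y + z) - σ.sec (x * (y + z)) =
        (σ.sec x * σ.sec y - σ.sec (x * y)) + (σ.sec x * σ.sec z - σ.sec (x * z))
      rw [mul_add, map_add, map_add, mul_add]; abel)))
    (fun x y => by
      ext z
      change σ.sec (x + y) * σ.sec z - σ.sec ((x + y) * z) =
        (σ.sec x * σ.sec z - σ.sec (x * z)) + (σ.sec y * σ.sec z - σ.sec (y * z))
      rw [add_mul, map_add, map_add, add_mul]; abel)

/-- The Hochschild `2`-cocycle of the extension `0 → N / N ^ 2 → B / N ^ 2 → C → 0`. -/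
def cocycle : ↥σ.bimodule.hochCocycles :=
  ⟨AddMonoidHom.mk' (fun x => (QuotientAddGroup.mk' _).comp (σ.defect x))
    (fun x y => by ext z; rw [map_add]; rfl), fun x y z => by
      change (QuotientAddGroup.mk (⟨σ.sec x * (σ.defect y z : B) - σ.defect (x * y) z
        + σ.defect x (y * z) - (σ.defect x y : B) * σ.sec z, _⟩ : ↥N) : Conormal N) = 0
      refine (congrArg QuotientAddGroup.mk (Subtype.ext ?_)).trans (QuotientAddGroup.mk_zero _)
      change σ.sec x * (σ.sec y * σ.sec z - σ.sec (y * z))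
          - (σ.sec (x * y) * σ.sec z - σ.sec (x * y * z))
          + (σ.sec x * σ.sec (y * z) - σ.sec (x * (y * z)))
          - (σ.sec x * σ.sec y - σ.sec (x * y)) * σ.sec z = 0
      rw [mul_sub, sub_mul, mul_assoc, mul_assoc]
      abel⟩

end IdealSection

/-! ### Higher Frobenius lifts and labelled Weil monoids -/

/-- `φ` is a higher `ϖ`-Frobenius lift of degree `s`: it reduces to the `p ^ s`-power Frobenius
modulo `ϖ`. -/
def IsFrobLift (p s : ℕ) {A : Type*} [CommRing A] (ϖ : A) (φ : A →+* A) : Prop :=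
  ∀ a : A, ϖ ∣ φ a - a ^ p ^ s

open Classical in
/-- The higher `ϖ`-derivation `δ` of degree `s` attached to a higher `ϖ`-Frobenius lift `φ` of
degree `s`, so `φ a = a ^ p ^ s + ϖ * δ a`. (It is only used when `ϖ` is not a zero divisor.) -/
noncomputable def piDer (p s : ℕ) {A : Type*} [CommRing A] (ϖ : A) (φ : A →+* A) (a : A) : A :=
  if h : ϖ ∣ φ a - a ^ p ^ s then h.choose else 0

/-- `s` is a positive multiple of `c`. -/
def IsDeg (c s : ℕ) : Prop := 0 < s ∧ c ∣ s

theorem IsDeg.self {c : ℕ} (hc : 0 < c) : IsDeg c c := ⟨hc, dvd_rfl⟩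

theorem IsDeg.add {c s r : ℕ} (hs : IsDeg c s) (hr : IsDeg c r) : IsDeg c (s + r) :=
  ⟨Nat.add_pos_left hs.1 r, dvd_add hs.2 hr.2⟩

/-- A labelled Weil monoid of higher `ϖ`-Frobenius lifts on `S` of minimal degree `c` and size `n`:
for every `s ∈ cℕ` distinct Frobenius lifts `φ_1^(s), …, φ_n^(s)` of degree `s` on `S`, the union
over all `s` being closed under composition (compatibly with the degrees). -/
structure WeilMonoid (p : ℕ) {S : Type*} [CommRing S] (ϖ : S) (c n : ℕ) where
  frob : ℕ → Fin n → S →+* S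
  isFrobLift : ∀ s, IsDeg c s → ∀ i, IsFrobLift p s ϖ (frob s i)
  injective : ∀ s, IsDeg c s → Function.Injective (frob s)
  comp : ∀ s r, IsDeg c s → IsDeg c r → ∀ i j, ∃ k,
    (frob s i).comp (frob r j) = frob (s + r) k

/-- The `ℤ`-span of a set of endomorphisms that is closed under composition, as an associative
`ℤ`-algebra. -/
def spanAlgebra {E : Type*} [Ring E] (G : Set E) (hG : ∀ a ∈ G, ∀ b ∈ G, a * b ∈ G) :
    NonUnitalSubring E :=
  { AddSubgroup.closure G with
    mul_mem' := by
      intro x y hx hy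
      change x ∈ AddSubgroup.closure G at hx
      change y ∈ AddSubgroup.closure G at hy
      change x * y ∈ AddSubgroup.closure G
      induction hx using AddSubgroup.closure_induction with
      | mem x hx =>
        induction hy using AddSubgroup.closure_induction with
        | mem y hy => exact AddSubgroup.subset_closure (hG x hx y hy)
        | zero => rw [mul_zero]; exact zero_mem _
        | add y z _ _ hy hz => rw [mul_add]; exact add_mem hy hz
        | neg y _ hy => rw [mul_neg]; exact neg_mem hy
      | zero => rw [zero_mul]; exact zero_mem _
      | add y z _ _ hy hz => rw [add_mul]; exact add_mem hy hz
      | neg y _ hy => rw [neg_mul]; exact neg_mem hy }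

theorem spanAlgebra_induction {E : Type*} [Ring E] {G : Set E}
    {hG : ∀ a ∈ G, ∀ b ∈ G, a * b ∈ G} {P : ↥(spanAlgebra G hG) → Prop}
    (hmem : ∀ a (ha : a ∈ G), P ⟨a, AddSubgroup.subset_closure ha⟩) (hzero : P 0)
    (hadd : ∀ x y, P x → P y → P (x + y)) (hneg : ∀ x, P x → P (-x)) (x : ↥(spanAlgebra G hG)) :
    P x := by
  obtain ⟨x, hx⟩ := x
  change x ∈ AddSubgroup.closure G at hx
  induction hx using AddSubgroup.closure_induction with
  | mem x hx => exact hmem x hx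
  | zero => exact hzero
  | add y z hy hz h1 h2 => exact hadd ⟨y, hy⟩ ⟨z, hz⟩ h1 h2
  | neg y hy h1 => exact hneg ⟨y, hy⟩ h1

/-- A ring endomorphism as an endomorphism of the underlying abelian group. -/
def ringEnd {A : Type*} [CommRing A] (φ : A →+* A) : AddMonoid.End A := φ.toAddMonoidHom

namespace WeilMonoid

variable {p : ℕ} {S : Type*} [CommRing S] {ϖ : S} {c n : ℕ} (W : WeilMonoid p ϖ c n)

/-- The underlying set of the Weil monoid, inside the endomorphisms of the abelian group `S`. -/
def carrier : Set (AddMonoid.End S) := {f | ∃ s i, IsDeg c s ∧ f = ringEnd (W.frob s i)}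

/-- The canonical algebra: the `ℤ`-linear span of the Weil monoid, under composition. -/
def algebra : NonUnitalSubring (AddMonoid.End S) :=
  spanAlgebra W.carrier (by
    rintro _ ⟨s, i, hs, rfl⟩ _ ⟨r, j, hr, rfl⟩
    obtain ⟨k, hk⟩ := W.comp s r hs hr i j
    exact ⟨s + r, k, hs.add hr, by rw [← hk]; rfl⟩)

/-- `φ_i^(s)` as an element of the canonical algebra. -/
def elt {s : ℕ} (hs : IsDeg c s) (i : Fin n) : ↥W.algebra :=
  ⟨ringEnd (W.frob s i), AddSubgroup.subset_closure ⟨s, i, hs, rfl⟩⟩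

theorem algebra_induction {W : WeilMonoid p ϖ c n} {P : ↥W.algebra → Prop}
    (hmem : ∀ (s : ℕ) (hs : IsDeg c s) (i : Fin n), P (W.elt hs i)) (hzero : P 0)
    (hadd : ∀ x y, P x → P y → P (x + y)) (hneg : ∀ x, P x → P (-x)) (x : ↥W.algebra) : P x := by
  refine spanAlgebra_induction ?_ hzero hadd hneg x
  rintro _ ⟨s, i, hs, rfl⟩
  exact hmem s hs i

open Classical in
/-- The associative symbol: `α_{ji}^{k(s,r)} = 1` if `φ_i^(s) φ_j^(r) = φ_k^(s+r)`, and `0`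
otherwise. -/
noncomputable def assocSymbol (s r : ℕ) (k j i : Fin n) : ℤ :=
  if (W.frob s i).comp (W.frob r j) = W.frob (s + r) k then 1 else 0

/-- The Lie symbol `ℓ_{ij}^{k(s)} = α_{ji}^{k(s,s)} - α_{ij}^{k(s,s)}`. -/
noncomputable def lieSymbol (s : ℕ) (k i j : Fin n) : ℤ :=
  W.assocSymbol s s k j i - W.assocSymbol s s k i j

/-- `δ_{ij}^(2c)`, the higher derivation of degree `2c` attached to `φ_i^(c) φ_j^(c)`. -/
noncomputable def der₂ (i j : Fin n) : S → S :=
  piDer p (2 * c) ϖ ((W.frob c i).comp (W.frob c j))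

/-- The Kulkarni-Nomizu type expression
`δ_{jl} q_{ik} - δ_{jk} q_{il} - δ_{il} q_{jk} + δ_{ik} q_{jl}`. -/
noncomputable def kulkarniNomizu (q : Matrix (Fin n) (Fin n) S) (i j k l : Fin n) : S :=
  W.der₂ j l (q i k) - W.der₂ j k (q i l) - W.der₂ i l (q j k) + W.der₂ i k (q j l)

end WeilMonoid

/-! ### Graded connections, Atiyah extensions and characteristic classes -/

/-- A graded `π`-connection on the `S`-algebra `A`: for every `s ∈ cℕ` Frobenius lifts
`(φ_1^(s))^G, …, (φ_n^(s))^G` of degree `s` on `A` extending `φ_1^(s), …, φ_n^(s)`, together with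
the induced `ℤ`-linear map `∇` on the canonical algebra, sending `φ_i^(s)` to `(φ_i^(s))^G`. -/
structure GradedConnection {p : ℕ} {S : Type*} [CommRing S] {ϖ : S} {c n : ℕ}
    (W : WeilMonoid p ϖ c n) (A : Type*) [CommRing A] [Algebra S A] where
  frobG : ℕ → Fin n → A →+* A
  isFrobLift : ∀ s, IsDeg c s → ∀ i, IsFrobLift p s (algebraMap S A ϖ) (frobG s i)
  extends_frob : ∀ s, IsDeg c s → ∀ i a,
    frobG s i (algebraMap S A a) = algebraMap S A (W.frob s i a)
  nabla : ↥W.algebra →+ AddMonoid.End A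
  nabla_elt : ∀ s (hs : IsDeg c s) i, nabla (W.elt hs i) = ringEnd (frobG s i)

namespace GradedConnection

variable {p : ℕ} {S : Type*} [CommRing S] {ϖ : S} {c n : ℕ}
  {W : WeilMonoid p ϖ c n} {A : Type*} [CommRing A] [Algebra S A] (D : GradedConnection W A)

/-- The monoid of all products of the `∇_{φ_i^(s)}`. -/
def productMonoid : Subsemigroup (AddMonoid.End A) :=
  Subsemigroup.closure {f | ∃ s i, IsDeg c s ∧ f = ringEnd (D.frobG s i)}

/-- The Atiyah extension attached to `∇`. -/
def atiyah : NonUnitalSubring (AddMonoid.End A) :=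
  spanAlgebra (D.productMonoid : Set (AddMonoid.End A))
    (fun _ ha _ hb => D.productMonoid.mul_mem ha hb)

/-- The kernel of the restriction map from the Atiyah extension to the canonical algebra. -/
def kernel : AddSubgroup ↥D.atiyah where
  carrier := {F | ∀ a : S, F.1 (algebraMap S A a) = 0}
  zero_mem' := fun _ => rfl
  add_mem' := by
    intro F G hF hG a
    change F.1 _ + G.1 _ = 0
    rw [hF a, hG a, add_zero]
  neg_mem' := by
    intro F hF a
    change -(F.1 _) = 0
    rw [hF a, neg_zero]

theorem nabla_mem (X : ↥W.algebra) : D.nabla X ∈ D.atiyah := by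
  induction X using WeilMonoid.algebra_induction with
  | hmem s hs i =>
    rw [D.nabla_elt]
    exact AddSubgroup.subset_closure (Subsemigroup.subset_closure ⟨s, i, hs, rfl⟩)
  | hzero => rw [map_zero]; exact zero_mem _
  | hadd x y hx hy => rw [map_add]; exact add_mem hx hy
  | hneg x hx => rw [map_neg]; exact neg_mem hx

theorem nabla_algebraMap (X : ↥W.algebra) (a : S) :
    D.nabla X (algebraMap S A a) = algebraMap S A (X.1 a) := by
  induction X using WeilMonoid.algebra_induction with
  | hmem s hs i => rw [D.nabla_elt]; exact D.extends_frob s hs i a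
  | hzero => rw [map_zero]; exact (map_zero _).symm
  | hadd x y hx hy =>
    rw [map_add]
    exact (congrArg₂ (· + ·) hx hy).trans (map_add _ _ _).symm
  | hneg x hx =>
    rw [map_neg]
    exact (congrArg (- ·) hx).trans (map_neg _ _).symm

/-- Elements of the Atiyah extension map the image of `S` into itself. -/
theorem atiyah_algebraMap (F : ↥D.atiyah) (a : S) :
    ∃ b : S, F.1 (algebraMap S A a) = algebraMap S A b := by
  revert a
  unfold atiyah at F
  induction F using spanAlgebra_induction with
  | hmem f hf =>
    change f ∈ Subsemigroup.closure _ at hf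
    induction hf using Subsemigroup.closure_induction with
    | mem f hf =>
      obtain ⟨s, i, hs, rfl⟩ := hf
      exact fun a => ⟨_, D.extends_frob s hs i a⟩
    | mul f g _ _ hf hg =>
      intro a
      obtain ⟨b, hb⟩ := hg a
      obtain ⟨d, hd⟩ := hf b
      exact ⟨d, (congrArg f hb).trans hd⟩
  | hzero => exact fun a => ⟨0, (map_zero _).symm⟩
  | hadd x y hx hy =>
    intro a
    obtain ⟨b, hb⟩ := hx a
    obtain ⟨d, hd⟩ := hy a
    exact ⟨b + d, (congrArg₂ (· + ·) hb hd).trans (map_add _ _ _).symm⟩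
  | hneg x hx =>
    intro a
    obtain ⟨b, hb⟩ := hx a
    exact ⟨-b, (congrArg (- ·) hb).trans (map_neg _ _).symm⟩

/-- The kernel is an ideal of the Atiyah extension, and `∇` is a section of the extension. -/
def extSection : IdealSection D.kernel ↥W.algebra where
  mul_left F G hG a := (congrArg F.1 (hG a)).trans (map_zero F.1)
  mul_right F hF G a := by
    obtain ⟨b, hb⟩ := D.atiyah_algebraMap G a
    exact (congrArg F.1 hb).trans (hF b)
  sec := AddMonoidHom.mk' (fun X => ⟨D.nabla X, D.nabla_mem X⟩)
    (fun X Y => Subtype.ext (map_add D.nabla X Y))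
  sec_mul X Y a := by
    change D.nabla X (D.nabla Y (algebraMap S A a)) - D.nabla (X * Y) (algebraMap S A a) = 0
    rw [D.nabla_algebraMap, D.nabla_algebraMap, D.nabla_algebraMap]
    exact sub_self _

/-- The conormal module of `∇`: the bimodule `N / N ^ 2` over the canonical algebra. -/
def conormal : NonUnitalBimodule ↥W.algebra (Conormal D.kernel) := D.extSection.bimodule

/-- The Hochschild characteristic class of `∇`, the class of the extension
`0 → N / N ^ 2 → L / N ^ 2 → 𝔡 → 0` of associative algebras. -/
def hochschildClass : D.conormal.HochH2 := D.conormal.hochClass D.extSection.cocycle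

/-- The Lie characteristic class of `∇`, the class of the extension
`0 → N / N ^ 2 → L / N ^ 2 → 𝔡 → 0` of Lie algebras. -/
def lieClass : D.conormal.LieH2 := D.conormal.lieClass D.extSection.cocycle

end GradedConnection

/-! ### Reduction to the cotangent space at the identity -/

section Reduction

variable {A : Type*} [CommRing A]

/-- The additive endomorphisms of `A` that preserve `M` and `M ^ 2`. -/
def stabEnd (M : Ideal A) : Subring (AddMonoid.End A) where
  carrier := {F | (∀ a ∈ M, F a ∈ M) ∧ ∀ a ∈ M ^ 2, F a ∈ M ^ 2}
  one_mem' := ⟨fun _ h => h, fun _ h => h⟩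
  mul_mem' hF hG := ⟨fun a h => hF.1 _ (hG.1 a h), fun a h => hF.2 _ (hG.2 a h)⟩
  zero_mem' := ⟨fun _ _ => M.zero_mem, fun _ _ => (M ^ 2).zero_mem⟩
  add_mem' hF hG := ⟨fun a h => M.add_mem (hF.1 a h) (hG.1 a h),
    fun a h => (M ^ 2).add_mem (hF.2 a h) (hG.2 a h)⟩
  neg_mem' hF := ⟨fun a h => M.neg_mem (hF.1 a h), fun a h => (M ^ 2).neg_mem (hF.2 a h)⟩

/-- The endomorphism `m ↦ F m` of `M`. -/
def stabEndRestrict {M : Ideal A} (F : ↥(stabEnd M)) : ↥M →+ ↥M :=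
  AddMonoidHom.mk' (fun m => ⟨F.1 m, F.2.1 m m.2⟩) (fun a b => Subtype.ext (map_add F.1 (a : A) b))

/-- The endomorphism of `M / M ^ 2` induced by `F`. -/
noncomputable def cotangentEnd {M : Ideal A} (F : ↥(stabEnd M)) : AddMonoid.End M.Cotangent :=
  AddMonoidHom.liftOfSurjective M.toCotangent.toAddMonoidHom M.toCotangent_surjective
    ⟨M.toCotangent.toAddMonoidHom.comp (stabEndRestrict F), fun x hx => by
      have h1 : (x : A) ∈ M ^ 2 := (M.toCotangent_eq_zero x).1 hx
      exact (M.toCotangent_eq_zero _).2 (F.2.2 _ h1)⟩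

theorem cotangentEnd_apply {M : Ideal A} (F : ↥(stabEnd M)) (m : ↥M) :
    cotangentEnd F (M.toCotangent m) = M.toCotangent ⟨F.1 m, F.2.1 m m.2⟩ :=
  AddMonoidHom.liftOfRightInverse_comp_apply M.toCotangent.toAddMonoidHom _ _ _ m

theorem cotangent_end_ext {M : Ideal A} {f g : AddMonoid.End M.Cotangent}
    (h : ∀ m : ↥M, f (M.toCotangent m) = g (M.toCotangent m)) : f = g := by
  refine AddMonoidHom.ext fun v => ?_
  obtain ⟨m, rfl⟩ := M.toCotangent_surjective v
  exact h m

/-- Reduction, as a ring homomorphism. -/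
noncomputable def cotangentEndHom (M : Ideal A) : ↥(stabEnd M) →+* AddMonoid.End M.Cotangent where
  toFun := cotangentEnd
  map_one' := cotangent_end_ext fun m => by
    rw [cotangentEnd_apply]; rfl
  map_mul' F G := cotangent_end_ext fun m => by
    change _ = cotangentEnd F (cotangentEnd G _)
    rw [cotangentEnd_apply, cotangentEnd_apply, cotangentEnd_apply]; rfl
  map_zero' := cotangent_end_ext fun m => by
    rw [cotangentEnd_apply]; exact (M.toCotangent_eq_zero _).2 (Ideal.zero_mem _)
  map_add' F G := cotangent_end_ext fun m => by
    change _ = cotangentEnd F _ + cotangentEnd G _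
    rw [cotangentEnd_apply, cotangentEnd_apply, cotangentEnd_apply, ← map_add]; rfl

variable (p : ℕ) (M : Ideal A) {ϖ : A} (hϖ : ϖ ∈ M)

/-- The line `k · [ϖ]` in `M / M ^ 2`, where `k = A / M`. -/
def piLine : Submodule (A ⧸ M) M.Cotangent := Submodule.span (A ⧸ M) {M.toCotangent ⟨ϖ, hϖ⟩}

/-- `𝔟^(s)`: the `Fr ^ s`-linear endomorphisms of `M / M ^ 2` with image contained in `k · [ϖ]`. -/
def bSpace (s : ℕ) : AddSubgroup (AddMonoid.End M.Cotangent) where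
  carrier := {u | (∀ (a : A ⧸ M) v, u (a • v) = a ^ p ^ s • u v) ∧ ∀ v, u v ∈ piLine M hϖ}
  zero_mem' := ⟨fun a _ => (smul_zero (a ^ p ^ s)).symm, fun _ => zero_mem _⟩
  add_mem' {u w} hu hw := ⟨fun a v => by
    change u _ + w _ = a ^ p ^ s • (u v + w v)
    rw [hu.1, hw.1, smul_add], fun v => add_mem (hu.2 v) (hw.2 v)⟩
  neg_mem' {u} hu := ⟨fun a v => by
    change -(u _) = a ^ p ^ s • (-(u v))
    rw [hu.1, smul_neg], fun v => neg_mem (hu.2 v)⟩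

/-- `𝔞^(s)`: the elements of `𝔟^(s)` that vanish on `k · [ϖ]`. -/
def aSpace (s : ℕ) : AddSubgroup (AddMonoid.End M.Cotangent) where
  carrier := {u | u ∈ bSpace p M hϖ s ∧ ∀ v ∈ piLine M hϖ, u v = 0}
  zero_mem' := ⟨zero_mem _, fun _ _ => rfl⟩
  add_mem' {u w} hu hw := ⟨add_mem hu.1 hw.1, fun v hv => by
    change u v + w v = 0
    rw [hu.2 v hv, hw.2 v hv, add_zero]⟩
  neg_mem' {u} hu := ⟨neg_mem hu.1, fun v hv => by
    change -(u v) = 0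
    rw [hu.2 v hv, neg_zero]⟩

/-- `𝔞^(≥ ec)`: the sum of the `𝔞^(mc)` with `m ≥ e`, `m > 0`. -/
def aSpaceGE (c e : ℕ) : AddSubgroup (AddMonoid.End M.Cotangent) :=
  ⨆ (s : ℕ) (_ : IsDeg c s ∧ e * c ≤ s), aSpace p M hϖ s

variable {p M hϖ}

theorem aSpaceGE_induction {c e : ℕ} {P : AddMonoid.End M.Cotangent → Prop}
    (hmem : ∀ s, IsDeg c s → e * c ≤ s → ∀ u ∈ aSpace p M hϖ s, P u) (hzero : P 0)
    (hadd : ∀ u w, P u → P w → P (u + w)) {u : AddMonoid.End M.Cotangent}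
    (hu : u ∈ aSpaceGE p M hϖ c e) : P u := by
  refine AddSubgroup.iSup_induction' (C := fun u _ => P u) _ (fun s u hu => ?_) hzero
    (fun u w _ _ => hadd u w) hu
  refine AddSubgroup.iSup_induction' (C := fun u _ => P u) _ (fun hs u hu => ?_) hzero
    (fun u w _ _ => hadd u w) hu
  exact hmem s hs.1 hs.2 u hu

theorem mem_aSpaceGE {c e s : ℕ} (hs : IsDeg c s) (he : e * c ≤ s) {u : AddMonoid.End M.Cotangent}
    (hu : u ∈ aSpace p M hϖ s) : u ∈ aSpaceGE p M hϖ c e :=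
  AddSubgroup.mem_iSup_of_mem s (AddSubgroup.mem_iSup_of_mem ⟨hs, he⟩ hu)

theorem aSpaceGE_kills {c e : ℕ} {u : AddMonoid.End M.Cotangent}
    (hu : u ∈ aSpaceGE p M hϖ c e) : ∀ v ∈ piLine M hϖ, u v = 0 :=
  aSpaceGE_induction (P := fun u => ∀ v ∈ piLine M hϖ, u v = 0) (fun _ _ _ _ hu => hu.2)
    (fun _ _ => rfl) (fun u w hu hw v hv => by
      change u v + w v = 0
      rw [hu v hv, hw v hv, add_zero]) hu

theorem aSpaceGE_range {c e : ℕ} {u : AddMonoid.End M.Cotangent}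
    (hu : u ∈ aSpaceGE p M hϖ c e) : ∀ v, u v ∈ piLine M hϖ :=
  aSpaceGE_induction (P := fun u => ∀ v, u v ∈ piLine M hϖ) (fun _ _ _ _ hu => hu.1.2)
    (fun _ => zero_mem _) (fun _ _ hu hw v => add_mem (hu v) (hw v)) hu

theorem bSpace_mul {s r : ℕ} {u w : AddMonoid.End M.Cotangent} (hu : u ∈ bSpace p M hϖ s)
    (hw : w ∈ bSpace p M hϖ r) : u * w ∈ bSpace p M hϖ (s + r) :=
  ⟨fun a v => by
    change u (w (a • v)) = _ • u (w v)
    rw [hw.1, hu.1, ← pow_mul, ← pow_add, add_comm r s], fun v => hu.2 _⟩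

theorem bSpace_mul_aSpace {s r : ℕ} {u w : AddMonoid.End M.Cotangent} (hu : u ∈ bSpace p M hϖ s)
    (hw : w ∈ aSpace p M hϖ r) : u * w ∈ aSpace p M hϖ (s + r) :=
  ⟨bSpace_mul hu hw.1, fun v hv => by
    change u (w v) = 0
    rw [hw.2 v hv, map_zero]⟩

theorem IsFrobLift.mem_stabEnd {s : ℕ} {φ : A →+* A} (h : IsFrobLift p s ϖ φ)
    (hp : p ^ s ≠ 0) (hϖ : ϖ ∈ M) : ringEnd φ ∈ stabEnd M := by
  have h1 : ∀ a ∈ M, φ a ∈ M := by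
    intro a ha
    obtain ⟨d, hd⟩ := h a
    rw [sub_eq_iff_eq_add.1 hd]
    exact M.add_mem (M.mul_mem_right d hϖ) (M.pow_mem_of_mem ha _ (Nat.pos_of_ne_zero hp))
  refine ⟨h1, fun a ha => ?_⟩
  change φ a ∈ M ^ 2
  rw [pow_two] at ha ⊢
  refine Submodule.mul_induction_on ha (fun x hx y hy => ?_) (fun x y hx hy => ?_)
  · rw [map_mul]; exact Ideal.mul_mem_mul (h1 x hx) (h1 y hy)
  · rw [map_add]; exact add_mem hx hy

theorem IsFrobLift.cotangentEnd_mem {s : ℕ} {φ : A →+* A} (h : IsFrobLift p s ϖ φ)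
    (hp : 2 ≤ p ^ s) (hF : ringEnd φ ∈ stabEnd M) :
    cotangentEnd ⟨ringEnd φ, hF⟩ ∈ bSpace p M hϖ s := by
  constructor
  · intro a v
    obtain ⟨a, rfl⟩ := Ideal.Quotient.mk_surjective a
    obtain ⟨m, rfl⟩ := M.toCotangent_surjective v
    change cotangentEnd _ (M.toCotangent (a • m)) = a ^ p ^ s • cotangentEnd _ (M.toCotangent m)
    rw [cotangentEnd_apply, cotangentEnd_apply, ← map_smul]
    rw [Ideal.toCotangent_eq]
    change φ (a * m) - a ^ p ^ s * φ m ∈ M ^ 2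
    obtain ⟨d, hd⟩ := h a
    rw [map_mul, ← sub_mul, hd, pow_two]
    exact Ideal.mul_mem_mul (M.mul_mem_right d hϖ) (hF.1 m m.2)
  · intro v
    obtain ⟨m, rfl⟩ := M.toCotangent_surjective v
    rw [cotangentEnd_apply]
    obtain ⟨d, hd⟩ := h m
    have : M.toCotangent ⟨ringEnd φ m, hF.1 m m.2⟩ =
        (Ideal.Quotient.mk M d) • M.toCotangent ⟨ϖ, hϖ⟩ := by
      change _ = d • M.toCotangent _
      rw [← map_smul, Ideal.toCotangent_eq]
      change φ m - d * ϖ ∈ M ^ 2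
      rw [mul_comm, ← hd, sub_sub_cancel]
      exact Ideal.pow_le_pow_right hp (Ideal.pow_mem_pow m.2 _)
    rw [this]
    exact Submodule.smul_mem _ _ (Submodule.mem_span_singleton_self _)

end Reduction

namespace GradedConnection

variable {p : ℕ} [hp : Fact p.Prime] {S : Type*} [CommRing S] {ϖ : S} {c n : ℕ}
  {W : WeilMonoid p ϖ c n} {A : Type*} [CommRing A] [Algebra S A] (D : GradedConnection W A)
  (M : Ideal A) (hϖ : algebraMap S A ϖ ∈ M)

theorem atiyah_le_stabEnd (hϖ : algebraMap S A ϖ ∈ M) (F : ↥D.atiyah) : F.1 ∈ stabEnd M := by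
  unfold atiyah at F
  induction F using spanAlgebra_induction with
  | hmem f hf =>
    change f ∈ Subsemigroup.closure _ at hf
    induction hf using Subsemigroup.closure_induction with
    | mem f hf =>
      obtain ⟨s, i, hs, rfl⟩ := hf
      exact (D.isFrobLift s hs i).mem_stabEnd (pow_ne_zero s hp.out.ne_zero) hϖ
    | mul f g _ _ hf hg => exact (stabEnd M).mul_mem hf hg
  | hzero => exact (stabEnd M).zero_mem
  | hadd x y hx hy => exact (stabEnd M).add_mem hx hy
  | hneg x hx => exact (stabEnd M).neg_mem hx

/-- The reduction map from the Atiyah extension to the endomorphisms of `M / M ^ 2`. -/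
noncomputable def red : ↥D.atiyah →ₙ+* AddMonoid.End M.Cotangent where
  toFun F := cotangentEndHom M ⟨F.1, D.atiyah_le_stabEnd M hϖ F⟩
  map_mul' F G := (cotangentEndHom M).map_mul ⟨F.1, D.atiyah_le_stabEnd M hϖ F⟩
    ⟨G.1, D.atiyah_le_stabEnd M hϖ G⟩
  map_zero' := (cotangentEndHom M).map_zero
  map_add' F G := (cotangentEndHom M).map_add ⟨F.1, D.atiyah_le_stabEnd M hϖ F⟩
    ⟨G.1, D.atiyah_le_stabEnd M hϖ G⟩

/-- The reduction of `∇`. -/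
noncomputable def redNabla : ↥W.algebra →+ AddMonoid.End M.Cotangent :=
  (D.red M hϖ).toAddMonoidHom.comp D.extSection.sec

/-- The reduction of `(X, Y) ↦ ∇_X ∇_Y - ∇_{XY}`. -/
noncomputable def redDefect (X Y : ↥W.algebra) : AddMonoid.End M.Cotangent :=
  D.redNabla M hϖ X * D.redNabla M hϖ Y - D.redNabla M hϖ (X * Y)

/-- The reduced curvature, the reduction of `(X, Y) ↦ [∇_X, ∇_Y] - ∇_{[X, Y]}`. -/
noncomputable def redCurvature (X Y : ↥W.algebra) : AddMonoid.End M.Cotangent :=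
  D.redNabla M hϖ X * D.redNabla M hϖ Y - D.redNabla M hϖ Y * D.redNabla M hϖ X
    - D.redNabla M hϖ (X * Y - Y * X)

theorem redNabla_elt_mem {s : ℕ} (hs : IsDeg c s) (i : Fin n) :
    D.redNabla M hϖ (W.elt hs i) ∈ bSpace p M hϖ s := by
  have h2 : 2 ≤ p ^ s := hp.out.two_le.trans (Nat.le_self_pow hs.1.ne' p)
  have hF := (D.isFrobLift s hs i).mem_stabEnd (pow_ne_zero s hp.out.ne_zero) hϖ
  have key := (D.isFrobLift s hs i).cotangentEnd_mem (hϖ := hϖ) h2 hF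
  have : D.redNabla M hϖ (W.elt hs i) = cotangentEnd ⟨ringEnd (D.frobG s i), hF⟩ :=
    congrArg cotangentEnd (Subtype.ext (D.nabla_elt s hs i))
  rw [this]
  exact key

theorem redNabla_line (X : ↥W.algebra) : D.redNabla M hϖ X (M.toCotangent ⟨_, hϖ⟩) =
    M.toCotangent ⟨algebraMap S A (X.1 ϖ), by
      rw [← D.nabla_algebraMap]
      exact (D.atiyah_le_stabEnd M hϖ ⟨D.nabla X, D.nabla_mem X⟩).1 _ hϖ⟩ := by
  refine (cotangentEnd_apply _ _).trans (congrArg M.toCotangent (Subtype.ext ?_))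
  exact D.nabla_algebraMap X ϖ

theorem redNabla_range (X : ↥W.algebra) (v : M.Cotangent) :
    D.redNabla M hϖ X v ∈ piLine M hϖ := by
  induction X using WeilMonoid.algebra_induction with
  | hmem s hs i => exact (D.redNabla_elt_mem M hϖ hs i).2 v
  | hzero => rw [map_zero]; exact zero_mem _
  | hadd x y hx hy => rw [map_add]; exact add_mem hx hy
  | hneg x hx => rw [map_neg]; exact neg_mem hx

theorem redDefect_mem (X Y : ↥W.algebra) : D.redDefect M hϖ X Y ∈ aSpaceGE p M hϖ c 2 := by
  unfold redDefect
  induction X using WeilMonoid.algebra_induction with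
  | hmem s hs i =>
    induction Y using WeilMonoid.algebra_induction with
    | hmem r hr j =>
      obtain ⟨k, hk⟩ := W.comp s r hs hr i j
      have hmul : W.elt hs i * W.elt hr j = W.elt (hs.add hr) k :=
        Subtype.ext (congrArg ringEnd hk)
      have hle : 2 * c ≤ s + r := by
        rw [two_mul]; exact add_le_add (Nat.le_of_dvd hs.1 hs.2) (Nat.le_of_dvd hr.1 hr.2)
      have hb : D.redNabla M hϖ (W.elt hs i) * D.redNabla M hϖ (W.elt hr j)
          - D.redNabla M hϖ (W.elt hs i * W.elt hr j) ∈ bSpace p M hϖ (s + r) := by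
        refine sub_mem (bSpace_mul (D.redNabla_elt_mem M hϖ hs i) (D.redNabla_elt_mem M hϖ hr j)) ?_
        rw [hmul]
        exact D.redNabla_elt_mem M hϖ _ k
      refine mem_aSpaceGE (hs.add hr) hle ⟨hb, fun v hv => ?_⟩
      obtain ⟨a, rfl⟩ := Submodule.mem_span_singleton.1 hv
      rw [hb.1]
      refine (congrArg (_ • ·) ?_).trans (smul_zero _)
      change D.redNabla M hϖ _ (D.redNabla M hϖ _ _) - D.redNabla M hϖ _ _ = 0
      rw [redNabla_line, redNabla_line, sub_eq_zero]
      refine (cotangentEnd_apply _ _).trans (congrArg M.toCotangent (Subtype.ext ?_))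
      exact D.nabla_algebraMap _ _
    | hzero => simp only [map_zero, mul_zero, sub_zero]; exact zero_mem _
    | hadd y z hy hz =>
      convert add_mem hy hz using 1
      simp only [map_add, mul_add]; abel
    | hneg y hy =>
      convert neg_mem hy using 1
      have e : W.elt hs i * -y = -(W.elt hs i * y) := mul_neg _ _
      rw [e]
      simp only [map_neg, mul_neg]; abel
  | hzero => simp only [map_zero, zero_mul, sub_zero]; exact zero_mem _
  | hadd x z hx hz =>
    convert add_mem hx hz using 1
    simp only [map_add, add_mul]; abel
  | hneg x hx =>
    convert neg_mem hx using 1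
    have e : -x * Y = -(x * Y) := neg_mul _ _
    rw [e]
    simp only [map_neg, neg_mul]; abel

theorem redNabla_mul_line (X Y : ↥W.algebra) {v : M.Cotangent} (hv : v ∈ piLine M hϖ) :
    D.redNabla M hϖ (X * Y) v = D.redNabla M hϖ X (D.redNabla M hϖ Y v) :=
  (sub_eq_zero.1 (aSpaceGE_kills (D.redDefect_mem M hϖ X Y) v hv)).symm

theorem redNabla_mul_mem (X : ↥W.algebra) {u : AddMonoid.End M.Cotangent}
    (hu : u ∈ aSpaceGE p M hϖ c 2) : D.redNabla M hϖ X * u ∈ aSpaceGE p M hϖ c 2 := by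
  induction X using WeilMonoid.algebra_induction with
  | hmem s hs i =>
    refine aSpaceGE_induction (P := fun u => D.redNabla M hϖ (W.elt hs i) * u ∈
      aSpaceGE p M hϖ c 2) (fun r hr he u hu => ?_) ?_ (fun u w hu hw => ?_) hu
    · exact mem_aSpaceGE (hs.add hr) (he.trans (Nat.le_add_left r s))
        (bSpace_mul_aSpace (D.redNabla_elt_mem M hϖ hs i) hu)
    · rw [mul_zero]; exact zero_mem _
    · rw [mul_add]; exact add_mem hu hw
  | hzero => rw [map_zero, zero_mul]; exact zero_mem _
  | hadd x y hx hy => rw [map_add, add_mul]; exact add_mem hx hy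
  | hneg x hx => rw [map_neg, neg_mul]; exact neg_mem hx

/-- The bimodule `𝔞^(≥ 2c)` over the canonical algebra. An element `u` of `𝔞^(≥ 2c)` has image in
`k · [ϖ]`, where `∇_X` acts as `X` does, and `X u` is the composition of the two. The right action
is zero. -/
noncomputable def redBimodule : NonUnitalBimodule ↥W.algebra ↥(aSpaceGE p M hϖ c 2) where
  left :=
    { toFun := fun X => AddMonoidHom.mk'
        (fun u => ⟨D.redNabla M hϖ X * u.1, D.redNabla_mul_mem M hϖ X u.2⟩)
        (fun u w => Subtype.ext (mul_add _ u.1 w.1))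
      map_zero' := AddMonoidHom.ext fun u => Subtype.ext (by
        change D.redNabla M hϖ 0 * u.1 = 0
        rw [map_zero, zero_mul])
      map_add' := fun X Y => AddMonoidHom.ext fun u => Subtype.ext (by
        change D.redNabla M hϖ (X + Y) * u.1 = D.redNabla M hϖ X * u.1 + D.redNabla M hϖ Y * u.1
        rw [map_add, add_mul])
      map_mul' := fun X Y => AddMonoidHom.ext fun u => Subtype.ext (AddMonoidHom.ext fun v =>
        D.redNabla_mul_line M hϖ X Y (aSpaceGE_range u.2 v)) }
  right := 0
  left_right _ _ _ := map_zero _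

/-- The Hochschild `2`-cocycle `(X, Y) ↦ ∇_X ∇_Y - ∇_{XY}` reduced to `𝔞^(≥ 2c)`. -/
noncomputable def redCocycle : ↥(D.redBimodule M hϖ).hochCocycles :=
  ⟨AddMonoidHom.mk' (fun X => AddMonoidHom.mk'
      (fun Y => ⟨D.redDefect M hϖ X Y, D.redDefect_mem M hϖ X Y⟩)
      (fun Y Z => Subtype.ext (by
        change D.redDefect M hϖ X (Y + Z) = D.redDefect M hϖ X Y + D.redDefect M hϖ X Z
        simp only [redDefect, map_add, mul_add]; abel)))
      (fun X Y => AddMonoidHom.ext fun Z => Subtype.ext (by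
        change D.redDefect M hϖ (X + Y) Z = D.redDefect M hϖ X Z + D.redDefect M hϖ Y Z
        simp only [redDefect, map_add, add_mul]; abel)), fun X Y Z => Subtype.ext (by
      change D.redNabla M hϖ X * D.redDefect M hϖ Y Z - D.redDefect M hϖ (X * Y) Z
        + D.redDefect M hϖ X (Y * Z) - 0 = 0
      have h0 : D.redDefect M hϖ X Y * D.redNabla M hϖ Z = 0 := AddMonoidHom.ext fun v =>
        aSpaceGE_kills (D.redDefect_mem M hϖ X Y) _ (D.redNabla_range M hϖ Z v)
      rw [sub_zero, ← h0]
      simp only [redDefect, mul_sub, sub_mul, mul_assoc]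
      abel)⟩

/-- The reduced Hochschild characteristic class of `∇`. -/
noncomputable def redHochschildClass : (D.redBimodule M hϖ).HochH2 :=
  (D.redBimodule M hϖ).hochClass (D.redCocycle M hϖ)

/-- The reduced Lie characteristic class of `∇`, the class of the reduced curvature. -/
noncomputable def redLieClass : (D.redBimodule M hϖ).LieH2 :=
  (D.redBimodule M hϖ).lieClass (D.redCocycle M hϖ)

theorem atiyah_line (hϖ : algebraMap S A ϖ ∈ M) (F : ↥D.atiyah) (m : A) (hm : m ∈ M) :
    ∃ d : A, F.1 m - d * algebraMap S A ϖ ∈ M ^ 2 := by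
  revert m
  unfold atiyah at F
  induction F using spanAlgebra_induction with
  | hmem f hf =>
    change f ∈ Subsemigroup.closure _ at hf
    have key : (∀ m ∈ M, ∃ d : A, f m - d * algebraMap S A ϖ ∈ M ^ 2) ∧ f ∈ stabEnd M := by
      induction hf using Subsemigroup.closure_induction with
      | mem f hf =>
        obtain ⟨s, i, hs, rfl⟩ := hf
        refine ⟨fun m hm => ?_,
          (D.isFrobLift s hs i).mem_stabEnd (pow_ne_zero s hp.out.ne_zero) hϖ⟩
        have h2 : 2 ≤ p ^ s := hp.out.two_le.trans (Nat.le_self_pow hs.1.ne' p)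
        obtain ⟨d, hd⟩ := D.isFrobLift s hs i m
        refine ⟨d, ?_⟩
        change D.frobG s i m - d * algebraMap S A ϖ ∈ M ^ 2
        rw [mul_comm, ← hd, sub_sub_cancel]
        exact Ideal.pow_le_pow_right h2 (Ideal.pow_mem_pow hm _)
      | mul f g _ _ hf hg =>
        exact ⟨fun m hm => hf.1 _ (hg.2.1 m hm), (stabEnd M).mul_mem hf.2 hg.2⟩
    exact key.1
  | hzero => exact fun m _ => ⟨0, by
      rw [zero_mul, sub_zero]; exact zero_mem _⟩
  | hadd x y hx hy =>
    intro m hm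
    obtain ⟨a, ha⟩ := hx m hm
    obtain ⟨b, hb⟩ := hy m hm
    refine ⟨a + b, ?_⟩
    have := add_mem ha hb
    rw [← add_sub_add_comm, ← add_mul] at this
    exact this
  | hneg x hx =>
    intro m hm
    obtain ⟨a, ha⟩ := hx m hm
    refine ⟨-a, ?_⟩
    have := neg_mem ha
    rw [neg_sub, ← neg_sub_neg, ← neg_mul] at this
    exact this

theorem red_range (F : ↥D.atiyah) (v : M.Cotangent) : D.red M hϖ F v ∈ piLine M hϖ := by
  obtain ⟨m, rfl⟩ := M.toCotangent_surjective v
  obtain ⟨d, hd⟩ := D.atiyah_line M hϖ F m m.2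
  have h1 : D.red M hϖ F (M.toCotangent m) = Ideal.Quotient.mk M d • M.toCotangent ⟨_, hϖ⟩ := by
    refine (cotangentEnd_apply _ _).trans ?_
    change _ = d • M.toCotangent _
    rw [← map_smul, Ideal.toCotangent_eq]
    exact hd
  rw [h1]
  exact Submodule.smul_mem _ _ (Submodule.mem_span_singleton_self _)

/-- The reduced conormal module: the image of the kernel under reduction. -/
noncomputable def redConormal : AddSubgroup (AddMonoid.End M.Cotangent) :=
  D.kernel.map (D.red M hϖ).toAddMonoidHom

/-- The left module structure over the canonical algebra on the reduced conormal module, `X` acting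
through composition with the reduction of `∇_X`. -/
noncomputable def redConormalAct : ↥W.algebra →ₙ+* AddMonoid.End ↥(D.redConormal M hϖ) where
  toFun X := AddMonoidHom.mk' (fun u => ⟨D.redNabla M hϖ X * u.1, by
      obtain ⟨F, hF, hu⟩ := u.2
      refine ⟨D.extSection.sec X * F, D.extSection.mul_left _ F hF, ?_⟩
      rw [← hu]
      exact (D.red M hϖ).map_mul _ _⟩)
    (fun u w => Subtype.ext (mul_add _ u.1 w.1))
  map_zero' := AddMonoidHom.ext fun u => Subtype.ext (by
    change D.redNabla M hϖ 0 * u.1 = 0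
    rw [map_zero, zero_mul])
  map_add' X Y := AddMonoidHom.ext fun u => Subtype.ext (by
    change D.redNabla M hϖ (X + Y) * u.1 = D.redNabla M hϖ X * u.1 + D.redNabla M hϖ Y * u.1
    rw [map_add, add_mul])
  map_mul' X Y := AddMonoidHom.ext fun u => Subtype.ext (AddMonoidHom.ext fun v => by
    obtain ⟨F, hF, hu⟩ := u.2
    refine D.redNabla_mul_line M hϖ X Y ?_
    rw [← hu]
    exact D.red_range M hϖ F v)

/-- The conclusion about `φ_i^(c)` and `φ_j^(c)`: the reduced curvature does not vanish, none of
the four characteristic classes vanishes, and neither conormal module is trivial (a module being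
trivial when every element of the algebra acts as zero). -/
structure NonTrivial (hc : IsDeg c c) (i j : Fin n) : Prop where
  redCurvature_ne : D.redCurvature M hϖ (W.elt hc i) (W.elt hc j) ≠ 0
  redLieClass_ne : D.redLieClass M hϖ ≠ 0
  lieClass_ne : D.lieClass ≠ 0
  hochschildClass_ne : D.hochschildClass ≠ 0
  redHochschildClass_ne : D.redHochschildClass M hϖ ≠ 0
  redConormal_nontrivial : ∃ X u, D.redConormalAct M hϖ X u ≠ 0
  conormal_nontrivial : ∃ X u, D.conormal.left X u ≠ 0

end GradedConnection

/-! ### The ring of functions on the `p`-adic completion of `GL_n`, and Levi-Civita connections -/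

/-- The `p`-adic completion of a ring. -/
abbrev PCompl (p : ℕ) (B : Type*) [CommRing B] : Type _ :=
  AdicCompletion (Ideal.span {(p : B)}) B

instance PCompl.isAdicComplete (p : ℕ) (B : Type*) [CommRing B] :
    IsAdicComplete (Ideal.span {(p : PCompl p B)}) (PCompl p B) := by
  have h : (Ideal.span {(p : B)}).map (algebraMap B (PCompl p B)) =
      Ideal.span {(p : PCompl p B)} := by
    rw [Ideal.map_span, Set.image_singleton, map_natCast]
  rw [← h, IsAdicComplete.map_algebraMap_iff]
  exact AdicCompletion.isAdicComplete ⟨{(p : B)}, by simp⟩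

theorem span_pow_le_comap {p : ℕ} {B T : Type*} [CommRing B] [CommRing T] (f : B →+* T) (m : ℕ) :
    Ideal.span {(p : B)} ^ m ≤ (Ideal.span {(p : T)} ^ m).comap f := by
  refine Ideal.map_le_iff_le_comap.1 ?_
  rw [Ideal.map_pow, Ideal.map_span, Set.image_singleton, map_natCast]

section PExtend

variable {p : ℕ} {B T : Type*} [CommRing B] [CommRing T]

/-- The map from the completion of `B` to `T / p ^ m` induced by `f`. -/
noncomputable def pExtendMod (f : B →+* T) (m : ℕ) : PCompl p B →+* T ⧸ Ideal.span {(p : T)} ^ m :=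
  (Ideal.quotientMap (Ideal.span {(p : T)} ^ m) f (span_pow_le_comap f m)).comp
    (AdicCompletion.evalₐ (Ideal.span {(p : B)}) m : PCompl p B →+* B ⧸ Ideal.span {(p : B)} ^ m)

theorem pExtendMod_apply (f : B →+* T) (m : ℕ) (x : PCompl p B) :
    pExtendMod f m x = Ideal.quotientMap (Ideal.span {(p : T)} ^ m) f (span_pow_le_comap f m)
      (AdicCompletion.evalₐ (Ideal.span {(p : B)}) m x) := rfl

theorem pExtendMod_compat (f : B →+* T) {m l : ℕ} (hle : m ≤ l) :
    (Ideal.Quotient.factorPow (Ideal.span {(p : T)}) hle).comp (pExtendMod f l) =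
      pExtendMod f m := by
  refine RingHom.ext fun x => ?_
  induction x using AdicCompletion.induction_on with
  | h r =>
    rw [RingHom.comp_apply, pExtendMod_apply, pExtendMod_apply, AdicCompletion.evalₐ_mk, AdicCompletion.evalₐ_mk, ← AdicCompletion.Ideal.mk_eq_mk _ hle]
    simp

variable [IsAdicComplete (Ideal.span {(p : T)}) T]

/-- The unique extension of a ring homomorphism from `B` to a `p`-adically complete ring to the
`p`-adic completion of `B`. -/
noncomputable def pExtend (f : B →+* T) : PCompl p B →+* T :=
  IsAdicComplete.liftRingHom (Ideal.span {(p : T)}) (pExtendMod f) (pExtendMod_compat f)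

theorem pExtend_algebraMap (f : B →+* T) (b : B) :
    pExtend (p := p) f (algebraMap B (PCompl p B) b) = f b := by
  have key : ∀ b : B, ∀ m, Ideal.Quotient.mk (Ideal.span {(p : T)} ^ m)
      (pExtend (p := p) f (algebraMap B (PCompl p B) b)) = Ideal.Quotient.mk _ (f b) := by
    intro b m
    unfold pExtend
    rw [IsAdicComplete.mk_liftRingHom]
    rw [pExtendMod_apply, AlgHom.commutes]
    simp
  refine congrFun (IsHausdorff.funext' (Ideal.span {(p : T)})
    (f := fun b => pExtend (p := p) f (algebraMap B (PCompl p B) b)) (g := f) ?_) b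
  intro m b
  exact key b m

end PExtend

section GeneralLinear

variable (p : ℕ) (S : Type*) [CommRing S] (n : ℕ)

/-- The coordinate ring `S[x, det(x)⁻¹]` of `GL_n`. -/
abbrev OGL : Type _ := Localization.Away (Matrix.mvPolynomialX (Fin n) (Fin n) S).det

/-- The `p`-adic completion of `S[x, det(x)⁻¹]`. -/
abbrev AGL : Type _ := PCompl p (OGL S n)

/-- The map from polynomials in the entries of `x` to the completed coordinate ring. -/
noncomputable def polyToAGL : MvPolynomial (Fin n × Fin n) S →+* AGL p S n :=
  (algebraMap (OGL S n) (AGL p S n)).comp (algebraMap _ (OGL S n))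

/-- The generic matrix `x`. -/
noncomputable def genericMatrix : Matrix (Fin n) (Fin n) (AGL p S n) :=
  (Matrix.mvPolynomialX (Fin n) (Fin n) S).map (polyToAGL p S n)

theorem genericMatrix_det_isUnit : IsUnit (genericMatrix p S n).det := by
  have h : (genericMatrix p S n).det =
      polyToAGL p S n (Matrix.mvPolynomialX (Fin n) (Fin n) S).det := by
    rw [RingHom.map_det]; rfl
  rw [h]
  exact (IsLocalization.Away.algebraMap_isUnit (S := OGL S n)
    (Matrix.mvPolynomialX (Fin n) (Fin n) S).det).map (algebraMap (OGL S n) (AGL p S n))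

variable {S n}

/-- The entrywise power `a^(p^s)`. -/
def matPow {T : Type*} [CommRing T] (s : ℕ) (a : Matrix (Fin n) (Fin n) T) :
    Matrix (Fin n) (Fin n) T := a.map (· ^ p ^ s)

theorem matPow_det_isUnit {T : Type*} [CommRing T] [hp : Fact p.Prime]
    [IsAdicComplete (Ideal.span {(p : T)}) T] (s : ℕ) {a : Matrix (Fin n) (Fin n) T}
    (ha : IsUnit a.det) : IsUnit (matPow p s a).det := by
  have hloc : IsLocalHom (Ideal.Quotient.mk (Ideal.span {(p : T)})) :=
    isLocalHom_of_le_jacobson_bot _ (IsAdicComplete.le_jacobson_bot _)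
  refine (isUnit_map_iff (Ideal.Quotient.mk (Ideal.span {(p : T)})) _).1 ?_
  cases subsingleton_or_nontrivial (T ⧸ Ideal.span {(p : T)}) with
  | inl h => exact isUnit_of_subsingleton _
  | inr h =>
    have : CharP (T ⧸ Ideal.span {(p : T)}) p :=
      (CharP.charP_iff_prime_eq_zero hp.out).2 (by
        have := Ideal.Quotient.eq_zero_iff_mem.2 (Ideal.mem_span_singleton_self (p : T))
        rwa [map_natCast] at this)
    have h : (Ideal.Quotient.mk (Ideal.span {(p : T)})) (matPow p s a).det =
        iterateFrobenius _ p s ((Ideal.Quotient.mk (Ideal.span {(p : T)})) a.det) := by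
      rw [RingHom.map_det, RingHom.map_det, RingHom.map_det]
      congr 1
    rw [h]
    exact (ha.map _).map _

/-- The ring endomorphism of the completed coordinate ring acting on the coefficients through `ψ`
and sending `x` to the invertible matrix `Y`. -/
noncomputable def substGL {p : ℕ} (ψ : S →+* AGL p S n) (Y : Matrix (Fin n) (Fin n) (AGL p S n))
    (hY : IsUnit Y.det) : AGL p S n →+* AGL p S n :=
  pExtend (IsLocalization.Away.lift (S := OGL S n)
    (g := MvPolynomial.eval₂Hom ψ (fun t : Fin n × Fin n => Y t.1 t.2))
    (Matrix.mvPolynomialX (Fin n) (Fin n) S).det (by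
      rw [RingHom.map_det]
      convert hY
      ext i j
      simp))

/-- The trivial lift `x ↦ x^(p^s)`, `φ` on the coefficients. -/
noncomputable def trivialLift {p : ℕ} [Fact p.Prime] (s : ℕ) (φ : S →+* S) : AGL p S n →+* AGL p S n :=
  substGL ((algebraMap S (AGL p S n)).comp φ) (matPow p s (genericMatrix p S n))
    (matPow_det_isUnit p s (genericMatrix_det_isUnit p S n))

/-- The `S`-algebra homomorphism `x ↦ x^t q x`. -/
noncomputable def metricHom {p : ℕ} (q : Matrix (Fin n) (Fin n) S) (hq : IsUnit q.det) :
    AGL p S n →+* AGL p S n :=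
  substGL (algebraMap S (AGL p S n))
    ((genericMatrix p S n).transpose * q.map (algebraMap S (AGL p S n)) * genericMatrix p S n) (by
      have h : (q.map (algebraMap S (AGL p S n))).det = algebraMap S (AGL p S n) q.det := by
        rw [RingHom.map_det]; rfl
      rw [Matrix.det_mul, Matrix.det_mul, Matrix.det_transpose, h]
      exact ((genericMatrix_det_isUnit p S n).mul (hq.map _)).mul (genericMatrix_det_isUnit p S n))

/-- The ideal `𝓜 = (ϖ, x - 1)`. -/
noncomputable def maxIdealOne (ϖ : S) : Ideal (AGL p S n) :=
  Ideal.span ({algebraMap S (AGL p S n) ϖ} ∪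
    Set.range fun t : Fin n × Fin n => (genericMatrix p S n - 1) t.1 t.2)

theorem mem_maxIdealOne (ϖ : S) : algebraMap S (AGL p S n) ϖ ∈ maxIdealOne p (n := n) ϖ :=
  Ideal.subset_span (Or.inl rfl)

/-- A metric: a symmetric invertible matrix. -/
def IsMetric (q : Matrix (Fin n) (Fin n) S) : Prop := q.IsSymm ∧ IsUnit q.det

variable (S n)

/-- Torsion symbols of the second kind: `n`-tuples of antisymmetric matrices over the completed
polynomial ring in the entries of an `n`-tuple `y = (y_1, …, y_n)` of `n × n` matrices. The variable
`(m, i, j)` is the `ij`-entry of `y_m`. -/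
structure TorsionSymbol where
  mat : Fin n → Matrix (Fin n) (Fin n) (PCompl p (MvPolynomial (Fin n × Fin n × Fin n) S))
  antisymm : ∀ k, (mat k).transpose = -mat k

variable {p S n}

/-- The value `L^k_{ij}(Y_1, …, Y_n)`. -/
noncomputable def TorsionSymbol.eval (L : TorsionSymbol p S n)
    (Y : Fin n → Matrix (Fin n) (Fin n) (AGL p S n)) (k i j : Fin n) : AGL p S n :=
  pExtend (MvPolynomial.eval₂Hom (algebraMap S (AGL p S n))
    (fun t : Fin n × Fin n × Fin n => Y t.1 t.2.1 t.2.2)) (L.mat k i j)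

/-- The condition `L(1) = 0`, where `L(1)` is obtained by setting all `y_m` equal to the identity
matrix. -/
def TorsionSymbol.VanishesAtOne (L : TorsionSymbol p S n) : Prop :=
  ∀ k i j, L.eval (fun _ => 1) k i j = 0

namespace GradedConnection

variable {ϖ : S} {c : ℕ} {W : WeilMonoid p ϖ c n} (D : GradedConnection W (AGL p S n))

/-- The Christoffel symbols of the second kind `Γ^k_{ij} = (Γ_i^t)_{kj}` of degree `s`, where
`Γ_i^t = (x^(p^s))⁻¹ δ_i(x)`. -/
noncomputable def christoffel (s : ℕ) (k i j : Fin n) : AGL p S n :=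
  ((matPow p s (genericMatrix p S n))⁻¹ *
    (genericMatrix p S n).map (piDer p s (algebraMap S (AGL p S n) ϖ) (D.frobG s i))) k j

/-- The matrices `Λ_i = (x^(p^s))⁻¹ φ_i(x)`. -/
noncomputable def lambdaMat (s : ℕ) (i : Fin n) : Matrix (Fin n) (Fin n) (AGL p S n) :=
  (matPow p s (genericMatrix p S n))⁻¹ * (genericMatrix p S n).map (D.frobG s i)

/-- The component of degree `s` is metric with respect to `q`: the squares formed by `x ↦ x^t q x`,
the trivial lifts and the `φ_i^G` commute. -/
def MetricWith [Fact p.Prime] (s : ℕ) (q : Matrix (Fin n) (Fin n) S) (hq : IsUnit q.det) : Prop :=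
  ∀ i, (metricHom q hq).comp (trivialLift s (W.frob s i)) = (D.frobG s i).comp (metricHom q hq)

/-- The component of degree `s` is symmetric with respect to the torsion symbol `L`. -/
def SymmetricWith (s : ℕ) (L : TorsionSymbol p S n) : Prop :=
  ∀ k i j, D.christoffel s k i j - D.christoffel s k j i = L.eval (D.lambdaMat s) k i j

/-- `∇` is the graded arithmetic Levi-Civita connection attached to the metrics `q^(s)` and the
torsion symbols `L^(s)`. -/
def IsLeviCivita [Fact p.Prime] (q : ℕ → Matrix (Fin n) (Fin n) S)
    (hq : ∀ s, IsDeg c s → IsMetric (q s)) (L : ℕ → TorsionSymbol p S n) : Prop :=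
  ∀ s (hs : IsDeg c s), D.MetricWith s (q s) (hq s hs).2 ∧ D.SymmetricWith s (L s)

end GradedConnection

end GeneralLinear

/-! ### The arithmetic setting -/

section Arithmetic

variable (p : ℕ) [hp : Fact p.Prime]

/-- The field `k`, an algebraic closure of the field with `p` elements. -/
abbrev resField : Type := AlgebraicClosure (ZMod p)

/-- The ring `R`, the completion of the maximal unramified extension of the `p`-adic integers,
realised as the ring of Witt vectors of `k`. -/
abbrev unramRing : Type := WittVector p (resField p)

/-- An algebraic closure of the fraction field `K` of `R`. -/
abbrev algClosureK : Type := AlgebraicClosure (FractionRing (unramRing p))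

/-- The canonical map from the `p`-adic integers, the Witt vectors of the field with `p` elements,
to `R`. -/
noncomputable def padicIntToR : ℤ_[p] →+* unramRing p :=
  (WittVector.map (algebraMap (ZMod p) (resField p))).comp
    (WittVector.equiv p).symm.toRingHom

theorem padicIntToR_injective : Function.Injective (padicIntToR p) :=
  (WittVector.map_injective _ (algebraMap (ZMod p) (resField p)).injective).comp
    (WittVector.equiv p).symm.injective

/-- The canonical embedding of the field of `p`-adic numbers. -/
noncomputable def padicEmbedding : ℚ_[p] →+* algClosureK p :=
  IsFractionRing.lift (A := ℤ_[p])
    (g := ((algebraMap (FractionRing (unramRing p)) (algClosureK p)).comp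
      (algebraMap (unramRing p) (FractionRing (unramRing p)))).comp (padicIntToR p))
    (((algebraMap (FractionRing (unramRing p)) (algClosureK p)).injective.comp
      (IsFractionRing.injective (unramRing p) (FractionRing (unramRing p)))).comp
      (padicIntToR_injective p))

variable {p}

/-- The ring `R_π = R[π]`. -/
abbrev ramRing (b : algClosureK p) : Type := ↥(Algebra.adjoin (unramRing p) {b})

/-- `π` as an element of `R[π]`. -/
def ramPi (b : algClosureK p) : ramRing b := ⟨b, Algebra.subset_adjoin rfl⟩

/-- The Teichmüller lift `k → R → R_π`, a bijection of `k` onto the set consisting of `0` and of the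
roots of unity of `R`. -/
noncomputable def teichPi (b : algClosureK p) (a : resField p) : ramRing b :=
  algebraMap (unramRing p) (ramRing b) (WittVector.teichmuller p a)

/-- `c₀` and `c₁` are the first two coefficients of the `π`-adic expansion of `q`, that is
`q_{ij} ≡ [c₀]_{ij} + [c₁]_{ij} π` modulo `π ^ 2`. -/
def HasCoeffs {b : algClosureK p} {n : ℕ} (q : Matrix (Fin n) (Fin n) (ramRing b))
    (c₀ c₁ : Matrix (Fin n) (Fin n) (resField p)) : Prop :=
  ∀ i j, ramPi b ^ 2 ∣ q i j - (teichPi b (c₀ i j) + teichPi b (c₁ i j) * ramPi b)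

end Arithmetic

set_option linter.unusedSectionVars false

/-! ### Residue maps and Frobenius lifts -/

/-! Everything is read off at the point `x = 1` modulo `ϖ ^ 2`. Write `e i` for the residue of `δ_i
ϖ`, which is non-zero because `φ_i` fixes `p`, a unit times `ϖ ^ e`. Let `g i` be the residue at `x
= 1` of the matrix `δ_i^G x` in degree `c`. Evaluation at `x = 1` gives a coordinate `M / M ^ 2 → k`
along `[ϖ]` (`exists_unifCoord`). In this coordinate `∇_{φ_i}` sends the class of `(x - 1)_{ab}` to
`(g i)_{ab}`, and on the line of `[ϖ]` it is `v ↦ e i * v ^ p ^ c`. Since the `φ_i` commute, the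
curvature has coordinate `e i * (g j)_{ab} ^ p ^ c - e j * (g i)_{ab} ^ p ^ c`.

At `x = 1` the Levi-Civita conditions become the classical ones. With `Q` the matrix of `p ^ c`-th
powers of the residues of the metric and `T i = Q * g i`, the symmetric part of `T i` is governed by
the derivative of the metric (`MetricWith.at_one`), and the torsion condition exchanges two indices
of `T` (`SymmetricWith.at_one`). As in the Koszul formula, the antisymmetric part of `T i` is then a
difference of derivatives of the metric (`metric_antisymm_eq`). If all curvature coordinates
vanished, `T i` and `T j` would be proportional after the twist by Frobenius, and this makes the
Kulkarni-Nomizu expression vanish modulo `ϖ`.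

The classes are separated from zero by a grading. An endomorphism of degree `s` multiplies scalars
through `a ↦ a ^ p ^ s`, so different degrees are independent over an infinite field
(`coord_eq_zero`). For a commuting pair a coboundary would write the curvature, of degree `2c`,
through left multiplications by `∇` of elements of degree at least `2c`, hence in degree at least
`3c`. For the unreduced classes one also needs that the kernel reduces into degrees at least `2c`,
which is independence of characters (`red_kernel_mem`), and that the coordinate of the reduction
descends to `N / N ^ 2` (`coord_red_idealSq`). The Hochschild classes follow from the Lie ones by
antisymmetrization, and the modules are non-trivial because `e i ≠ 0`.

For the coefficients of a metric, a Frobenius lift sends Teichmüller representatives to their `p ^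
s`-th powers modulo `ϖ ^ 2`, so `δ_i q` modulo `ϖ` sees only `c₁` (`map_piDer_of_coeffs`). The
obstruction is then a `p ^ (2c)`-th power of a linear form in `c₁` (`map_kulkarniNomizu`).

These arguments use only a residue map in the sense of `IsResidueMap`, with noetherianity and
locality of the map where needed. For `R[π]` it is obtained by adjoining to `R` the whole ring of
integers of `E`: the result is a finite local domain with residue field `k`, and Nakayama shows that
`π` alone generates it. -/

theorem IsFrobLift.apply_eq {p s : ℕ} {A : Type*} [CommRing A] {ϖ : A} {φ : A →+* A}
    (h : IsFrobLift p s ϖ φ) (a : A) : φ a = a ^ p ^ s + ϖ * piDer p s ϖ φ a := by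
  have h1 : ϖ ∣ φ a - a ^ p ^ s := h a
  unfold piDer
  rw [dif_pos h1, ← h1.choose_spec]
  ring

/-- `r` is the residue map of a domain `S` of mixed characteristic in which `ϖ` generates the
kernel of `r` and `p` is a unit times a power of `ϖ`. -/
structure IsResidueMap (p : ℕ) {S k : Type*} [CommRing S] [Field k] (ϖ : S) (r : S →+* k) :
    Prop where
  surjective : Function.Surjective r
  eq_zero_iff : ∀ x, r x = 0 ↔ ϖ ∣ x
  ne_zero : ϖ ≠ 0
  exists_unit : ∃ (e : ℕ) (u : S), IsUnit u ∧ (p : S) = u * ϖ ^ e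

namespace IsResidueMap

variable {p : ℕ} [hp : Fact p.Prime] {S k : Type*} [CommRing S] [IsDomain S] [Field k] [CharP k p]
  {ϖ : S} {r : S →+* k}

theorem map_unif (hr : IsResidueMap p ϖ r) : r ϖ = 0 := (hr.eq_zero_iff ϖ).2 dvd_rfl

theorem map_p (_ : IsResidueMap p ϖ r) : r p = 0 := by
  rw [map_natCast, CharP.cast_eq_zero]

theorem eq_iff (hr : IsResidueMap p ϖ r) (x y : S) : r x = r y ↔ ϖ ∣ x - y := by
  rw [← hr.eq_zero_iff, map_sub, sub_eq_zero]

/-- Turns a first order congruence modulo `ϖ ^ 2` into an equation in `k`; most residue computations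
below end here. -/
theorem sq_dvd_mul_iff (hr : IsResidueMap p ϖ r) (y : S) : ϖ ^ 2 ∣ ϖ * y ↔ r y = 0 := by
  rw [hr.eq_zero_iff, pow_two, mul_dvd_mul_iff_left hr.ne_zero]

/-- Powers with exponent divisible by `p` of elements congruent modulo `ϖ` are congruent
modulo `ϖ ^ 2`. -/
theorem pow_congr (hr : IsResidueMap p ϖ r) {x y : S} (h : r x = r y) {m : ℕ} (hm : p ∣ m) :
    ϖ ^ 2 ∣ x ^ m - y ^ m := by
  obtain ⟨l, rfl⟩ := hm
  have h1 : ϖ ^ 2 ∣ x ^ p - y ^ p := by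
    rw [← geom_sum₂_mul, pow_two]
    refine mul_dvd_mul ((hr.eq_zero_iff _).1 ?_) ((hr.eq_iff _ _).1 h)
    rw [map_sum]
    simp only [map_mul, map_pow, h, ← pow_add]
    -- All `p` terms of the geometric sum have the same residue, so the sum is zero in
    -- characteristic `p`.
    rw [Finset.sum_congr rfl (g := fun _ => r y ^ (p - 1))]
    · simp
    · intro i hi
      rw [Finset.mem_range] at hi
      congr 1
      omega
  rw [pow_mul, pow_mul]
  exact h1.trans (sub_dvd_pow_sub_pow _ _ _)

theorem dvd_ppow {s : ℕ} (hs : 0 < s) : p ∣ p ^ s := dvd_pow_self p hs.ne'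

theorem map_frob (hr : IsResidueMap p ϖ r) {s : ℕ} {φ : S →+* S} (h : IsFrobLift p s ϖ φ) (a : S) :
    r (φ a) = r a ^ p ^ s := by
  rw [h.apply_eq, map_add, map_mul, hr.map_unif, zero_mul, add_zero, map_pow]

/-- `piDer` is defined by a choice of quotient; cancelling `ϖ` in a domain makes the choice unique.
-/
theorem piDer_eq (hr : IsResidueMap p ϖ r) {s : ℕ} {φ : S →+* S} {a z : S}
    (h : φ a = a ^ p ^ s + ϖ * z) : piDer p s ϖ φ a = z := by
  have h1 : ϖ ∣ φ a - a ^ p ^ s := ⟨z, by rw [h]; ring⟩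
  unfold piDer
  rw [dif_pos h1]
  apply mul_left_cancel₀ hr.ne_zero
  rw [← h1.choose_spec, h]
  ring

/-- The unit `φ ϖ / ϖ`. -/
theorem frob_unif (hr : IsResidueMap p ϖ r) {s : ℕ} (hs : 0 < s) {φ : S →+* S}
    (h : IsFrobLift p s ϖ φ) : ∃ w, φ ϖ = ϖ * w ∧ r w = r (piDer p s ϖ φ ϖ) := by
  have h2 : 2 ≤ p ^ s := hp.out.two_le.trans (Nat.le_self_pow hs.ne' p)
  refine ⟨ϖ ^ (p ^ s - 1) + piDer p s ϖ φ ϖ, ?_, ?_⟩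
  · rw [h.apply_eq ϖ, mul_add, ← pow_succ', Nat.sub_add_cancel (by omega)]
  · rw [map_add, map_pow, hr.map_unif, zero_pow (by omega), zero_add]

/-- Apply `φ` to `p = u * ϖ ^ e`, with `φ ϖ = ϖ * w`: since `φ` fixes `p`, cancellation gives `u = φ
u * w ^ e` with `e ≠ 0`, so `w` cannot reduce to zero. -/
theorem piDer_unif_ne (hr : IsResidueMap p ϖ r) {s : ℕ} (hs : 0 < s) {φ : S →+* S}
    (h : IsFrobLift p s ϖ φ) : r (piDer p s ϖ φ ϖ) ≠ 0 := by
  obtain ⟨w, hw, hrw⟩ := hr.frob_unif hs h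
  rw [← hrw]
  obtain ⟨e, u, hu, he⟩ := hr.exists_unit
  have h1 := congrArg φ he
  rw [map_natCast, map_mul, map_pow, hw, he, mul_pow, mul_left_comm, mul_comm] at h1
  have h2 := mul_left_cancel₀ (pow_ne_zero e hr.ne_zero) h1
  have he0 : e ≠ 0 := by
    rintro rfl
    have := hr.map_p
    rw [he, pow_zero, mul_one] at this
    exact (hu.map r).ne_zero this
  intro hw0
  refine (hu.map r).ne_zero ?_
  rw [h2, map_mul, map_pow, hw0, zero_pow he0, mul_zero]

/-- The derivation attached to a composition, modulo `ϖ`. -/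
theorem map_piDer_comp (hr : IsResidueMap p ϖ r) {s t : ℕ} (hs : 0 < s) (ht : 0 < t)
    {φ ψ : S →+* S} (hφ : IsFrobLift p s ϖ φ) (hψ : IsFrobLift p t ϖ ψ) (a : S) :
    r (piDer p (s + t) ϖ (φ.comp ψ) a) = r (piDer p s ϖ φ ϖ) * r (piDer p t ϖ ψ a) ^ p ^ s := by
  obtain ⟨w, hw, hrw⟩ := hr.frob_unif hs hφ
  -- Raising `φ a ≡ a ^ p ^ s` to the power `p ^ t` gains a factor `ϖ`. Modulo `ϖ` only `φ (ϖ * δ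
  -- a)` contributes to the derivation of the composite.
  obtain ⟨d, hd⟩ := hr.pow_congr (x := φ a) (y := a ^ p ^ s) (by rw [hr.map_frob hφ, map_pow])
    (dvd_ppow ht)
  have key : (φ.comp ψ) a = a ^ p ^ (s + t) + ϖ * (ϖ * d + w * φ (piDer p t ϖ ψ a)) := by
    rw [RingHom.comp_apply, hψ.apply_eq a, map_add, map_mul, map_pow, hw, pow_add, pow_mul,
      sub_eq_iff_eq_add.1 hd]
    ring
  rw [hr.piDer_eq key, map_add, map_mul, hr.map_unif, zero_mul, zero_add, map_mul, hrw,
    hr.map_frob hφ]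

/-- A Frobenius lift acts on multiplicative representatives as on the residue field, modulo
`ϖ ^ 2`. -/
theorem frob_teich [IsAlgClosed k] (hr : IsResidueMap p ϖ r) (t : k →* S)
    {s : ℕ} {φ : S →+* S} (h : IsFrobLift p s ϖ φ) (a : k) :
    ϖ ^ 2 ∣ φ (t a) - t a ^ p ^ s := by
  -- Extracting a `p`-th root in `k` turns a congruence modulo `ϖ` for the root into one modulo `ϖ ^
  -- 2` for `a`.
  obtain ⟨b, rfl⟩ := IsAlgClosed.exists_pow_nat_eq a hp.out.pos
  rw [map_pow, map_pow, pow_right_comm]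
  exact hr.pow_congr (by rw [hr.map_frob h, map_pow]) dvd_rfl

/-- The value of a higher derivation modulo `ϖ` in terms of the first two coefficients of the
`ϖ`-adic expansion. -/
theorem map_piDer_of_coeffs [IsAlgClosed k] (hr : IsResidueMap p ϖ r) {t : k →* S}
    (ht : ∀ a, r (t a) = a) {s : ℕ} (hs : 0 < s) {φ : S →+* S} (h : IsFrobLift p s ϖ φ) {q : S}
    {c₀ c₁ : k} (hq : ϖ ^ 2 ∣ q - (t c₀ + t c₁ * ϖ)) :
    r (piDer p s ϖ φ q) = c₁ ^ p ^ s * r (piDer p s ϖ φ ϖ) := by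
  obtain ⟨w, hw, hrw⟩ := hr.frob_unif hs h
  rw [← hrw, ← sub_eq_zero]
  have e : c₁ ^ p ^ s * r w = r (t c₁ ^ p ^ s * w) := by rw [map_mul, map_pow, ht]
  rw [e, ← map_sub, ← hr.sq_dvd_mul_iff]
  have h1 : ϖ ^ 2 ∣ φ (q - (t c₀ + t c₁ * ϖ)) := by
    refine dvd_trans ?_ (map_dvd φ hq)
    rw [map_pow, hw, mul_pow]
    exact dvd_mul_right _ _
  have h2 := hr.frob_teich t h c₀
  have h3 : ϖ ^ 2 ∣ ϖ * (w * (φ (t c₁) - t c₁ ^ p ^ s)) := by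
    rw [hr.sq_dvd_mul_iff, map_mul, map_sub, hr.map_frob h, map_pow, sub_self, mul_zero]
  have h4 : ϖ ^ 2 ∣ q ^ p ^ s - t c₀ ^ p ^ s := by
    refine hr.pow_congr ?_ (dvd_ppow hs)
    have := (hr.eq_iff _ _).2 ((dvd_pow_self ϖ two_ne_zero).trans hq)
    rw [this, map_add, map_mul, hr.map_unif, mul_zero, add_zero]
  -- The four congruences replace `φ q` by `φ` of its expansion, apply `φ` to the two Teichmüller
  -- terms, and replace `q ^ p ^ s` by `t c₀ ^ p ^ s`. The terms in `c₀` cancel.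
  have h5 := dvd_sub (dvd_add (dvd_add h1 h2) h3) h4
  convert h5 using 1
  have e1 : ϖ * piDer p s ϖ φ q = φ q - q ^ p ^ s := by rw [h.apply_eq q]; ring
  rw [mul_sub, e1]
  simp only [map_sub, map_add, map_mul, hw]
  ring

end IsResidueMap

/-! ### The graded pieces of the endomorphisms of the cotangent space -/

section BSpaceGE

variable {A : Type*} [CommRing A] (p : ℕ) (M : Ideal A) {ϖ : A} (hϖ : ϖ ∈ M)

/-- `𝔟^(≥ ec)`: the sum of the `𝔟^(s)` with `s ≥ ec` a positive multiple of `c`. -/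
def bSpaceGE (c e : ℕ) : AddSubgroup (AddMonoid.End M.Cotangent) :=
  ⨆ (s : ℕ) (_ : IsDeg c s ∧ e * c ≤ s), bSpace p M hϖ s

variable {p M hϖ}

theorem mem_bSpaceGE {c e s : ℕ} (hs : IsDeg c s) (he : e * c ≤ s) {u : AddMonoid.End M.Cotangent}
    (hu : u ∈ bSpace p M hϖ s) : u ∈ bSpaceGE p M hϖ c e :=
  AddSubgroup.mem_iSup_of_mem s (AddSubgroup.mem_iSup_of_mem ⟨hs, he⟩ hu)

theorem bSpaceGE_induction {c e : ℕ} {P : AddMonoid.End M.Cotangent → Prop}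
    (hmem : ∀ s, IsDeg c s → e * c ≤ s → ∀ u ∈ bSpace p M hϖ s, P u) (hzero : P 0)
    (hadd : ∀ u w, P u → P w → P (u + w)) {u : AddMonoid.End M.Cotangent}
    (hu : u ∈ bSpaceGE p M hϖ c e) : P u := by
  refine AddSubgroup.iSup_induction' (C := fun u _ => P u) _ (fun s u hu => ?_) hzero
    (fun u w _ _ => hadd u w) hu
  refine AddSubgroup.iSup_induction' (C := fun u _ => P u) _ (fun hs u hu => ?_) hzero
    (fun u w _ _ => hadd u w) hu
  exact hmem s hs.1 hs.2 u hu

theorem aSpaceGE_le_bSpaceGE (c e : ℕ) : aSpaceGE p M hϖ c e ≤ bSpaceGE p M hϖ c e :=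
  iSup_mono fun _ => iSup_mono fun _ _ hu => hu.1

/-- Degrees add under composition; this lifts the terms of a coboundary strictly above degree `2c`.
-/
theorem bSpace_mul_bSpaceGE {c e : ℕ} {u w : AddMonoid.End M.Cotangent}
    (hc : IsDeg c c) (hu : u ∈ bSpace p M hϖ c) (hw : w ∈ bSpaceGE p M hϖ c e) :
    u * w ∈ bSpaceGE p M hϖ c (e + 1) := by
  refine bSpaceGE_induction (P := fun w => u * w ∈ bSpaceGE p M hϖ c (e + 1))
    (fun s hs he w hw => ?_) ?_ (fun w w' h h' => ?_) hw
  · refine mem_bSpaceGE (hc.add hs) ?_ (bSpace_mul hu hw)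
    rw [add_mul, one_mul, add_comm]
    exact Nat.add_le_add_left he c
  · rw [mul_zero]; exact zero_mem _
  · rw [mul_add]; exact add_mem h h'

end BSpaceGE

/-- A residue map `A → k` extending `r`, together with the coordinate along `[ϖ]` of a semilinear
splitting of `k · [ϖ] ⊆ M / M ^ 2`. -/
structure UnifCoord {S k A : Type*} [CommRing S] [Field k] [CommRing A] [Algebra S A]
    (r : S →+* k) (M : Ideal A) {ϖ : S} (hϖ : algebraMap S A ϖ ∈ M) where
  res : A →+* k
  res_algebraMap : ∀ s, res (algebraMap S A s) = r s
  coord : M.Cotangent →+ k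
  coord_smul : ∀ (a : A) v, coord (Ideal.Quotient.mk M a • v) = res a * coord v
  coord_unif : coord (M.toCotangent ⟨_, hϖ⟩) = 1

namespace UnifCoord

variable {p : ℕ} [hp : Fact p.Prime] {S k A : Type*} [CommRing S] [Field k] [CommRing A]
  [Algebra S A] {r : S →+* k} {M : Ideal A} {ϖ : S} {hϖ : algebraMap S A ϖ ∈ M}
  (κ : UnifCoord r M hϖ)

theorem exists_of_mem_line {v : M.Cotangent} (hv : v ∈ piLine M hϖ) :
    ∃ a, v = Ideal.Quotient.mk M a • M.toCotangent ⟨_, hϖ⟩ ∧ κ.coord v = κ.res a := by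
  obtain ⟨a, rfl⟩ := Submodule.mem_span_singleton.1 hv
  obtain ⟨a, rfl⟩ := Ideal.Quotient.mk_surjective a
  exact ⟨a, rfl, by rw [κ.coord_smul, κ.coord_unif, mul_one]⟩

/-- Elements of `𝔟^(≥ ec)` are polynomial in the scalar, without terms of degree less
than `p ^ (ec)`. -/
theorem exists_polynomial {c e : ℕ} {u : AddMonoid.End M.Cotangent}
    (hu : u ∈ bSpaceGE p M hϖ c e) (v : M.Cotangent) :
    ∃ f : Polynomial k, (∀ j < p ^ (e * c), f.coeff j = 0) ∧
      ∀ a, κ.coord (u (Ideal.Quotient.mk M a • v)) = f.eval (κ.res a) := by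
  refine bSpaceGE_induction (P := fun u => ∃ f : Polynomial k,
    (∀ j < p ^ (e * c), f.coeff j = 0) ∧
      ∀ a, κ.coord (u (Ideal.Quotient.mk M a • v)) = f.eval (κ.res a))
    (fun s hs he u hu => ?_) ⟨0, by simp, fun a => by simp⟩ ?_ hu
  · refine ⟨Polynomial.C (κ.coord (u v)) * Polynomial.X ^ p ^ s, fun j hj => ?_, fun a => ?_⟩
    · rw [Polynomial.coeff_C_mul_X_pow, if_neg]
      exact (hj.trans_le (Nat.pow_le_pow_right hp.out.pos he)).ne
    · rw [hu.1, ← map_pow, κ.coord_smul, map_pow, Polynomial.eval_C_mul, Polynomial.eval_pow,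
        Polynomial.eval_X, mul_comm]
  · rintro u w ⟨f, hf, hf'⟩ ⟨g, hg, hg'⟩
    refine ⟨f + g, fun j hj => by rw [Polynomial.coeff_add, hf j hj, hg j hj, add_zero],
      fun a => ?_⟩
    change κ.coord (u _ + w _) = _
    rw [map_add, hf', hg', Polynomial.eval_add]

/-- The sum of the `𝔟^(s)` is direct. -/
theorem coord_eq_zero [Infinite k] (hr : Function.Surjective r) {c e s : ℕ}
    (hs : s < e * c) {u w : AddMonoid.End M.Cotangent} (hu : u ∈ bSpace p M hϖ s)
    (hw : w ∈ bSpaceGE p M hϖ c e) (h : ∀ v, κ.coord (u v) = κ.coord (w v)) (v : M.Cotangent) :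
    κ.coord (u v) = 0 := by
  obtain ⟨f, hf, hf'⟩ := κ.exists_polynomial hw v
  -- The values of `r` fill the infinite field `k`, so two polynomial functions that agree there are
  -- equal as polynomials. One is a monomial of degree `p ^ s`, below every exponent allowed in the
  -- other.
  have key : f = Polynomial.C (κ.coord (u v)) * Polynomial.X ^ p ^ s := by
    refine Polynomial.funext fun x => ?_
    obtain ⟨y, rfl⟩ := hr x
    rw [← κ.res_algebraMap, ← hf', ← h, hu.1, ← map_pow, κ.coord_smul, map_pow,
      Polynomial.eval_C_mul, Polynomial.eval_pow, Polynomial.eval_X, mul_comm]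
  have := hf (p ^ s) (Nat.pow_lt_pow_right hp.out.one_lt hs)
  rwa [key, Polynomial.coeff_C_mul_X_pow, if_pos rfl] at this

/-- An element of `𝔟^(≥ ec)` that kills the image of `ϖ S` kills the line `k · [ϖ]`, as seen by
the coordinate. -/
theorem coord_line_eq_zero [Infinite k] (hr : Function.Surjective r) {c e : ℕ}
    {u : AddMonoid.End M.Cotangent} (hu : u ∈ bSpaceGE p M hϖ c e)
    (h : ∀ s : S, u (Ideal.Quotient.mk M (algebraMap S A s) • M.toCotangent ⟨_, hϖ⟩) = 0)
    {v : M.Cotangent} (hv : v ∈ piLine M hϖ) : κ.coord (u v) = 0 := by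
  obtain ⟨a, rfl, -⟩ := κ.exists_of_mem_line hv
  obtain ⟨f, -, hf'⟩ := κ.exists_polynomial hu (M.toCotangent ⟨_, hϖ⟩)
  -- Scalars from `S` are enough, since their residues already exhaust `k`.
  have key : f = 0 := by
    refine Polynomial.funext fun x => ?_
    obtain ⟨y, rfl⟩ := hr x
    rw [← κ.res_algebraMap, ← hf', h, map_zero, Polynomial.eval_zero]
  rw [hf', key, Polynomial.eval_zero]

end UnifCoord

/-! ### Homogeneous components of the Atiyah extension -/

namespace GradedConnection

variable {p : ℕ} [hp : Fact p.Prime] {S k A : Type*} [CommRing S] [IsDomain S] [Field k]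
  [CharP k p] [Infinite k] [CommRing A] [Algebra S A] {ϖ : S} {c n : ℕ} {W : WeilMonoid p ϖ c n}
  (D : GradedConnection W A) {r : S →+* k} {M : Ideal A} {hϖ : algebraMap S A ϖ ∈ M}
  (κ : UnifCoord r M hϖ)

/-- Frobenius lifts of different degrees are different. -/
theorem degree_eq_of_frob_eq (W : WeilMonoid p ϖ c n) (hr : IsResidueMap p ϖ r) {s t : ℕ}
    (hs : IsDeg c s) (ht : IsDeg c t) {i j : Fin n} (h : W.frob s i = W.frob t j) : s = t := by
  have key : (Polynomial.X ^ p ^ s : Polynomial k) = Polynomial.X ^ p ^ t := by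
    refine Polynomial.funext fun x => ?_
    obtain ⟨y, rfl⟩ := hr.surjective x
    have h1 := hr.map_frob (W.isFrobLift s hs i) y
    rw [h, hr.map_frob (W.isFrobLift t ht j) y] at h1
    simp [h1]
  have := congrArg Polynomial.natDegree key
  rw [Polynomial.natDegree_X_pow, Polynomial.natDegree_X_pow] at this
  exact Nat.pow_right_injective hp.out.two_le this

/-- On the line only the action on the base matters: `∇` sends `[ϖ]` to the class of `φ ϖ = ϖ * w`,
and the rest is semilinearity. -/
theorem redNabla_coord (hr : IsResidueMap p ϖ r) {s : ℕ} (hs : IsDeg c s) (i : Fin n)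
    {v : M.Cotangent} (hv : v ∈ piLine M hϖ) :
    κ.coord (D.redNabla M hϖ (W.elt hs i) v) =
      r (piDer p s ϖ (W.frob s i) ϖ) * κ.coord v ^ p ^ s := by
  obtain ⟨a, rfl, ha⟩ := κ.exists_of_mem_line hv
  rw [(D.redNabla_elt_mem M hϖ hs i).1, ← map_pow, κ.coord_smul, ha, map_pow, mul_comm,
    redNabla_line]
  congr 1
  obtain ⟨w, hw, hrw⟩ := hr.frob_unif hs.1 (W.isFrobLift s hs i)
  rw [← hrw, ← κ.res_algebraMap, ← mul_one (κ.res _), ← κ.coord_unif, ← κ.coord_smul]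
  congr 1
  change _ = algebraMap S A w • M.toCotangent _
  rw [← map_smul]
  refine congrArg M.toCotangent (Subtype.ext ?_)
  change algebraMap S A (W.frob s i ϖ) = algebraMap S A w * algebraMap S A ϖ
  rw [hw, map_mul, mul_comm]

/-- Products of the lifts are homogeneous, and those of degree `c` are single lifts. -/
theorem productMonoid_cases {f : AddMonoid.End A} (hf : f ∈ D.productMonoid)
    (hfA : f ∈ D.atiyah) : ∃ s, ∃ _ : IsDeg c s, ∃ i : Fin n,
      (∀ a, f (algebraMap S A a) = algebraMap S A (W.frob s i a)) ∧
      D.red M hϖ ⟨f, hfA⟩ ∈ bSpace p M hϖ s ∧ (s = c → f = ringEnd (D.frobG c i)) := by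
  unfold productMonoid at hf
  induction hf using Subsemigroup.closure_induction with
  | mem f hf =>
    obtain ⟨s, i, hs, rfl⟩ := hf
    refine ⟨s, hs, i, fun a => D.extends_frob s hs i a, ?_, ?_⟩
    · have h2 : 2 ≤ p ^ s := hp.out.two_le.trans (Nat.le_self_pow hs.1.ne' p)
      exact (D.isFrobLift s hs i).cotangentEnd_mem (hϖ := hϖ) h2 _
    · rintro rfl; rfl
  | mul f g hf' hg' hf hg =>
    have hfA' : f ∈ D.atiyah := AddSubgroup.subset_closure hf'
    have hgA' : g ∈ D.atiyah := AddSubgroup.subset_closure hg'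
    obtain ⟨s, hs, i, h1, h2, -⟩ := hf hfA'
    obtain ⟨t, ht, j, h1', h2', -⟩ := hg hgA'
    obtain ⟨l, hl⟩ := W.comp s t hs ht i j
    refine ⟨s + t, hs.add ht, l, fun a => ?_, ?_, fun h => ?_⟩
    · change f (g _) = _
      rw [h1', h1, ← hl]; rfl
    · have : (⟨f * g, hfA⟩ : ↥D.atiyah) = ⟨f, hfA'⟩ * ⟨g, hgA'⟩ := rfl
      rw [this, map_mul]
      exact bSpace_mul h2 h2'
    -- A product of two factors has degree at least `2c`, so it is never of degree `c`.
    · have h3 := Nat.le_of_dvd hs.1 hs.2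
      have h4 := ht.1
      omega

/-- Every element of the Atiyah extension restricts to a combination of ring endomorphisms of the
base, and its reduction has the corresponding component of degree `c`. -/
theorem atiyah_decomposition (hc : IsDeg c c) (hr : IsResidueMap p ϖ r) (F : ↥D.atiyah) :
    ∃ m : (S →* S) →₀ ℤ,
      (∀ a, F.1 (algebraMap S A a) = algebraMap S A (m.sum fun φ z => (z : S) * φ a)) ∧
      D.red M hϖ F - ∑ i, m (W.frob c i : S →* S) • D.redNabla M hϖ (W.elt hc i) ∈
        bSpaceGE p M hϖ c 2 := by
  classical
  unfold atiyah at F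
  induction F using spanAlgebra_induction with
  | hmem f hf =>
    obtain ⟨s, hs, i, h1, h2, h3⟩ := D.productMonoid_cases (M := M) (hϖ := hϖ) hf
      (AddSubgroup.subset_closure hf)
    refine ⟨Finsupp.single (W.frob s i : S →* S) 1, fun a => ?_, ?_⟩
    · change f _ = _
      rw [h1, Finsupp.sum_single_index] <;> simp
    · by_cases hsc : s = c
      · subst hsc
        rw [Finset.sum_eq_single i]
        · rw [Finsupp.single_eq_same, one_smul]
          convert AddSubgroup.zero_mem _
          rw [sub_eq_zero]
          refine congrArg (D.red M hϖ) (Subtype.ext ?_)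
          exact (h3 rfl).trans (D.nabla_elt s hs i).symm
        · intro j _ hj
          rw [Finsupp.single_eq_of_ne, zero_smul]
          intro h
          exact hj (W.injective s hs (MonoidHom.ext_iff.1 h |> fun h => RingHom.ext h))
        · simp
      -- A degree in `cℕ` other than `c` is at least `2c`, and no `φ_j^(c)` can equal a lift of
      -- another degree, so all coefficients in the sum vanish.
      · rw [Finset.sum_eq_zero, sub_zero]
        · refine mem_bSpaceGE hs ?_ h2
          obtain ⟨d, rfl⟩ := hs.2
          have h0 := hs.1
          rcases d with _ | _ | d
          · simp at h0
          · simp at hsc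
          · nlinarith
        · intro j _
          rw [Finsupp.single_eq_of_ne, zero_smul]
          intro h
          refine hsc (degree_eq_of_frob_eq W hr hs hc (i := i) (j := j) ?_)
          exact (RingHom.ext fun a => (MonoidHom.ext_iff.1 h a)).symm
  | hzero =>
    refine ⟨0, fun a => ?_, ?_⟩
    · rw [Finsupp.sum_zero_index, map_zero]; rfl
    · simp only [Finsupp.coe_zero, Pi.zero_apply, zero_smul, Finset.sum_const_zero, sub_zero]
      convert AddSubgroup.zero_mem _
      exact map_zero (D.red M hϖ)
  | hadd x y hx hy =>
    obtain ⟨m, h1, h2⟩ := hx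
    obtain ⟨m', h1', h2'⟩ := hy
    refine ⟨m + m', fun a => ?_, ?_⟩
    · rw [Finsupp.sum_add_index', map_add, ← h1, ← h1']
      · rfl
      · simp
      · intro φ z z'; push_cast; ring
    · convert add_mem h2 h2' using 1
      have : D.red M hϖ (x + y) = D.red M hϖ x + D.red M hϖ y := map_add (D.red M hϖ) x y
      simp only [Finsupp.add_apply, add_smul, Finset.sum_add_distrib]
      erw [this]
      abel
  | hneg x hx =>
    obtain ⟨m, h1, h2⟩ := hx
    refine ⟨-m, fun a => ?_, ?_⟩
    · rw [Finsupp.sum_neg_index (by simp)]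
      change -(x.1 _) = _
      rw [h1, ← map_neg, Finsupp.sum, Finsupp.sum, ← Finset.sum_neg_distrib]
      congr 1
      exact Finset.sum_congr rfl fun φ _ => by push_cast; ring
    · convert neg_mem h2 using 1
      have : D.red M hϖ (-x) = -D.red M hϖ x := map_neg (D.red M hϖ) x
      simp only [Finsupp.neg_apply, neg_smul, Finset.sum_neg_distrib]
      erw [this]
      abel

/-- The restriction of `F` to the base is an integral combination of multiplicative maps `S → S`.
Such maps are linearly independent (Dedekind), also over `ℤ` in characteristic zero, so if `F`
restricts to zero the combination is zero and no component of degree `c` is left. -/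
theorem red_kernel_mem [CharZero S] (hinj : Function.Injective (algebraMap S A)) (hc : IsDeg c c)
    (hr : IsResidueMap p ϖ r) {F : ↥D.atiyah} (hF : F ∈ D.kernel) :
    D.red M hϖ F ∈ bSpaceGE p M hϖ c 2 := by
  obtain ⟨m, h1, h2⟩ := D.atiyah_decomposition hc hr F (hϖ := hϖ)
  have hm : m = 0 := by
    have hli := (linearIndependent_monoidHom S S).restrict_scalars (R := ℤ)
      (by intro x y h; simpa using h)
    refine linearIndependent_iff.1 hli m (funext fun a => ?_)
    have h3 := (h1 a).symm.trans (hF a)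
    have h4 := hinj (h3.trans (map_zero _).symm)
    rw [Finsupp.linearCombination_apply, Finsupp.sum, Finset.sum_apply]
    rw [Finsupp.sum] at h4
    simpa [zsmul_eq_mul] using h4
  simpa [hm] using h2

end GradedConnection

/-- A Hochschild primitive `g` is also a primitive of the antisymmetrized cocycle. Hence only the
Lie classes have to be shown non-zero. -/
theorem NonUnitalBimodule.lieClass_eq_zero {C M : Type*} [NonUnitalRing C] [AddCommGroup M]
    (β : NonUnitalBimodule C M) {f : ↥β.hochCocycles} (h : β.hochClass f = 0) :
    β.lieClass f = 0 := by
  let := commutatorLieRing C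
  obtain ⟨g, hg⟩ := (QuotientAddGroup.eq_zero_iff f).1 h
  refine (QuotientAddGroup.eq_zero_iff (β.lieCocycle f)).2 ⟨g, fun x y => ?_⟩
  change f.1 x y - f.1 y x = (β.left x (g y) - β.right (MulOpposite.op x) (g y)) -
    (β.left y (g x) - β.right (MulOpposite.op y) (g x)) - g (x * y - y * x)
  have h1 : f.1 x y = _ := hg x y
  have h2 : f.1 y x = _ := hg y x
  rw [h1, h2, map_sub]
  abel

/-- On a commuting pair the term `g ⁅x, y⁆`, over which there is no control, disappears from the
coboundary. -/
theorem NonUnitalBimodule.exists_of_lieClass_eq_zero {C M : Type*} [NonUnitalRing C]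
    [AddCommGroup M] (β : NonUnitalBimodule C M) {f : ↥β.hochCocycles} (h : β.lieClass f = 0) :
    ∃ g : C →+ M, ∀ x y, x * y = y * x → f.1 x y - f.1 y x =
      (β.left x (g y) - β.right (MulOpposite.op x) (g y)) -
        (β.left y (g x) - β.right (MulOpposite.op y) (g x)) := by
  let := commutatorLieRing C
  obtain ⟨g, hg⟩ := (QuotientAddGroup.eq_zero_iff (β.lieCocycle f)).1 h
  refine ⟨g, fun x y hxy => ?_⟩
  have h1 : f.1 x y - f.1 y x = (β.left x (g y) - β.right (MulOpposite.op x) (g y)) -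
    (β.left y (g x) - β.right (MulOpposite.op y) (g x)) - g (x * y - y * x) := hg x y
  rw [h1, hxy, sub_self, map_zero, sub_zero]

/-! ### From one non-zero curvature coordinate to all the conclusions -/

namespace GradedConnection

variable {p : ℕ} [hp : Fact p.Prime] {S k A : Type*} [CommRing S] [IsDomain S] [CharZero S]
  [Field k] [CharP k p] [Infinite k] [CommRing A] [Algebra S A] {ϖ : S} {c n : ℕ}
  {W : WeilMonoid p ϖ c n} (D : GradedConnection W A) {r : S →+* k} {M : Ideal A}
  {hϖ : algebraMap S A ϖ ∈ M} (κ : UnifCoord r M hϖ)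

theorem redCurvature_eq (X Y : ↥W.algebra) (h : X * Y = Y * X) :
    D.redCurvature M hϖ X Y = D.redNabla M hϖ X * D.redNabla M hϖ Y -
      D.redNabla M hϖ Y * D.redNabla M hϖ X := by
  unfold redCurvature
  rw [h, sub_self, map_zero, sub_zero]

theorem redCurvature_mem (hc : IsDeg c c) {i j : Fin n}
    (h : W.elt hc i * W.elt hc j = W.elt hc j * W.elt hc i) :
    D.redCurvature M hϖ (W.elt hc i) (W.elt hc j) ∈ bSpace p M hϖ (c + c) := by
  rw [D.redCurvature_eq _ _ h]
  exact sub_mem (bSpace_mul (D.redNabla_elt_mem M hϖ hc i) (D.redNabla_elt_mem M hϖ hc j))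
    (bSpace_mul (D.redNabla_elt_mem M hϖ hc j) (D.redNabla_elt_mem M hϖ hc i))

/-- The degree argument common to the reduced and the unreduced class: the curvature sits in degree
`c + c`, the right-hand side in degrees at least `3c`. -/
theorem coord_redCurvature_eq_zero (hc : IsDeg c c) (hr : IsResidueMap p ϖ r) {i j : Fin n}
    (h : W.elt hc i * W.elt hc j = W.elt hc j * W.elt hc i) {u w : AddMonoid.End M.Cotangent}
    (hu : u ∈ bSpaceGE p M hϖ c 2) (hw : w ∈ bSpaceGE p M hϖ c 2)
    (huw : ∀ v, κ.coord (D.redCurvature M hϖ (W.elt hc i) (W.elt hc j) v) =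
      κ.coord (D.redNabla M hϖ (W.elt hc i) (u v)) - κ.coord (D.redNabla M hϖ (W.elt hc j) (w v)))
    (v : M.Cotangent) : κ.coord (D.redCurvature M hϖ (W.elt hc i) (W.elt hc j) v) = 0 := by
  have hlt : c + c < (2 + 1) * c := by have := hc.1; omega
  refine κ.coord_eq_zero hr.surjective hlt (D.redCurvature_mem hc h)
    (sub_mem (bSpace_mul_bSpaceGE hc (D.redNabla_elt_mem M hϖ hc i) hu)
      (bSpace_mul_bSpaceGE hc (D.redNabla_elt_mem M hϖ hc j) hw)) (fun v => ?_) v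
  rw [huw v, ← map_sub]
  rfl

/-- An element of the kernel annihilates `s * ϖ` for every `s : S`, and these classes suffice to
control the whole line. -/
theorem coord_red_kernel_line (hinj : Function.Injective (algebraMap S A)) (hc : IsDeg c c)
    (hr : IsResidueMap p ϖ r) {F : ↥D.atiyah} (hF : F ∈ D.kernel) {v : M.Cotangent}
    (hv : v ∈ piLine M hϖ) : κ.coord (D.red M hϖ F v) = 0 := by
  refine κ.coord_line_eq_zero hr.surjective (D.red_kernel_mem hinj hc hr hF) (fun s => ?_) hv
  change D.red M hϖ F (algebraMap S A s • M.toCotangent _) = 0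
  rw [← map_smul]
  refine (cotangentEnd_apply _ _).trans ((M.toCotangent_eq_zero _).2 ?_)
  change F.1 (algebraMap S A s * algebraMap S A ϖ) ∈ M ^ 2
  rw [← map_mul, hF]
  exact zero_mem _

/-- In a product from the kernel the second factor has its image in the line, where the first factor
has coordinate zero. So the coordinate of the reduction is well defined on `N / N ^ 2`. -/
theorem coord_red_idealSq (hinj : Function.Injective (algebraMap S A)) (hc : IsDeg c c)
    (hr : IsResidueMap p ϖ r) {F : ↥D.atiyah} (hF : F ∈ idealSq D.kernel) (v : M.Cotangent) :
    κ.coord (D.red M hϖ F v) = 0 := by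
  unfold idealSq at hF
  induction hF using AddSubgroup.closure_induction with
  | mem x hx =>
    obtain ⟨F, hF, G, -, rfl⟩ := hx
    rw [map_mul]
    exact D.coord_red_kernel_line κ hinj hc hr hF (D.red_range M hϖ G v)
  | zero => rw [map_zero]; exact map_zero κ.coord
  | add x y _ _ hx hy =>
    rw [map_add]
    change κ.coord (D.red M hϖ x v + D.red M hϖ y v) = 0
    rw [map_add, hx, hy, add_zero]
  | neg x _ hx =>
    rw [map_neg]
    change κ.coord (-D.red M hϖ x v) = 0
    rw [map_neg, hx, neg_zero]

/-- If the reduced curvature at a commuting pair has a value with non-zero coordinate, then all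
conclusions hold for this pair. -/
theorem nonTrivial_of_coord_ne (hinj : Function.Injective (algebraMap S A)) (hc : IsDeg c c)
    (hr : IsResidueMap p ϖ r) {i j : Fin n}
    (h : W.elt hc i * W.elt hc j = W.elt hc j * W.elt hc i) {v : M.Cotangent}
    (hv : κ.coord (D.redCurvature M hϖ (W.elt hc i) (W.elt hc j) v) ≠ 0) :
    D.NonTrivial M hϖ hc i j := by
  set X := W.elt hc i with hX
  set Y := W.elt hc j with hY
  have hred : D.redLieClass M hϖ ≠ 0 := by
    intro h0
    obtain ⟨g, hg⟩ := NonUnitalBimodule.exists_of_lieClass_eq_zero _ h0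
    refine hv (D.coord_redCurvature_eq_zero κ hc hr h (aSpaceGE_le_bSpaceGE c 2 (g Y).2)
      (aSpaceGE_le_bSpaceGE c 2 (g X).2) (fun v => ?_) v)
    have h1 := congrArg Subtype.val (hg X Y h)
    have h2 : D.redDefect M hϖ X Y - D.redDefect M hϖ Y X =
      (D.redNabla M hϖ X * (g Y).1 - 0) - (D.redNabla M hϖ Y * (g X).1 - 0) := h1
    have h3 : D.redCurvature M hϖ X Y = D.redNabla M hϖ X * (g Y).1 - D.redNabla M hϖ Y * (g X).1 := by
      rw [sub_zero, sub_zero] at h2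
      rw [← h2, D.redCurvature_eq X Y h, redDefect, redDefect, h]
      abel
    rw [h3, ← map_sub]
    rfl
  -- The commutator of the lifts: since `X * Y = Y * X`, it is both a representative of the value of
  -- the Lie cocycle and a lift of the reduced curvature.
  set F : ↥D.atiyah := D.extSection.sec X * D.extSection.sec Y -
    D.extSection.sec Y * D.extSection.sec X with hFdef
  have hFd : F = (D.extSection.defect X Y : ↥D.atiyah) - D.extSection.defect Y X := by
    change _ = (D.extSection.sec X * D.extSection.sec Y - D.extSection.sec (X * Y)) -
      (D.extSection.sec Y * D.extSection.sec X - D.extSection.sec (Y * X))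
    rw [hFdef, h]
    abel
  have hFk : F ∈ D.kernel := by
    rw [hFd]
    exact sub_mem (D.extSection.defect X Y).2 (D.extSection.defect Y X).2
  have hFred : D.red M hϖ F = D.redCurvature M hϖ X Y := by
    rw [D.redCurvature_eq X Y h, hFdef, map_sub, map_mul, map_mul]
    rfl
  have hlie : D.lieClass ≠ 0 := by
    intro h0
    obtain ⟨g, hg⟩ := NonUnitalBimodule.exists_of_lieClass_eq_zero _ h0
    obtain ⟨G, hG⟩ := QuotientAddGroup.mk_surjective (g Y)
    obtain ⟨G', hG'⟩ := QuotientAddGroup.mk_surjective (g X)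
    have h1 := hg X Y h
    rw [← hG, ← hG'] at h1
    have h2 : (QuotientAddGroup.mk (D.extSection.defect X Y - D.extSection.defect Y X) :
        Conormal D.kernel) = QuotientAddGroup.mk
        (((⟨D.extSection.sec X * G, D.extSection.mul_left _ G G.2⟩ : ↥D.kernel) -
          ⟨G * D.extSection.sec X, D.extSection.mul_right G G.2 _⟩) -
        ((⟨D.extSection.sec Y * G', D.extSection.mul_left _ G' G'.2⟩ : ↥D.kernel) -
          ⟨G' * D.extSection.sec Y, D.extSection.mul_right G' G'.2 _⟩)) := h1
    have h3 := QuotientAddGroup.eq_iff_sub_mem.1 h2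
    have h4 : F - ((D.extSection.sec X * G - G * D.extSection.sec X) -
        (D.extSection.sec Y * G' - G' * D.extSection.sec Y)) ∈ idealSq D.kernel := by
      rw [hFd]
      exact h3
    refine hv (D.coord_redCurvature_eq_zero κ hc hr h (D.red_kernel_mem hinj hc hr G.2)
      (D.red_kernel_mem hinj hc hr G'.2) (fun v => ?_) v)
    -- In coordinates the error in `N ^ 2` disappears, and so do the right action terms, because `∇`
    -- maps into the line on which `G` and `G'` have coordinate zero. The relation left is the one
    -- of the reduced case.
    have h5 := D.coord_red_idealSq κ hinj hc hr h4 v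
    have h6 := D.coord_red_kernel_line κ hinj hc hr G.2 (D.redNabla_range M hϖ X v)
    have h7 := D.coord_red_kernel_line κ hinj hc hr G'.2 (D.redNabla_range M hϖ Y v)
    simp only [map_sub, map_mul] at h5
    have h8 : κ.coord (D.red M hϖ F v) - ((κ.coord (D.redNabla M hϖ X (D.red M hϖ G v)) -
        κ.coord (D.red M hϖ G (D.redNabla M hϖ X v))) -
        (κ.coord (D.redNabla M hϖ Y (D.red M hϖ G' v)) -
        κ.coord (D.red M hϖ G' (D.redNabla M hϖ Y v)))) = 0 := by
      rw [← h5]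
      simp only [← map_sub]
      rfl
    rw [← hFred]
    rw [h6, h7, sub_zero, sub_zero] at h8
    exact sub_eq_zero.1 h8
  -- The curvature itself witnesses non-triviality of both modules: on the line `X` acts by a
  -- Frobenius power times the non-zero residue of `δ_i ϖ`.
  have hact : κ.coord (D.redNabla M hϖ X (D.red M hϖ F v)) ≠ 0 := by
    rw [D.redNabla_coord κ hr hc i (D.red_range M hϖ F v), hFred]
    exact mul_ne_zero (hr.piDer_unif_ne hc.1 (W.isFrobLift c hc i)) (pow_ne_zero _ hv)
  refine ⟨?_, hred, hlie, fun h0 => hlie (NonUnitalBimodule.lieClass_eq_zero _ h0),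
    fun h0 => hred (NonUnitalBimodule.lieClass_eq_zero _ h0), ?_, ?_⟩
  · intro h0
    refine hv ?_
    rw [h0]
    exact map_zero κ.coord
  · refine ⟨X, ⟨D.red M hϖ F, F, hFk, rfl⟩, fun h0 => hact ?_⟩
    have h1 : D.redNabla M hϖ X * D.red M hϖ F = 0 := congrArg Subtype.val h0
    have h2 := DFunLike.congr_fun h1 v
    exact (congrArg κ.coord h2).trans (map_zero κ.coord)
  · refine ⟨X, QuotientAddGroup.mk ⟨F, hFk⟩, fun h0 => hact ?_⟩
    have h1 : (QuotientAddGroup.mk (⟨D.extSection.sec X * F,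
      D.extSection.mul_left _ F hFk⟩ : ↥D.kernel) : Conormal D.kernel) = 0 := h0
    have h2 : D.extSection.sec X * F ∈ idealSq D.kernel := (QuotientAddGroup.eq_zero_iff
      (⟨D.extSection.sec X * F, D.extSection.mul_left _ F hFk⟩ : ↥D.kernel)).1 h1
    have h3 := D.coord_red_idealSq κ hinj hc hr h2 v
    rw [map_mul] at h3
    exact h3

end GradedConnection

/-! ### Evaluation at the identity matrix -/

/-- Cauchy sequences for a nilpotent ideal are constant from index `m` on. It serves for `S / ϖ ^
2`, where `p ^ 2 = 0`, so that functions on the completion can be evaluated there. -/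
theorem IsAdicComplete.of_pow_eq_bot {T : Type*} [CommRing T] {I : Ideal T} {m : ℕ}
    (h : I ^ m = ⊥) : IsAdicComplete I T where
  haus' x hx := by
    have := hx m
    rwa [h, Submodule.bot_smul, SModEq.bot] at this
  prec' f hf := by
    refine ⟨f m, fun n => ?_⟩
    rcases le_total n m with hn | hn
    · exact hf hn
    · have := hf hn
      rw [h, Submodule.bot_smul, SModEq.bot] at this
      rw [this]

section PComplExt

variable {p : ℕ} {B : Type*} [CommRing B]

theorem PCompl.exists_eq_add (x : PCompl p B) :
    ∃ (b : B) (y : PCompl p B), x = algebraMap B (PCompl p B) b + p * y := by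
  obtain ⟨b, hb⟩ := Ideal.Quotient.mk_surjective (AdicCompletion.evalOneₐ (Ideal.span {(p : B)}) x)
  have h1 : x - algebraMap B (PCompl p B) b ∈
      RingHom.ker (AdicCompletion.evalOneₐ (Ideal.span {(p : B)})).toRingHom := by
    rw [RingHom.mem_ker, map_sub, sub_eq_zero]
    exact hb.symm.trans (DFunLike.congr_fun
      (AdicCompletion.evalOneₐ_comp_algebraMap_eq_mk (Ideal.span {(p : B)})) b).symm
  rw [AdicCompletion.ker_evalOneₐ_eq_map (fg := ⟨{(p : B)}, by simp⟩), Ideal.map_span,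
    Set.image_singleton, map_natCast, Ideal.mem_span_singleton] at h1
  obtain ⟨y, hy⟩ := h1
  exact ⟨b, y, by rw [← hy]; ring⟩

/-- Ring homomorphisms from the completion to a ring of characteristic `p` are determined on the
uncompleted ring. -/
theorem PCompl.hom_eq {k : Type*} [CommRing k] [CharP k p] {f g : PCompl p B →+* k}
    (h : ∀ b, f (algebraMap B (PCompl p B) b) = g (algebraMap B (PCompl p B) b))
    (x : PCompl p B) : f x = g x := by
  obtain ⟨b, y, rfl⟩ := PCompl.exists_eq_add x
  simp only [map_add, map_mul, map_natCast, CharP.cast_eq_zero, zero_mul, h]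

end PComplExt

section AtOne

variable {p : ℕ} {S : Type*} [CommRing S] {n : ℕ} {T : Type*} [CommRing T]

/-- The homomorphism from the coordinate ring given by `ψ` on the coefficients and `x ↦ 1`. -/
noncomputable def oglAtOne (ψ : S →+* T) : OGL S n →+* T :=
  IsLocalization.Away.lift (S := OGL S n)
    (g := MvPolynomial.eval₂Hom ψ (fun t : Fin n × Fin n => (1 : Matrix (Fin n) (Fin n) T) t.1 t.2))
    (Matrix.mvPolynomialX (Fin n) (Fin n) S).det (by
      rw [RingHom.map_det]
      refine (congrArg IsUnit (Eq.trans (congrArg Matrix.det ?_) Matrix.det_one)).mpr isUnit_one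
      ext i j
      simp)

theorem oglAtOne_poly (ψ : S →+* T) (f : MvPolynomial (Fin n × Fin n) S) :
    oglAtOne ψ (algebraMap _ (OGL S n) f) = MvPolynomial.eval₂Hom ψ
      (fun t : Fin n × Fin n => (1 : Matrix (Fin n) (Fin n) T) t.1 t.2) f :=
  IsLocalization.Away.lift_eq _ _ _

theorem oglAtOne_algebraMap (ψ : S →+* T) (s : S) :
    oglAtOne ψ (algebraMap S (OGL S n) s) = ψ s := by
  rw [IsScalarTower.algebraMap_apply S (MvPolynomial (Fin n × Fin n) S) (OGL S n), oglAtOne_poly]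
  simp

theorem agl_algebraMap (s : S) : algebraMap S (AGL p S n) s =
    algebraMap (OGL S n) (AGL p S n) (algebraMap S (OGL S n) s) :=
  IsScalarTower.algebraMap_apply S (OGL S n) (AGL p S n) s

/-- Evaluation at `x = 1` retracts the coordinate ring onto `S`, so an element of `S` that dies in
the completion lies in every `p ^ m S`. Krull's intersection theorem concludes. -/
theorem algebraMap_agl_injective [IsDomain S] [IsNoetherianRing S] (hp : ¬ IsUnit (p : S)) :
    Function.Injective (algebraMap S (AGL p S n)) := by
  refine (injective_iff_map_eq_zero _).2 fun s hs => ?_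
  have h1 : ∀ m, s ∈ Ideal.span {(p : S)} ^ m := by
    intro m
    rw [agl_algebraMap] at hs
    have h2 := congrArg (AdicCompletion.evalₐ (Ideal.span {(p : OGL S n)}) m) hs
    rw [AlgHom.commutes, map_zero] at h2
    have h3 := Ideal.Quotient.eq_zero_iff_mem.1 h2
    have h4 := span_pow_le_comap (oglAtOne (RingHom.id S)) m h3
    rwa [Ideal.mem_comap, oglAtOne_algebraMap] at h4
  have h5 := Ideal.iInf_pow_eq_bot_of_isDomain (Ideal.span {(p : S)})
    (by rwa [Ne, Ideal.span_singleton_eq_top])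
  rw [← Ideal.mem_bot, ← h5]
  exact Ideal.mem_iInf.2 h1

theorem substGL_genericMatrix (ψ : S →+* AGL p S n) (Y : Matrix (Fin n) (Fin n) (AGL p S n))
    (hY : IsUnit Y.det) (i j : Fin n) : substGL ψ Y hY (genericMatrix p S n i j) = Y i j := by
  unfold substGL
  change pExtend _ (algebraMap (OGL S n) (AGL p S n) (algebraMap _ (OGL S n) _)) = _
  rw [pExtend_algebraMap, IsLocalization.Away.lift_eq]
  simp

variable [IsAdicComplete (Ideal.span {(p : T)}) T]

theorem pExtend_oglAtOne_algebraMap (ψ : S →+* T) (s : S) :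
    pExtend (p := p) (oglAtOne (n := n) ψ) (algebraMap S (AGL p S n) s) = ψ s := by
  rw [agl_algebraMap, pExtend_algebraMap, oglAtOne_algebraMap]

theorem pExtend_oglAtOne_genericMatrix (ψ : S →+* T) (i j : Fin n) :
    pExtend (p := p) (oglAtOne (n := n) ψ) (genericMatrix p S n i j) =
      (1 : Matrix (Fin n) (Fin n) T) i j := by
  change pExtend _ (algebraMap (OGL S n) (AGL p S n) (algebraMap _ (OGL S n) _)) = _
  rw [pExtend_algebraMap, oglAtOne_poly]
  simp

end AtOne

section Coord

variable {p : ℕ} [hp : Fact p.Prime] {S k : Type*} [CommRing S] [IsDomain S] [Field k]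
  [CharP k p] {ϖ : S} {r : S →+* k} {n : ℕ}

/-- The infinitesimal neighbourhood of the identity modulo `ϖ ^ 2`: an evaluation of functions at
`x = 1`, with the attached coordinate on `𝓜 / 𝓜 ^ 2`. -/
theorem IsResidueMap.exists_unifCoord (hr : IsResidueMap p ϖ r) (n : ℕ) :
    ∃ (ev : AGL p S n →+* S ⧸ Ideal.span {ϖ ^ 2})
      (κ : UnifCoord r (maxIdealOne p (n := n) ϖ) (mem_maxIdealOne p ϖ)),
      (∀ s, ev (algebraMap S _ s) = Ideal.Quotient.mk _ s) ∧
      (∀ i j, ev (genericMatrix p S n i j) = (1 : Matrix (Fin n) (Fin n) _) i j) ∧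
      (∀ a s, ev a = Ideal.Quotient.mk _ s → κ.res a = r s) ∧
      (∀ m s, ev m.1 = Ideal.Quotient.mk _ (ϖ * s) →
        κ.coord ((maxIdealOne p (n := n) ϖ).toCotangent m) = r s) := by
  set J := Ideal.span {ϖ ^ 2} with hJ
  have : IsAdicComplete (Ideal.span {(p : S ⧸ J)}) (S ⧸ J) := by
    refine IsAdicComplete.of_pow_eq_bot (m := 2) ?_
    rw [Ideal.span_singleton_pow, Ideal.span_singleton_eq_bot, ← map_natCast (Ideal.Quotient.mk J),
      ← map_pow, Ideal.Quotient.eq_zero_iff_mem, hJ, Ideal.mem_span_singleton]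
    exact pow_dvd_pow_of_dvd ((hr.eq_zero_iff _).1 hr.map_p) 2
  let ev : AGL p S n →+* S ⧸ J := pExtend (p := p) (oglAtOne (n := n) (Ideal.Quotient.mk J))
  have ev1 : ∀ s, ev (algebraMap S _ s) = Ideal.Quotient.mk _ s :=
    pExtend_oglAtOne_algebraMap (Ideal.Quotient.mk J)
  have ev2 : ∀ i j, ev (genericMatrix p S n i j) = (1 : Matrix (Fin n) (Fin n) _) i j :=
    pExtend_oglAtOne_genericMatrix (Ideal.Quotient.mk J)
  let res' : S ⧸ J →+* k := Ideal.Quotient.lift J r fun a ha => by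
    rw [hr.eq_zero_iff]
    exact (dvd_pow_self ϖ two_ne_zero).trans (Ideal.mem_span_singleton.1 ha)
  have hres' : ∀ s, res' (Ideal.Quotient.mk J s) = r s := fun s => Ideal.Quotient.lift_mk _ _ _
  -- Division by `ϖ` in `S / ϖ ^ 2` is only defined up to multiples of `ϖ`, which is harmless after
  -- taking residues.
  have hmk : ∀ s s', Ideal.Quotient.mk J (ϖ * s) = Ideal.Quotient.mk J (ϖ * s') → r s = r s' := by
    intro s s' h
    rw [Ideal.Quotient.eq, hJ, Ideal.mem_span_singleton, ← mul_sub, hr.sq_dvd_mul_iff,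
      map_sub, sub_eq_zero] at h
    exact h
  set M := maxIdealOne p (S := S) (n := n) ϖ with hM
  have hex : ∀ m ∈ M, ∃ s, ev m = Ideal.Quotient.mk J (ϖ * s) := by
    have hle : M ≤ (Ideal.span {Ideal.Quotient.mk J ϖ}).comap ev := by
      refine Ideal.span_le.2 ?_
      rintro _ (rfl | ⟨t, rfl⟩)
      · rw [SetLike.mem_coe, Ideal.mem_comap]
        rw [ev1]
        exact Ideal.mem_span_singleton_self _
      · rw [SetLike.mem_coe, Ideal.mem_comap]
        change ev (genericMatrix p S n t.1 t.2 - (1 : Matrix (Fin n) (Fin n) _) t.1 t.2) ∈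
          Ideal.span {Ideal.Quotient.mk J ϖ}
        have h0 : (1 : Matrix (Fin n) (Fin n) (S ⧸ J)) t.1 t.2 -
            ev ((1 : Matrix (Fin n) (Fin n) _) t.1 t.2) = 0 := by
          rw [Matrix.one_apply, Matrix.one_apply]
          split_ifs <;> simp
        rw [map_sub, ev2, h0]
        exact Ideal.zero_mem _
    intro m hm
    obtain ⟨t, ht⟩ := Ideal.mem_span_singleton.1 (hle hm)
    obtain ⟨s, rfl⟩ := Ideal.Quotient.mk_surjective t
    exact ⟨s, by rw [ht, map_mul]⟩
  choose! g hg using hex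
  have hg' : ∀ m ∈ M, ∀ s, ev m = Ideal.Quotient.mk J (ϖ * s) → r (g m) = r s :=
    fun m hm s h => hmk _ _ ((hg m hm).symm.trans h)
  let c0 : ↥M →+ k := AddMonoidHom.mk' (fun m => r (g m)) (fun a b => by
    rw [← map_add]
    refine hg' _ (a + b).2 _ ?_
    change ev (a.1 + b.1) = _
    rw [map_add, hg _ a.2, hg _ b.2, mul_add, map_add])
  -- The reason for working modulo `ϖ ^ 2`: since `M` goes to multiples of `ϖ`, its square goes to
  -- zero and the coordinate descends to the cotangent space.
  have hsq : ∀ a ∈ M ^ 2, ev a = 0 := by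
    intro a ha
    rw [pow_two] at ha
    refine Submodule.mul_induction_on ha (fun x hx y hy => ?_) (fun x y hx hy => ?_)
    · rw [map_mul, hg x hx, hg y hy, ← map_mul, Ideal.Quotient.eq_zero_iff_mem, hJ,
        Ideal.mem_span_singleton]
      exact ⟨g x * g y, by ring⟩
    · rw [map_add, hx, hy, add_zero]
  let c1 : M.Cotangent →+ k := AddMonoidHom.liftOfSurjective M.toCotangent.toAddMonoidHom
    M.toCotangent_surjective ⟨c0, fun x hx => by
      have h1 : (x : AGL p S n) ∈ M ^ 2 := (M.toCotangent_eq_zero x).1 hx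
      refine (hg' x.1 x.2 0 ?_).trans (map_zero r)
      rw [hsq _ h1, mul_zero, map_zero]⟩
  have hc1 : ∀ m, c1 (M.toCotangent m) = r (g m.1) := fun m =>
    AddMonoidHom.liftOfRightInverse_comp_apply M.toCotangent.toAddMonoidHom _ _ _ m
  have hc2 : ∀ (m : ↥M) (s : S), ev m.1 = Ideal.Quotient.mk _ (ϖ * s) →
      c1 (M.toCotangent m) = r s := fun m s h => (hc1 m).trans (hg' m.1 m.2 s h)
  refine ⟨ev, ⟨res'.comp ev, fun s => ?_, c1, fun a v => ?_, ?_⟩, ev1, ev2, fun a s h => ?_, hc2⟩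
  · rw [RingHom.comp_apply, ev1, hres']
  · obtain ⟨m, rfl⟩ := M.toCotangent_surjective v
    change c1 (a • M.toCotangent m) = _
    rw [← map_smul, hc1 m]
    obtain ⟨s, hs⟩ := Ideal.Quotient.mk_surjective (ev a)
    rw [RingHom.comp_apply, ← hs, hres', ← map_mul]
    refine hc2 _ _ ?_
    change ev (a * m.1) = _
    rw [map_mul, hg _ m.2, ← hs, ← map_mul, mul_left_comm]
  · rw [← map_one r]
    exact hc2 _ _ (by rw [ev1, mul_one])
  · change res' (ev a) = _
    rw [h, hres']

end Coord

/-! ### The graded Levi-Civita connection at the identity -/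

theorem Matrix.map_nonsing_inv_eq_one {m : Type*} [Fintype m] [DecidableEq m] {A k : Type*}
    [CommRing A] [CommRing k] (f : A →+* k) {X : Matrix m m A} (hX : IsUnit X.det)
    (h : X.map f = 1) : X⁻¹.map f = 1 := by
  have h1 := congrArg (f.mapMatrix) (Matrix.mul_nonsing_inv X hX)
  rw [map_mul, map_one] at h1
  change X.map f * X⁻¹.map f = 1 at h1
  rwa [h, one_mul] at h1

namespace GradedConnection

variable {p : ℕ} [hp : Fact p.Prime] {S k : Type*} [CommRing S] [IsDomain S] [Field k]
  [CharP k p] {ϖ : S} {r : S →+* k} {c n : ℕ} {W : WeilMonoid p ϖ c n}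
  (D : GradedConnection W (AGL p S n))

/-- The matrix of `δ_i^G x`. -/
noncomputable def derMat (s : ℕ) (i : Fin n) : Matrix (Fin n) (Fin n) (AGL p S n) :=
  (genericMatrix p S n).map (piDer p s (algebraMap S (AGL p S n) ϖ) (D.frobG s i))

theorem frobG_generic {s : ℕ} (hs : IsDeg c s) (i a b : Fin n) :
    D.frobG s i (genericMatrix p S n a b) =
      genericMatrix p S n a b ^ p ^ s + algebraMap S _ ϖ * D.derMat s i a b :=
  (D.isFrobLift s hs i).apply_eq _

/-- At `x = 1` the constant terms of `φ^G (x - 1)` cancel, and `ϖ * δ^G x` is what remains. -/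
theorem coord_redNabla_generic {ev : AGL p S n →+* S ⧸ Ideal.span {ϖ ^ 2}}
    {κ : UnifCoord r (maxIdealOne p (n := n) ϖ) (mem_maxIdealOne p ϖ)}
    (ev1 : ∀ s, ev (algebraMap S _ s) = Ideal.Quotient.mk _ s)
    (ev2 : ∀ i j, ev (genericMatrix p S n i j) = (1 : Matrix (Fin n) (Fin n) _) i j)
    (ev3 : ∀ a s, ev a = Ideal.Quotient.mk _ s → κ.res a = r s)
    (ev4 : ∀ m s, ev m.1 = Ideal.Quotient.mk _ (ϖ * s) →
      κ.coord ((maxIdealOne p (n := n) ϖ).toCotangent m) = r s)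
    {s : ℕ} (hs : IsDeg c s) (i a b : Fin n) :
    κ.coord (D.redNabla _ (mem_maxIdealOne p ϖ) (W.elt hs i)
      ((maxIdealOne p (n := n) ϖ).toCotangent ⟨(genericMatrix p S n - 1) a b,
        Ideal.subset_span (Or.inr ⟨(a, b), rfl⟩)⟩)) = κ.res (D.derMat s i a b) := by
  obtain ⟨t, ht⟩ := Ideal.Quotient.mk_surjective (ev (D.derMat s i a b))
  rw [ev3 _ _ ht.symm]
  refine (congrArg κ.coord (cotangentEnd_apply _ _)).trans (ev4 _ _ ?_)
  change ev (D.nabla (W.elt hs i) (genericMatrix p S n a b - (1 : Matrix (Fin n) (Fin n) _) a b)) = _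
  rw [D.nabla_elt s hs i]
  change ev (D.frobG s i (genericMatrix p S n a b - (1 : Matrix (Fin n) (Fin n) _) a b)) = _
  rw [map_sub, D.frobG_generic hs, map_sub, map_add, map_pow, map_mul, ev1, ev2, ← ht, ← map_mul]
  have h0 : (1 : Matrix (Fin n) (Fin n) (S ⧸ Ideal.span {ϖ ^ 2})) a b ^ p ^ s =
      ev (D.frobG s i ((1 : Matrix (Fin n) (Fin n) _) a b)) := by
    rw [Matrix.one_apply, Matrix.one_apply]
    split_ifs
    · simp
    · simp [hp.out.ne_zero]
  rw [h0, add_sub_cancel_left]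

/-- The metric condition at the identity. -/
theorem MetricWith.at_one (hr : IsResidueMap p ϖ r)
    {ev : AGL p S n →+* S ⧸ Ideal.span {ϖ ^ 2}}
    {κ : UnifCoord r (maxIdealOne p (n := n) ϖ) (mem_maxIdealOne p ϖ)}
    (ev1 : ∀ s, ev (algebraMap S _ s) = Ideal.Quotient.mk _ s)
    (ev2 : ∀ i j, ev (genericMatrix p S n i j) = (1 : Matrix (Fin n) (Fin n) _) i j)
    (ev3 : ∀ a s, ev a = Ideal.Quotient.mk _ s → κ.res a = r s)
    {s : ℕ} (hs : IsDeg c s) {q : Matrix (Fin n) (Fin n) S} {hq : IsUnit q.det}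
    (h : D.MetricWith s q hq) (i : Fin n) :
    ((D.derMat s i).map κ.res).transpose * (q.map fun x => r x ^ p ^ s) +
      (q.map fun x => r x ^ p ^ s) * (D.derMat s i).map κ.res =
      -(q.map fun x => r (piDer p s ϖ (W.frob s i) x)) := by
  ext a b
  have h1 := congrArg ev (RingHom.congr_fun (h i) (genericMatrix p S n a b))
  choose t ht using fun a b => Ideal.Quotient.mk_surjective (ev (D.derMat s i a b))
  have hx : (genericMatrix p S n).map ev = 1 := Matrix.ext ev2
  have hg : (D.derMat s i).map κ.res = (Matrix.of t).map r :=
    Matrix.ext fun a b => ev3 _ _ (ht a b).symm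
  -- The square is evaluated on an entry of `x` at the identity: this path gives `q ^ (p ^ s)`, the
  -- other path gives `φ(x)^t φ(q) φ(x)`.
  have hL : ev ((metricHom q hq) (trivialLift s (W.frob s i) (genericMatrix p S n a b))) =
      Ideal.Quotient.mk (Ideal.span {ϖ ^ 2}) (q a b) ^ p ^ s := by
    unfold trivialLift metricHom
    rw [substGL_genericMatrix]
    change ev (substGL _ _ _ (genericMatrix p S n a b ^ p ^ s)) = _
    rw [map_pow, substGL_genericMatrix, map_pow]
    congr 1
    have : ev.mapMatrix ((genericMatrix p S n).transpose * q.map (algebraMap S (AGL p S n)) *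
        genericMatrix p S n) = q.map (Ideal.Quotient.mk (Ideal.span {ϖ ^ 2})) := by
      rw [map_mul, map_mul]
      change ((genericMatrix p S n).map ev).transpose * (q.map (algebraMap S (AGL p S n))).map ev *
        (genericMatrix p S n).map ev = _
      rw [hx, Matrix.transpose_one, one_mul, mul_one]
      ext a b
      exact ev1 _
    exact congrFun (congrFun this a) b
  have hφ : ((genericMatrix p S n).map (D.frobG s i)).map ev =
      (1 + ϖ • Matrix.of t).map (Ideal.Quotient.mk (Ideal.span {ϖ ^ 2})) := by
    ext a b
    change ev (D.frobG s i (genericMatrix p S n a b)) = Ideal.Quotient.mk (Ideal.span {ϖ ^ 2})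
      ((1 : Matrix (Fin n) (Fin n) S) a b + ϖ * t a b)
    rw [D.frobG_generic hs, map_add, map_pow, map_mul, ev1, ev2, ← ht, map_add, map_mul]
    congr 1
    rw [Matrix.one_apply, Matrix.one_apply]
    split_ifs <;> simp [hp.out.ne_zero]
  have hR : ev (D.frobG s i (metricHom q hq (genericMatrix p S n a b))) =
      Ideal.Quotient.mk (Ideal.span {ϖ ^ 2}) (((1 + ϖ • Matrix.of t).transpose * q.map (W.frob s i) *
        (1 + ϖ • Matrix.of t)) a b) := by
    unfold metricHom
    rw [substGL_genericMatrix]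
    have : (ev.comp (D.frobG s i)).mapMatrix ((genericMatrix p S n).transpose *
        q.map (algebraMap S (AGL p S n)) * genericMatrix p S n) =
        (Ideal.Quotient.mk (Ideal.span {ϖ ^ 2})).mapMatrix ((1 + ϖ • Matrix.of t).transpose * q.map (W.frob s i) *
        (1 + ϖ • Matrix.of t)) := by
      rw [map_mul, map_mul, map_mul, map_mul]
      change (((genericMatrix p S n).map (D.frobG s i)).map ev).transpose *
        (q.map (algebraMap S (AGL p S n))).map (ev.comp (D.frobG s i)) *
        ((genericMatrix p S n).map (D.frobG s i)).map ev =
        ((1 + ϖ • Matrix.of t).map (Ideal.Quotient.mk (Ideal.span {ϖ ^ 2}))).transpose *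
          (q.map (W.frob s i)).map (Ideal.Quotient.mk (Ideal.span {ϖ ^ 2})) *
          (1 + ϖ • Matrix.of t).map (Ideal.Quotient.mk (Ideal.span {ϖ ^ 2}))
      rw [hφ]
      congr 2
      ext a b
      change ev (D.frobG s i (algebraMap S _ (q a b))) = Ideal.Quotient.mk (Ideal.span {ϖ ^ 2}) (W.frob s i (q a b))
      rw [D.extends_frob s hs, ev1]
    exact congrFun (congrFun this a) b
  have h2 := hL.symm.trans (h1.trans hR)
  rw [← map_pow, eq_comm, Ideal.Quotient.eq, Ideal.mem_span_singleton] at h2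
  have hq' : q.map (W.frob s i) = q.map (· ^ p ^ s) + ϖ • q.map (piDer p s ϖ (W.frob s i)) := by
    ext a b
    exact (W.isFrobLift s hs i).apply_eq _
  set Q := q.map (· ^ p ^ s) with hQ
  set δq := q.map (piDer p s ϖ (W.frob s i)) with hδ
  set t' := Matrix.of t with ht'
  -- Expansion in powers of `ϖ`: the constant terms of the two paths agree, so the coefficient of
  -- `ϖ` has to vanish in the residue field.
  have h3 : (1 + ϖ • t').transpose * q.map (W.frob s i) * (1 + ϖ • t') =
      Q + ϖ • (t'.transpose * Q + Q * t' + δq) + (ϖ ^ 2) • (t'.transpose * δq + t'.transpose * Q * t'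
        + δq * t' + ϖ • (t'.transpose * δq * t')) := by
    rw [hq', Matrix.transpose_add, Matrix.transpose_one, Matrix.transpose_smul]
    simp only [add_mul, mul_add, one_mul, mul_one, Matrix.smul_mul, Matrix.mul_smul, smul_add,
      smul_smul, pow_two, mul_assoc]
    abel
  rw [h3] at h2
  have h4 : ϖ ^ 2 ∣ ϖ * (t'.transpose * Q + Q * t' + δq) a b := by
    have h5 : (Q + ϖ • (t'.transpose * Q + Q * t' + δq) + (ϖ ^ 2) • (t'.transpose * δq +
        t'.transpose * Q * t' + δq * t' + ϖ • (t'.transpose * δq * t'))) a b - q a b ^ p ^ s =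
        ϖ * (t'.transpose * Q + Q * t' + δq) a b + ϖ ^ 2 * (t'.transpose * δq +
        t'.transpose * Q * t' + δq * t' + ϖ • (t'.transpose * δq * t')) a b := by
      rw [Matrix.add_apply, Matrix.add_apply, Matrix.smul_apply, Matrix.smul_apply, smul_eq_mul,
        smul_eq_mul, hQ, Matrix.map_apply]
      ring
    rw [h5] at h2
    exact (dvd_add_left (dvd_mul_right _ _)).1 h2
  rw [hr.sq_dvd_mul_iff] at h4
  have h6 : r.mapMatrix (t'.transpose * Q + Q * t' + δq) a b = 0 := h4
  rw [map_add, map_add, map_mul, map_mul] at h6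
  have hQr : r.mapMatrix Q = q.map fun x => r x ^ p ^ s := by
    ext a b
    exact map_pow r _ _
  rw [hQr] at h6
  rw [hg]
  exact eq_neg_of_add_eq_zero_left h6

/-- The torsion condition at the identity. -/
theorem SymmetricWith.at_one (hr : IsResidueMap p ϖ r)
    {ev : AGL p S n →+* S ⧸ Ideal.span {ϖ ^ 2}}
    {κ : UnifCoord r (maxIdealOne p (n := n) ϖ) (mem_maxIdealOne p ϖ)}
    (ev2 : ∀ i j, ev (genericMatrix p S n i j) = (1 : Matrix (Fin n) (Fin n) _) i j)
    (ev3 : ∀ a s, ev a = Ideal.Quotient.mk _ s → κ.res a = r s)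
    {s : ℕ} (hs : IsDeg c s) {L : TorsionSymbol p S n} (h : D.SymmetricWith s L)
    (hL : L.VanishesAtOne) (i j l : Fin n) :
    κ.res (D.derMat s i l j) = κ.res (D.derMat s j l i) := by
  have hx : ∀ a b, κ.res (genericMatrix p S n a b) = (1 : Matrix (Fin n) (Fin n) k) a b := by
    intro a b
    have h1 : ev (genericMatrix p S n a b) =
        Ideal.Quotient.mk _ ((1 : Matrix (Fin n) (Fin n) S) a b) := by
      rw [ev2, Matrix.one_apply, Matrix.one_apply]
      split_ifs <;> simp
    rw [ev3 _ _ h1, Matrix.one_apply, Matrix.one_apply]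
    split_ifs <;> simp
  have hX : (matPow p s (genericMatrix p S n)).map κ.res = 1 := by
    ext a b
    change κ.res (genericMatrix p S n a b ^ p ^ s) = _
    rw [map_pow, hx, Matrix.one_apply]
    split_ifs <;> simp [hp.out.ne_zero]
  have hX' := Matrix.map_nonsing_inv_eq_one κ.res
    (matPow_det_isUnit p s (genericMatrix_det_isUnit p S n)) hX
  have hmul : ∀ (Y : Matrix (Fin n) (Fin n) (AGL p S n)),
      ((matPow p s (genericMatrix p S n))⁻¹ * Y).map κ.res = Y.map κ.res := by
    intro Y
    change κ.res.mapMatrix _ = κ.res.mapMatrix Y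
    rw [map_mul]
    change (matPow p s (genericMatrix p S n))⁻¹.map κ.res * _ = _
    rw [hX', one_mul]
  have hΓ : ∀ i j, κ.res (D.christoffel s l i j) = κ.res (D.derMat s i l j) := fun i j =>
    congrFun (congrFun (hmul (D.derMat s i)) l) j
  -- Modulo `ϖ` and at `x = 1`, the lift acts on `x` as the entrywise power does, so every `Λ_i` is
  -- the identity. Hence only `L(1)` matters.
  have hΛ : ∀ i, (D.lambdaMat s i).map κ.res = 1 := by
    intro i
    refine (hmul _).trans (Matrix.ext fun a b => ?_)
    change κ.res (D.frobG s i (genericMatrix p S n a b)) = _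
    rw [D.frobG_generic hs, map_add, map_pow, map_mul, κ.res_algebraMap, hr.map_unif, zero_mul,
      add_zero, hx, Matrix.one_apply]
    split_ifs <;> simp [hp.out.ne_zero]
  have hev : κ.res (L.eval (D.lambdaMat s) l i j) = κ.res (L.eval (fun _ => 1) l i j) := by
    unfold TorsionSymbol.eval
    refine PCompl.hom_eq (f := κ.res.comp (pExtend _)) (g := κ.res.comp (pExtend _)) (fun f => ?_)
      (L.mat l i j)
    simp only [RingHom.comp_apply, pExtend_algebraMap]
    rw [← RingHom.comp_apply, ← RingHom.comp_apply]
    congr 1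
    refine MvPolynomial.ringHom_ext (fun s => by simp) (fun t => ?_)
    simp only [RingHom.comp_apply, MvPolynomial.coe_eval₂Hom, MvPolynomial.eval₂_X]
    refine (congrFun (congrFun (hΛ t.1) t.2.1) t.2.2).trans ?_
    rw [Matrix.one_apply, Matrix.one_apply]
    split_ifs <;> simp
  have h1 := congrArg κ.res (h l i j)
  rw [hev, hL, map_zero, map_sub, hΓ, hΓ] at h1
  exact sub_eq_zero.1 h1

end GradedConnection

/-! ### The curvature of the graded Levi-Civita connection -/

section Curvature

variable {p : ℕ} [hp : Fact p.Prime] {S k : Type*} [CommRing S] [IsDomain S] [Field k]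
  [CharP k p] {ϖ : S} {r : S →+* k} {c n : ℕ}

/-- Take `l` with `φ_i φ_j = φ_l`: one of the two associative symbols in the Lie symbol is then `1`,
so the other one is too. -/
theorem WeilMonoid.frob_comm (W : WeilMonoid p ϖ c n) (hc : IsDeg c c)
    (hW : ∀ l i j : Fin n, W.lieSymbol c l i j = 0) (i j : Fin n) :
    (W.frob c i).comp (W.frob c j) = (W.frob c j).comp (W.frob c i) := by
  obtain ⟨l, hl⟩ := W.comp c c hc hc i j
  have h := hW l i j
  unfold WeilMonoid.lieSymbol WeilMonoid.assocSymbol at h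
  rw [if_pos hl] at h
  by_contra hne
  rw [if_neg (fun h' => hne (hl.trans h'.symm))] at h
  norm_num at h

theorem WeilMonoid.elt_comm (W : WeilMonoid p ϖ c n) (hc : IsDeg c c)
    (hW : ∀ l i j : Fin n, W.lieSymbol c l i j = 0) (i j : Fin n) :
    W.elt hc i * W.elt hc j = W.elt hc j * W.elt hc i :=
  Subtype.ext (congrArg ringEnd (W.frob_comm hc hW i j))

theorem WeilMonoid.map_der₂ (W : WeilMonoid p ϖ c n) (hc : IsDeg c c) (hr : IsResidueMap p ϖ r)
    (i j : Fin n) (x : S) : r (W.der₂ i j x) =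
      r (piDer p c ϖ (W.frob c i) ϖ) * r (piDer p c ϖ (W.frob c j) x) ^ p ^ c := by
  unfold WeilMonoid.der₂
  rw [two_mul]
  exact hr.map_piDer_comp hc.1 hc.1 (W.isFrobLift c hc i) (W.isFrobLift c hc j) x

/-- The antisymmetrized first order terms of a metric in terms of the Levi-Civita symbols `T` of the
first kind. -/
theorem metric_antisymm_eq {ι k : Type*} [CommRing k] {T d : ι → ι → ι → k}
    (hT : ∀ i a b, T i b a + T i a b = -d i a b) (hs : ∀ i j a, T i a j = T j a i) (i a b : ι) :
    d b i a - d a i b = T i b a - T i a b := by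
  -- The term `T a i b` occurs in both equations and cancels in the difference, so no division by
  -- `2` is needed.
  have h1 := hT b i a
  have h2 := hT a i b
  rw [hs b i a, hs b a i] at h1
  rw [hs a i b] at h2
  linear_combination h1 - h2

namespace GradedConnection

variable {W : WeilMonoid p ϖ c n} (D : GradedConnection W (AGL p S n))

theorem IsLeviCivita.nonTrivial [IsNoetherianRing S] [CharZero S] [Infinite k]
    (hr : IsResidueMap p ϖ r) (hc : IsDeg c c) (hW : ∀ l i j : Fin n, W.lieSymbol c l i j = 0)
    {q : ℕ → Matrix (Fin n) (Fin n) S} {hq : ∀ s, IsDeg c s → IsMetric (q s)}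
    {L : ℕ → TorsionSymbol p S n} (hD : D.IsLeviCivita q hq L) (hL : (L c).VanishesAtOne)
    {i j : Fin n} (h : ∃ l m : Fin n, ¬ ϖ ∣ W.kulkarniNomizu (q c) i j l m) :
    D.NonTrivial (maxIdealOne p ϖ) (mem_maxIdealOne p ϖ) hc i j := by
  obtain ⟨ev, κ, ev1, ev2, ev3, ev4⟩ := hr.exists_unifCoord n
  have hpu : ¬ IsUnit (p : S) := fun hu => (hu.map r).ne_zero hr.map_p
  have hcomm := W.elt_comm hc hW i j
  set g : Fin n → Matrix (Fin n) (Fin n) k := fun i => (D.derMat c i).map κ.res with hg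
  set e : Fin n → k := fun i => r (piDer p c ϖ (W.frob c i) ϖ) with he
  set Q : Matrix (Fin n) (Fin n) k := (q c).map fun x => r x ^ p ^ c with hQ
  set d : Fin n → Fin n → Fin n → k := fun i a b => r (piDer p c ϖ (W.frob c i) (q c a b)) with hd
  -- This is the coordinate of the curvature on the class of `(x - 1)_{ab}`.
  suffices hne : ∃ a b, e i * g j a b ^ p ^ c - e j * g i a b ^ p ^ c ≠ 0 by
    obtain ⟨a, b, hab⟩ := hne
    refine D.nonTrivial_of_coord_ne κ (algebraMap_agl_injective hpu) hc hr hcomm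
      (v := (maxIdealOne p (n := n) ϖ).toCotangent ⟨(genericMatrix p S n - 1) a b,
        Ideal.subset_span (Or.inr ⟨(a, b), rfl⟩)⟩) ?_
    rw [D.redCurvature_eq _ _ hcomm]
    refine fun h0 => hab (Eq.trans ?_ h0)
    refine Eq.trans ?_ (map_sub κ.coord _ _).symm
    refine congrArg₂ (· - ·) ?_ ?_
    · refine Eq.trans ?_ (D.redNabla_coord κ hr hc i (D.redNabla_range _ _ _ _)).symm
      rw [D.coord_redNabla_generic ev1 ev2 ev3 ev4]
      rfl
    · refine Eq.trans ?_ (D.redNabla_coord κ hr hc j (D.redNabla_range _ _ _ _)).symm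
      rw [D.coord_redNabla_generic ev1 ev2 ev3 ev4]
      rfl
  by_contra! hz
  obtain ⟨l, m, hlm⟩ := h
  refine hlm ((hr.eq_zero_iff _).1 ?_)
  have hQs : Q.transpose = Q := by
    ext a b
    change r (q c b a) ^ p ^ c = r (q c a b) ^ p ^ c
    rw [(hq c hc).1.apply]
  have hT : ∀ i a b, (Q * g i) b a + (Q * g i) a b = -d i a b := by
    intro i a b
    have h1 := MetricWith.at_one D hr ev1 ev2 ev3 hc (hD c hc).1 i
    have h2 : (Q * g i).transpose + Q * g i =
        -((q c).map fun x => r (piDer p c ϖ (W.frob c i) x)) := by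
      rw [Matrix.transpose_mul, hQs]
      exact h1
    exact congrFun (congrFun h2 a) b
  have hs : ∀ i j a, (Q * g i) a j = (Q * g j) a i := by
    intro i j a
    rw [Matrix.mul_apply, Matrix.mul_apply]
    refine Finset.sum_congr rfl fun x _ => ?_
    rw [show g i x j = g j x i from SymmetricWith.at_one D hr ev2 ev3 hc (hD c hc).2 hL i j x]
  -- The `p ^ c`-th power is additive, so vanishing of the curvature coordinates survives
  -- multiplication of `g i` and `g j` by the common matrix `Q`.
  have hpow : ∀ a b, e i * (Q * g j) a b ^ p ^ c = e j * (Q * g i) a b ^ p ^ c := by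
    intro a b
    rw [Matrix.mul_apply, Matrix.mul_apply, sum_pow_char_pow, sum_pow_char_pow, Finset.mul_sum,
      Finset.mul_sum]
    refine Finset.sum_congr rfl fun x _ => ?_
    rw [mul_pow, mul_pow]
    linear_combination Q a x ^ p ^ c * hz x b
  have hA := metric_antisymm_eq (T := fun i => Q * g i) hT hs i l m
  have hB := metric_antisymm_eq (T := fun i => Q * g i) hT hs j l m
  have hA' := congrArg (· ^ p ^ c) hA
  have hB' := congrArg (· ^ p ^ c) hB
  simp only [sub_pow_char_pow] at hA' hB'
  unfold WeilMonoid.kulkarniNomizu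
  simp only [map_add, map_sub, W.map_der₂ hc hr]
  -- The residue is `e j` times a twisted antisymmetrized derivative for `i`, minus the same with
  -- `i` and `j` exchanged. The Koszul type identity rewrites both through `T`, and `hpow` cancels
  -- them.
  linear_combination e j * hA' - e i * hB' - hpow m l + hpow l m

end GradedConnection

end Curvature

/-! ### The first two coefficients of a metric -/

section Coefficients

variable {p : ℕ} [hp : Fact p.Prime] {S k : Type*} [CommRing S] [IsDomain S] [Field k]
  [IsAlgClosed k] [CharP k p] {ϖ : S} {r : S →+* k} {c n : ℕ} {t : k →* S}

theorem IsResidueMap.exists_coeffs (hr : IsResidueMap p ϖ r) (ht : ∀ a, r (t a) = a) (x : S) :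
    ∃ a b, ϖ ^ 2 ∣ x - (t a + t b * ϖ) := by
  obtain ⟨y, hy⟩ := (hr.eq_iff x (t (r x))).1 (ht _).symm
  refine ⟨r x, r y, ?_⟩
  have h : x - (t (r x) + t (r y) * ϖ) = ϖ * (y - t (r y)) := by
    rw [← sub_sub, hy]
    ring
  rw [h, hr.sq_dvd_mul_iff, map_sub, ht, sub_self]

theorem IsResidueMap.map_coeffs (hr : IsResidueMap p ϖ r) (ht : ∀ a, r (t a) = a) {x : S}
    {a b : k} (h : ϖ ^ 2 ∣ x - (t a + t b * ϖ)) : r x = a := by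
  have := (hr.eq_iff _ _).2 ((dvd_pow_self ϖ two_ne_zero).trans h)
  rw [this, map_add, map_mul, hr.map_unif, mul_zero, add_zero, ht]

theorem IsResidueMap.coeffs_unique (hr : IsResidueMap p ϖ r) (ht : ∀ a, r (t a) = a) {x : S}
    {a b a' b' : k} (h : ϖ ^ 2 ∣ x - (t a + t b * ϖ)) (h' : ϖ ^ 2 ∣ x - (t a' + t b' * ϖ)) :
    a = a' ∧ b = b' := by
  have h1 := dvd_sub h' h
  have ha : a = a' := (hr.map_coeffs ht h).symm.trans (hr.map_coeffs ht h')
  refine ⟨ha, ?_⟩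
  subst ha
  have h2 : x - (t a + t b' * ϖ) - (x - (t a + t b * ϖ)) = ϖ * (t b - t b') := by ring
  rw [h2, hr.sq_dvd_mul_iff, map_sub, ht, ht, sub_eq_zero] at h1
  exact h1

theorem IsMetric.coeffs (hr : IsResidueMap p ϖ r) (ht : ∀ a, r (t a) = a)
    {q : Matrix (Fin n) (Fin n) S} (hq : IsMetric q) {c₀ c₁ : Matrix (Fin n) (Fin n) k}
    (h : ∀ i j, ϖ ^ 2 ∣ q i j - (t (c₀ i j) + t (c₁ i j) * ϖ)) : IsMetric c₀ ∧ c₁.IsSymm := by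
  have hsymm : ∀ i j, c₀ j i = c₀ i j ∧ c₁ j i = c₁ i j := fun i j =>
    hr.coeffs_unique ht (x := q i j) (by rw [← hq.1.apply]; exact h j i) (h i j)
  have hmap : c₀ = r.mapMatrix q := Matrix.ext fun i j => (hr.map_coeffs ht (h i j)).symm
  refine ⟨⟨Matrix.ext fun i j => (hsymm i j).1, ?_⟩, Matrix.ext fun i j => (hsymm i j).2⟩
  rw [hmap, ← RingHom.map_det]
  exact hq.2.map r

theorem IsMetric.of_coeffs (hr : IsResidueMap p ϖ r) (ht : ∀ a, r (t a) = a)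
    (hloc : IsLocalHom r) {c₀ c₁ : Matrix (Fin n) (Fin n) k} (h₀ : IsMetric c₀) (h₁ : c₁.IsSymm) :
    IsMetric (Matrix.of fun i j => t (c₀ i j) + t (c₁ i j) * ϖ) := by
  refine ⟨Matrix.ext fun i j => ?_, (isUnit_map_iff r _).1 ?_⟩
  · change t (c₀ j i) + t (c₁ j i) * ϖ = t (c₀ i j) + t (c₁ i j) * ϖ
    rw [h₀.1.apply, h₁.apply]
  · rw [RingHom.map_det]
    convert h₀.2
    ext i j
    change r (t (c₀ i j) + t (c₁ i j) * ϖ) = _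
    rw [map_add, map_mul, hr.map_unif, mul_zero, add_zero, ht]

/-- The subspace of matrices `a` with
`ε_{jl} a_{ik} - ε_{jk} a_{il} - ε_{il} a_{jk} + ε_{ik} a_{jl} = 0`. -/
def knSubspace {k : Type*} [Field k] {n : ℕ} (ε : Matrix (Fin n) (Fin n) k) :
    Submodule k (Matrix (Fin n) (Fin n) k) where
  carrier := {a | ∀ i j l m, ε j m * a i l - ε j l * a i m - ε i m * a j l + ε i l * a j m = 0}
  zero_mem' := by simp
  add_mem' {a b} ha hb i j l m := by
    simp only [Matrix.add_apply]
    linear_combination ha i j l m + hb i j l m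
  smul_mem' x a ha i j l m := by
    simp only [Matrix.smul_apply, smul_eq_mul]
    linear_combination x * ha i j l m

theorem exists_symm_notMem_knSubspace {k : Type*} [Field k] {n : ℕ} (hn : 2 ≤ n)
    {ε : Matrix (Fin n) (Fin n) k} (hε : ∀ i j, ε i j ≠ 0) :
    ∃ a : Matrix (Fin n) (Fin n) k, a.IsSymm ∧ a ∉ knSubspace ε := by
  let i : Fin n := ⟨0, by omega⟩
  let j : Fin n := ⟨1, by omega⟩
  have hij : j ≠ i := by simp [i, j]
  -- The matrix unit at `(i, i)`: the equation with indices `i, j, i, j` collapses to `ε j j = 0`.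
  refine ⟨Matrix.diagonal (Pi.single i 1), Matrix.isSymm_diagonal _, fun h => hε j j ?_⟩
  have := h i j i j
  simpa [Matrix.diagonal_apply, hij, hij.symm] using this

/-- The residue of the Kulkarni-Nomizu expression is a power of the linear expression
defining `knSubspace`. -/
theorem WeilMonoid.map_kulkarniNomizu (W : WeilMonoid p ϖ c n) (hc : IsDeg c c)
    (hr : IsResidueMap p ϖ r) (ht : ∀ a, r (t a) = a) {ε : Matrix (Fin n) (Fin n) k}
    (hε : ∀ i j, ε i j ^ p ^ (2 * c) = r (piDer p c ϖ (W.frob c i) ϖ) *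
      r (piDer p c ϖ (W.frob c j) ϖ) ^ p ^ c)
    {q : Matrix (Fin n) (Fin n) S} {c₀ c₁ : Matrix (Fin n) (Fin n) k}
    (h : ∀ i j, ϖ ^ 2 ∣ q i j - (t (c₀ i j) + t (c₁ i j) * ϖ)) (i j l m : Fin n) :
    r (W.kulkarniNomizu q i j l m) = (ε j m * c₁ i l - ε j l * c₁ i m - ε i m * c₁ j l +
      ε i l * c₁ j m) ^ p ^ (2 * c) := by
  have key : ∀ i j a b, r (W.der₂ i j (q a b)) = (ε i j * c₁ a b) ^ p ^ (2 * c) := by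
    intro i j a b
    rw [W.map_der₂ hc hr, hr.map_piDer_of_coeffs ht hc.1 (W.isFrobLift c hc j) (h a b), mul_pow,
      mul_pow, hε, ← pow_mul, ← pow_add, two_mul]
    ring
  unfold WeilMonoid.kulkarniNomizu
  simp only [map_add, map_sub, key, add_pow_char_pow, sub_pow_char_pow]

theorem WeilMonoid.exists_not_dvd_kulkarniNomizu_iff (W : WeilMonoid p ϖ c n) (hc : IsDeg c c)
    (hr : IsResidueMap p ϖ r) (ht : ∀ a, r (t a) = a) {ε : Matrix (Fin n) (Fin n) k}
    (hε : ∀ i j, ε i j ^ p ^ (2 * c) = r (piDer p c ϖ (W.frob c i) ϖ) *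
      r (piDer p c ϖ (W.frob c j) ϖ) ^ p ^ c)
    {q : Matrix (Fin n) (Fin n) S} {c₀ c₁ : Matrix (Fin n) (Fin n) k}
    (h : ∀ i j, ϖ ^ 2 ∣ q i j - (t (c₀ i j) + t (c₁ i j) * ϖ)) :
    (∃ i j l m : Fin n, ¬ ϖ ∣ W.kulkarniNomizu q i j l m) ↔ c₁ ∉ knSubspace ε := by
  rw [← not_iff_not, not_not]
  push Not
  refine forall_congr' fun i => forall_congr' fun j => forall_congr' fun l =>
    forall_congr' fun m => ?_
  rw [← hr.eq_zero_iff, W.map_kulkarniNomizu hc hr ht hε h,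
    pow_eq_zero_iff (pow_ne_zero _ hp.out.ne_zero)]

end Coefficients

/-! ### Finite domains over complete rings -/

section FiniteOverComplete

open TensorProduct

theorem IsAdicComplete.of_linearEquiv {B D D' : Type*} [CommRing B] (I : Ideal B) [AddCommGroup D]
    [Module B D] [AddCommGroup D'] [Module B D'] (f : D ≃ₗ[B] D') [IsAdicComplete I D] :
    IsAdicComplete I D' := by
  rw [← AdicCompletion.of_bijective_iff]
  have h : ⇑(AdicCompletion.of I D') = AdicCompletion.congr I f ∘ AdicCompletion.of I D ∘ f.symm := by
    funext x
    rw [Function.comp_apply, Function.comp_apply, AdicCompletion.congr_apply, AdicCompletion.map_of]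
    simp
  rw [h]
  exact (AdicCompletion.congr I f).bijective.comp
    ((AdicCompletion.of_bijective I D).comp f.symm.bijective)

-- For a finite module over a noetherian ring, completion is the tensor product with the completed
-- ring, which here is `B` itself.
universe u in
theorem IsAdicComplete.of_finite_aux {B D : Type u} [CommRing B] [IsNoetherianRing B] (I : Ideal B)
    [IsAdicComplete I B] [AddCommGroup D] [Module B D] [Module.Finite B D] :
    IsAdicComplete I D := by
  rw [← AdicCompletion.of_bijective_iff]
  let e1 : D ≃ₗ[B] AdicCompletion I B ⊗[B] D := (TensorProduct.lid B D).symm.trans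
    (LinearEquiv.rTensor D (LinearEquiv.ofBijective (AdicCompletion.of I B)
      (AdicCompletion.of_bijective I B)))
  have h : ⇑(AdicCompletion.of I D) = AdicCompletion.ofTensorProduct I D ∘ e1 := by
    funext x
    have : e1 x = (AdicCompletion.of I B 1) ⊗ₜ x := rfl
    rw [Function.comp_apply, this, AdicCompletion.ofTensorProduct_tmul]
    exact (one_smul (AdicCompletion I B) _).symm
  rw [h]
  exact (AdicCompletion.ofTensorProduct_bijective_of_finite_of_isNoetherian I D).comp e1.bijective

/-- Replacing `D` by a quotient of `Fin n → B` removes the universe restriction of `of_finite_aux`.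
-/
theorem IsAdicComplete.of_finite {B D : Type*} [CommRing B] [IsNoetherianRing B] (I : Ideal B)
    [IsAdicComplete I B] [AddCommGroup D] [Module B D] [Module.Finite B D] :
    IsAdicComplete I D := by
  obtain ⟨n, f, hf⟩ := Module.Finite.exists_fin' B D
  have := IsAdicComplete.of_finite_aux I (D := (Fin n → B) ⧸ LinearMap.ker f)
  exact IsAdicComplete.of_linearEquiv I (f.quotKerEquivOfSurjective hf)

/-- In an artinian ring, an element is a unit, or nilpotent, or yields a non-trivial idempotent. -/
theorem IsArtinianRing.exists_idempotent {A : Type*} [CommRing A] [IsArtinianRing A] (a : A) :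
    ∃ e : A, e * e = e ∧ (e = 0 → IsNilpotent a) ∧ (e = 1 → IsUnit a) := by
  obtain ⟨n, y, hy⟩ := IsArtinian.exists_pow_succ_smul_dvd a (1 : A)
  simp only [smul_eq_mul, mul_one] at hy
  have h1 : ∀ m, a ^ (n + 1) = a ^ (n + 1 + m) * y ^ m := by
    intro m
    induction m with
    | zero => simp
    | succ m ih =>
      rw [ih]
      calc a ^ (n + 1 + m) * y ^ m = a ^ n * (a ^ (m + 1) * y ^ m) := by ring
        _ = a ^ (n + 1) * y * (a ^ (m + 1) * y ^ m) := by rw [hy]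
        _ = _ := by ring
  have h2 := h1 (n + 1)
  -- Powers of `a` stabilise, `a ^ n = a ^ (n + 1) * y`, and `(a * y) ^ (n + 1)` is the projector
  -- onto the part where `a` is invertible.
  refine ⟨a ^ (n + 1) * y ^ (n + 1), ?_, fun h => ⟨n + 1, ?_⟩, fun h => ?_⟩
  · calc _ = (a ^ (n + 1 + (n + 1)) * y ^ (n + 1)) * y ^ (n + 1) := by ring
      _ = _ := by rw [← h2]
  · rw [h2, pow_add, mul_assoc, h, mul_zero]
  · exact IsUnit.of_mul_eq_one (a ^ n * y ^ (n + 1)) (by rw [← h]; ring)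

/-- A domain that is finite over a complete noetherian local ring is local. -/
theorem IsLocalRing.of_finite_of_isAdicComplete {B D : Type*} [CommRing B] [IsNoetherianRing B]
    (I : Ideal B) [I.IsMaximal] [IsAdicComplete I B] [CommRing D] [IsDomain D] [Algebra B D]
    [Module.Finite B D] : IsLocalRing D := by
  set J := I.map (algebraMap B D) with hJ
  have hc : IsAdicComplete J D := by
    rw [hJ, IsAdicComplete.map_algebraMap_iff]
    exact IsAdicComplete.of_finite I
  have hart : IsArtinianRing (D ⧸ J) := by
    let : Field (B ⧸ I) := Ideal.Quotient.field I
    have : Module.Finite (B ⧸ I) (D ⧸ J) := Module.Finite.of_restrictScalars_finite B _ _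
    exact IsArtinianRing.of_finite (B ⧸ I) (D ⧸ J)
  have hloc : IsLocalHom (Ideal.Quotient.mk J) :=
    isLocalHom_of_le_jacobson_bot _ (IsAdicComplete.le_jacobson_bot _)
  refine IsLocalRing.of_isUnit_or_isUnit_one_sub_self fun a => ?_
  obtain ⟨e, he, h0, h1⟩ := IsArtinianRing.exists_idempotent (Ideal.Quotient.mk J a)
  obtain ⟨e, rfl⟩ := Ideal.Quotient.mk_surjective e
  -- The idempotent lifts to a root of `X ^ 2 - X` in `D`, and a domain has only the roots `0` and
  -- `1`. The root is simple modulo `J`, since `2e - 1` is its own inverse.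
  obtain ⟨E, hE, hEe⟩ := HenselianRing.is_henselian (I := J) (Polynomial.X ^ 2 - Polynomial.X)
    (by monicity!) e (by
      rw [Polynomial.eval_sub, Polynomial.eval_pow, Polynomial.eval_X, ← Ideal.Quotient.eq, pow_two,
        map_mul, he]) (by
      refine IsUnit.of_mul_eq_one (Ideal.Quotient.mk J (2 * e - 1)) ?_
      rw [← map_mul]
      simp only [Polynomial.derivative_X_pow, Polynomial.derivative_X,
        Polynomial.eval_sub, Polynomial.eval_mul, Polynomial.eval_one, Polynomial.eval_pow,
        Polynomial.eval_X, Polynomial.eval_C, map_sub, map_mul, map_one]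
      simp only [Nat.cast_ofNat, Nat.add_one_sub_one, pow_one, map_ofNat]
      linear_combination 4 * he)
  have hEe' := Ideal.Quotient.eq.2 hEe
  rw [Polynomial.IsRoot, Polynomial.eval_sub, Polynomial.eval_pow, Polynomial.eval_X, pow_two,
    ← mul_sub_one, mul_eq_zero, sub_eq_zero] at hE
  rcases hE with rfl | rfl
  · right
    refine (isUnit_map_iff (Ideal.Quotient.mk J) _).1 ?_
    rw [map_sub, map_one]
    exact (h0 (by rw [← hEe', map_zero])).isUnit_one_sub
  · left
    exact (isUnit_map_iff (Ideal.Quotient.mk J) _).1 (h1 (by rw [← hEe', map_one]))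

end FiniteOverComplete

/-- In a local ring that is an algebra over a field, a root of a product of distinct linear factors
over the field lies in the field. -/
theorem IsLocalRing.exists_eq_of_prod_eq_zero {k Q : Type*} [Field k] [CommRing Q] [IsLocalRing Q]
    (f : k →+* Q) (s : Finset k) {y : Q} (h : ∏ a ∈ s, (y - f a) = 0) : ∃ a, y = f a := by
  classical
  have h1 : ∃ a ∈ s, ¬ IsUnit (y - f a) := by
    by_contra! hu
    have := (IsUnit.prod_iff (s := s) (f := fun a => y - f a)).2 hu
    rw [h] at this
    exact not_isUnit_zero this
  obtain ⟨a, ha, hna⟩ := h1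
  refine ⟨a, sub_eq_zero.1 ?_⟩
  rw [← Finset.mul_prod_erase s _ ha] at h
  -- At most one factor is a non-unit: two of them differ by `f` of a non-zero element of a field.
  have hu : IsUnit (∏ b ∈ s.erase a, (y - f b)) := by
    refine (IsUnit.prod_iff (s := s.erase a) (f := fun a => y - f a)).2 fun b hb => ?_
    by_contra hnb
    have h2 := IsLocalRing.nonunits_add hna (b := -(y - f b)) (by
      rw [mem_nonunits_iff, IsUnit.neg_iff]; exact hnb)
    have h3 : y - f a + -(y - f b) = f (b - a) := by rw [map_sub]; ring
    rw [h3] at h2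
    exact h2 ((sub_ne_zero.2 (Finset.ne_of_mem_erase hb)).isUnit.map f)
  exact (hu.mul_left_eq_zero).1 h

/-- Solutions of `y ^ q = y` in a local algebra over an algebraically closed field of
characteristic dividing `q` lie in the field. -/
theorem IsLocalRing.exists_eq_of_pow_eq {k Q : Type*} [Field k] [IsAlgClosed k] (p : ℕ) [CharP k p]
    [CommRing Q] [IsLocalRing Q] (f : k →+* Q) {q : ℕ} (hq : 1 < q) (hpq : p ∣ q) {y : Q}
    (hy : y ^ q = y) : ∃ a, y = f a := by
  classical
  set P : Polynomial k := Polynomial.X ^ q - Polynomial.X with hP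
  have hmon : P.Monic := by
    rw [hP]
    exact Polynomial.monic_X_pow_sub (by rw [Polynomial.degree_X]; exact_mod_cast hq)
  have hnd : P.roots.Nodup := Polynomial.nodup_roots (galois_poly_separable p q hpq)
  have hprod := Polynomial.prod_multiset_X_sub_C_of_monic_of_roots_card_eq hmon
    (IsAlgClosed.splits P).natDegree_eq_card_roots.symm
  refine IsLocalRing.exists_eq_of_prod_eq_zero f P.roots.toFinset ?_
  have h1 : Polynomial.eval₂ f y P = 0 := by
    rw [hP, Polynomial.eval₂_sub, Polynomial.eval₂_X_pow, Polynomial.eval₂_X, hy, sub_self]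
  rw [← hprod] at h1
  have h2 : (P.roots.map fun a => Polynomial.X - Polynomial.C a).prod =
      ∏ a ∈ P.roots.toFinset, (Polynomial.X - Polynomial.C a) := by
    rw [Finset.prod_eq_multiset_prod, Multiset.toFinset_val, hnd.dedup]
  rw [h2, Polynomial.eval₂_finsetProd] at h1
  simpa using h1

/-! ### Rings of integers of `p`-adic fields -/

section RingOfIntegers

variable {p : ℕ} [hp : Fact p.Prime] {E : Type*} [Field E] [Algebra ℚ_[p] E] [Algebra ℤ_[p] E]
  [IsScalarTower ℤ_[p] ℚ_[p] E] [FiniteDimensional ℚ_[p] E]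

theorem padicIntegralClosure_finite : Module.Finite ℤ_[p] (integralClosure ℤ_[p] E) :=
  IsIntegralClosure.finite ℤ_[p] ℚ_[p] E _

theorem padicIntegralClosure_isLocalRing : IsLocalRing (integralClosure ℤ_[p] E) :=
  have := padicIntegralClosure_finite (p := p) (E := E)
  IsLocalRing.of_finite_of_isAdicComplete (IsLocalRing.maximalIdeal ℤ_[p])

theorem padicIntegralClosure_faithfulSMul : FaithfulSMul ℤ_[p] (integralClosure ℤ_[p] E) := by
  rw [faithfulSMul_iff_algebraMap_injective]
  have h1 : Function.Injective (algebraMap ℤ_[p] E) := by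
    rw [IsScalarTower.algebraMap_eq ℤ_[p] ℚ_[p] E]
    exact (algebraMap ℚ_[p] E).injective.comp (IsFractionRing.injective ℤ_[p] ℚ_[p])
  rw [IsScalarTower.algebraMap_eq ℤ_[p] (integralClosure ℤ_[p] E) E] at h1
  rw [RingHom.coe_comp] at h1
  exact Function.Injective.of_comp h1

/-- A prime element generates the maximal ideal, and `p` is a unit times one of its powers. -/
theorem padicIntegralClosure_eq_unit_mul_pow {ϖ : integralClosure ℤ_[p] E} (hϖ : Prime ϖ) :
    ∃ (e : ℕ) (u : integralClosure ℤ_[p] E), IsUnit u ∧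
      (p : integralClosure ℤ_[p] E) = u * ϖ ^ e := by
  have := padicIntegralClosure_finite (p := p) (E := E)
  have := padicIntegralClosure_isLocalRing (p := p) (E := E)
  have := padicIntegralClosure_faithfulSMul (p := p) (E := E)
  have := integralClosure.isDedekindDomain ℤ_[p] ℚ_[p] (L := E)
  have hp0 : (p : integralClosure ℤ_[p] E) ≠ 0 := by
    rw [← map_natCast (algebraMap ℤ_[p] (integralClosure ℤ_[p] E)), Ne,
      FaithfulSMul.algebraMap_eq_zero_iff]
    exact_mod_cast hp.out.ne_zero
  -- Split off the largest power of `ϖ` dividing `p`. The cofactor is not divisible by the generator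
  -- of the maximal ideal, so it is a unit.
  obtain ⟨u, hu, hnd⟩ :=
    (FiniteMultiplicity.of_not_isUnit hϖ.not_isUnit hp0).exists_eq_pow_mul_and_not_dvd
  refine ⟨_, u, ?_, hu.trans (mul_comm _ _)⟩
  have hmax : (Ideal.span {ϖ}).IsMaximal :=
    ((Ideal.span_singleton_prime hϖ.ne_zero).2 hϖ).isMaximal (by
      rw [Ne, Ideal.span_singleton_eq_bot]; exact hϖ.ne_zero)
  have hspan := IsLocalRing.eq_maximalIdeal hmax
  by_contra hnu
  have h1 : u ∈ IsLocalRing.maximalIdeal (integralClosure ℤ_[p] E) := hnu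
  rw [← hspan, Ideal.mem_span_singleton] at h1
  exact hnd h1

/-- The residue field is finite of characteristic `p`. -/
theorem padicIntegralClosure_exists_card {ϖ : integralClosure ℤ_[p] E} (hϖ : Prime ϖ) :
    ∃ q : ℕ, 1 < q ∧ p ∣ q ∧ ∀ y : integralClosure ℤ_[p] E, ϖ ∣ y ^ q - y := by
  have := padicIntegralClosure_finite (p := p) (E := E)
  have := padicIntegralClosure_isLocalRing (p := p) (E := E)
  have := padicIntegralClosure_faithfulSMul (p := p) (E := E)
  have := integralClosure.isDedekindDomain ℤ_[p] ℚ_[p] (L := E)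
  have hmax : (Ideal.span {ϖ}).IsMaximal :=
    ((Ideal.span_singleton_prime hϖ.ne_zero).2 hϖ).isMaximal (by
      rw [Ne, Ideal.span_singleton_eq_bot]; exact hϖ.ne_zero)
  have hspan := IsLocalRing.eq_maximalIdeal hmax
  have hfin : Finite (IsLocalRing.ResidueField ℤ_[p]) :=
    Finite.of_equiv _ (PadicInt.residueField (p := p)).symm.toEquiv
  have hfin2 : Finite (IsLocalRing.ResidueField (integralClosure ℤ_[p] E)) :=
    Module.finite_of_finite (IsLocalRing.ResidueField ℤ_[p])
  have := Fintype.ofFinite (IsLocalRing.ResidueField (integralClosure ℤ_[p] E))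
  refine ⟨Fintype.card (IsLocalRing.ResidueField (integralClosure ℤ_[p] E)),
    Fintype.one_lt_card, ?_, fun y => ?_⟩
  · have hp0 : (p : IsLocalRing.ResidueField (integralClosure ℤ_[p] E)) = 0 := by
      rw [← map_natCast (IsLocalRing.residue (integralClosure ℤ_[p] E)),
        IsLocalRing.residue_eq_zero_iff, IsLocalRing.mem_maximalIdeal, mem_nonunits_iff,
        ← map_natCast (algebraMap ℤ_[p] (integralClosure ℤ_[p] E)), isUnit_map_iff]
      exact PadicInt.prime_p.not_isUnit
    have : CharP (IsLocalRing.ResidueField (integralClosure ℤ_[p] E)) p :=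
      (CharP.charP_iff_prime_eq_zero hp.out).2 hp0
    rw [← CharP.cast_eq_zero_iff (IsLocalRing.ResidueField (integralClosure ℤ_[p] E)) p,
      Nat.cast_card_eq_zero]
  · rw [← Ideal.mem_span_singleton, hspan, ← IsLocalRing.residue_eq_zero_iff, map_sub, map_pow,
      FiniteField.pow_card, sub_self]

end RingOfIntegers

/-! ### The ring generated over the Witt vectors by a ring of integers -/

section Ramified

variable {p : ℕ} [hp : Fact p.Prime]

/-- Nakayama's lemma for `A` as a submodule of the finite module `D`. -/
theorem Subalgebra.eq_top_of_sup_smul {R D : Type*} [CommRing R] [CommRing D] [Algebra R D]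
    [Module.Finite R D] {π : R} (hπ : Ideal.span {π} ≤ Ideal.jacobson ⊥) {A : Subalgebra R D}
    (h : ∀ x : D, ∃ a ∈ A, ∃ y, x = a + π • y) : A = ⊤ := by
  rw [← Algebra.toSubmodule_eq_top, eq_top_iff]
  refine Submodule.le_of_le_smul_of_le_jacobson_bot (Module.Finite.fg_top) hπ fun x _ => ?_
  obtain ⟨a, ha, y, rfl⟩ := h x
  exact Submodule.add_mem_sup ha
    (Submodule.smul_mem_smul (Ideal.mem_span_singleton_self _) Submodule.mem_top)

theorem unramRing_span_p_isMaximal :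
    (Ideal.span {(p : unramRing p)}).IsMaximal := by
  rw [← WittVector.ker_constantCoeff]
  exact RingHom.ker_isMaximal_of_surjective _ (WittVector.constantCoeff_surjective p)

/-- A finite domain generated over the Witt vectors by the image of a ring with prime element `ϖ`
has the residue map of a totally ramified extension. -/
theorem exists_residueMap_of_adjoin {D O : Type*} [CommRing D] [IsDomain D]
    [Algebra (unramRing p) D] [Module.Finite (unramRing p) D] [FaithfulSMul (unramRing p) D]
    [CommRing O] (f : O →+* D) (hgen : Algebra.adjoin (unramRing p) (Set.range f) = ⊤) {ϖ : O}
    (hϖ : ∃ (e : ℕ) (u : O), IsUnit u ∧ (p : O) = u * ϖ ^ e)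
    (hq : ∃ q : ℕ, 1 < q ∧ p ∣ q ∧ ∀ y : O, ϖ ∣ y ^ q - y) :
    ∃ r : D →+* resField p, IsResidueMap p (f ϖ) r ∧
      (∀ a, r (algebraMap (unramRing p) D (WittVector.teichmuller p a)) = a) ∧ IsLocalHom r := by
  have hmax := unramRing_span_p_isMaximal (p := p)
  have : IsLocalRing D :=
    IsLocalRing.of_finite_of_isAdicComplete (Ideal.span {(p : unramRing p)})
  obtain ⟨e, u, hu, he⟩ := hϖ
  obtain ⟨q, hq1, hpq, hqy⟩ := hq
  have heD : (p : D) = f u * f ϖ ^ e := by rw [← map_natCast f, he, map_mul, map_pow]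
  have hpR : ¬ IsUnit (p : unramRing p) := fun h =>
    hmax.ne_top (Ideal.span_singleton_eq_top.2 h)
  have hpD : ¬ IsUnit (p : D) := by
    rw [← map_natCast (algebraMap (unramRing p) D), isUnit_map_iff]
    exact hpR
  have hp0 : (p : D) ≠ 0 := by
    rw [← map_natCast (algebraMap (unramRing p) D), Ne, FaithfulSMul.algebraMap_eq_zero_iff]
    exact (WittVector.irreducible p).ne_zero
  have hϖD : ¬ IsUnit (f ϖ) := fun h => hpD (heD ▸ (hu.map f).mul (h.pow e))
  have he0 : e ≠ 0 := by
    rintro rfl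
    exact hpD (by rw [heD, pow_zero, mul_one]; exact hu.map f)
  have hdvd : f ϖ ∣ (p : D) := heD ▸ (dvd_pow_self _ he0).mul_left _
  have hϖ0 : f ϖ ≠ 0 := by
    intro h
    rw [h, zero_pow he0, mul_zero] at heD
    exact hp0 heD
  set J : Ideal D := Ideal.span {f ϖ} with hJ
  have hJne : J ≠ ⊤ := fun h => hϖD (Ideal.span_singleton_eq_top.1 h)
  have : Nontrivial (D ⧸ J) := Ideal.Quotient.nontrivial_iff.2 hJne
  have : IsLocalRing (D ⧸ J) := IsLocalRing.of_surjective' _ Ideal.Quotient.mk_surjective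
  let j0 : unramRing p ⧸ Ideal.span {(p : unramRing p)} →+* D ⧸ J :=
    Ideal.Quotient.lift _ ((Ideal.Quotient.mk J).comp (algebraMap (unramRing p) D)) (by
      intro a ha
      obtain ⟨b, rfl⟩ := Ideal.mem_span_singleton.1 ha
      rw [RingHom.comp_apply, Ideal.Quotient.eq_zero_iff_mem, hJ, Ideal.mem_span_singleton,
        map_mul, map_natCast]
      exact hdvd.mul_right _)
  let j : resField p →+* D ⧸ J := j0.comp (WittVector.quotientPEquiv (p := p)
    (k := resField p)).symm.toRingHom
  have hj : ∀ a : unramRing p, j (WittVector.constantCoeff a) = Ideal.Quotient.mk J (algebraMap _ D a) := by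
    intro a
    have h1 : (WittVector.quotientPEquiv (p := p) (k := resField p)).symm
        (WittVector.constantCoeff a) = Ideal.Quotient.mk _ a := by
      rw [RingEquiv.symm_apply_eq]
      rfl
    change j0 ((WittVector.quotientPEquiv (p := p) (k := resField p)).symm
        (WittVector.constantCoeff a)) = _
    rw [h1]
    exact Ideal.Quotient.lift_mk _ _ _
  -- Modulo `ϖ` the generators coming from `O` satisfy `y ^ q = y`, and in a local `k`-algebra such
  -- elements already lie in `k`: the extension is totally ramified.
  have hjs : Function.Surjective j := by
    intro y
    obtain ⟨x, rfl⟩ := Ideal.Quotient.mk_surjective y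
    have hx : x ∈ Algebra.adjoin (unramRing p) (Set.range f) := hgen ▸ Algebra.mem_top
    induction hx using Algebra.adjoin_induction with
    | mem x hx =>
      obtain ⟨z, rfl⟩ := hx
      obtain ⟨a, ha⟩ := IsLocalRing.exists_eq_of_pow_eq p j hq1 hpq
        (y := Ideal.Quotient.mk J (f z)) (by
          rw [← map_pow, Ideal.Quotient.eq, hJ, Ideal.mem_span_singleton, ← map_pow, ← map_sub]
          exact map_dvd f (hqy z))
      exact ⟨a, ha.symm⟩
    | algebraMap a => exact ⟨_, hj a⟩
    | add x y _ _ hx hy =>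
      obtain ⟨a, ha⟩ := hx
      obtain ⟨b, hb⟩ := hy
      exact ⟨a + b, by rw [map_add, map_add, ha, hb]⟩
    | mul x y _ _ hx hy =>
      obtain ⟨a, ha⟩ := hx
      obtain ⟨b, hb⟩ := hy
      exact ⟨a * b, by rw [map_mul, map_mul, ha, hb]⟩
  let je : resField p ≃+* D ⧸ J := RingEquiv.ofBijective j ⟨j.injective, hjs⟩
  have hje : ∀ a, je a = j a := fun _ => rfl
  let r : D →+* resField p := je.symm.toRingHom.comp (Ideal.Quotient.mk J)
  have hr : ∀ x, r x = je.symm (Ideal.Quotient.mk J x) := fun _ => rfl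
  have hr0 : ∀ x, r x = 0 ↔ f ϖ ∣ x := by
    intro x
    rw [hr, map_eq_zero_iff _ je.symm.injective, Ideal.Quotient.eq_zero_iff_mem, hJ,
      Ideal.mem_span_singleton]
  have hrt : ∀ a, r (algebraMap (unramRing p) D (WittVector.teichmuller p a)) = a := by
    intro a
    rw [hr, ← hj, RingEquiv.symm_apply_eq, hje]
    congr 1
  refine ⟨r, ⟨fun a => ⟨_, hrt a⟩, hr0, hϖ0, e, f u, hu.map f, heD⟩, hrt, ⟨fun x hx => ?_⟩⟩
  · by_contra hnx
    have h1 : ¬ f ϖ ∣ x := fun h => hx.ne_zero ((hr0 x).2 h)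
    have h2 : f ϖ ∣ x - algebraMap (unramRing p) D (WittVector.teichmuller p (r x)) := by
      rw [← hr0, map_sub, hrt, sub_self]
    have h3 : IsUnit (algebraMap (unramRing p) D (WittVector.teichmuller p (r x))) :=
      ((hx.map (WittVector.teichmuller p)).map _)
    have h4 : ¬ IsUnit (x - algebraMap (unramRing p) D (WittVector.teichmuller p (r x))) :=
      fun h => hϖD (isUnit_of_dvd_unit h2 h)
    -- Otherwise the Teichmüller representative of the residue, a unit, would be a sum of two
    -- non-units.
    have h5 := IsLocalRing.nonunits_add (a := x) hnx (b := -(x - _)) (by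
      rw [mem_nonunits_iff, IsUnit.neg_iff]; exact h4)
    rw [neg_sub, add_sub_cancel] at h5
    exact h5 h3

/-- A finite algebra over the Witt vectors with a residue map with uniformizer `ϖ` is generated
by `ϖ`. -/
theorem IsResidueMap.adjoin_eq_top {D : Type*} [CommRing D] [Algebra (unramRing p) D]
    [Module.Finite (unramRing p) D] {ϖ : D} {r : D →+* resField p} (hr : IsResidueMap p ϖ r)
    (hrt : ∀ a, r (algebraMap (unramRing p) D (WittVector.teichmuller p a)) = a) :
    Algebra.adjoin (unramRing p) {ϖ} = ⊤ := by
  -- The `ϖ`-adic expansion with Teichmüller digits, cut off after `m` terms. It is used for `m =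
  -- e`, where `ϖ ^ e` is `p` up to a unit and Nakayama over `R` applies.
  have hstep : ∀ (m : ℕ) (x : D), ∃ a ∈ Algebra.adjoin (unramRing p) {ϖ}, ∃ y,
      x = a + ϖ ^ m * y := by
    intro m
    induction m with
    | zero => exact fun x => ⟨0, zero_mem _, x, by simp⟩
    | succ m ih =>
      intro x
      obtain ⟨a, ha, y, rfl⟩ := ih x
      obtain ⟨z, hz⟩ : ϖ ∣ y - algebraMap (unramRing p) D (WittVector.teichmuller p (r y)) := by
        rw [← hr.eq_zero_iff, map_sub, hrt, sub_self]
      set b : D := algebraMap (unramRing p) D (WittVector.teichmuller p (r y))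
      have hb : b ∈ Algebra.adjoin (unramRing p) {ϖ} := Subalgebra.algebraMap_mem _ _
      have hϖ : ϖ ∈ Algebra.adjoin (unramRing p) {ϖ} :=
        Algebra.subset_adjoin (Set.mem_singleton ϖ)
      refine ⟨a + ϖ ^ m * b, add_mem ha (mul_mem (pow_mem hϖ m) hb), z, ?_⟩
      rw [sub_eq_iff_eq_add.1 hz]
      ring
  obtain ⟨e, u, hu, he⟩ := hr.exists_unit
  refine Subalgebra.eq_top_of_sup_smul (π := (p : unramRing p))
    (IsAdicComplete.le_jacobson_bot _) fun x => ?_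
  obtain ⟨a, ha, y, rfl⟩ := hstep e x
  obtain ⟨v, hv⟩ := hu.exists_left_inv
  refine ⟨a, ha, v * y, ?_⟩
  rw [Algebra.smul_def, map_natCast, he]
  linear_combination (-(ϖ ^ e * y)) * hv

end Ramified

/-! ### The ring `R[π]` inside the algebraic closure of `K` -/

section Setting

variable {p : ℕ} [hp : Fact p.Prime]

instance algClosureK_faithfulSMul : FaithfulSMul (unramRing p) (algClosureK p) := by
  rw [faithfulSMul_iff_algebraMap_injective,
    IsScalarTower.algebraMap_eq (unramRing p) (FractionRing (unramRing p)) (algClosureK p)]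
  exact (algebraMap (FractionRing (unramRing p)) (algClosureK p)).injective.comp
    (IsFractionRing.injective (unramRing p) (FractionRing (unramRing p)))

theorem padicEmbedding_intCoe (z : ℤ_[p]) : padicEmbedding p (algebraMap ℤ_[p] ℚ_[p] z) =
    algebraMap (unramRing p) (algClosureK p) (padicIntToR p z) := by
  unfold padicEmbedding
  rw [IsFractionRing.lift_algebraMap,
    IsScalarTower.algebraMap_eq (unramRing p) (FractionRing (unramRing p)) (algClosureK p)]
  rfl

/-- The adjunction of the image of a finite `ℤ_p`-algebra to the Witt vectors is finite. -/
theorem exists_finite_subalgebra {O : Type*} [CommRing O] [Algebra ℤ_[p] O] [Module.Finite ℤ_[p] O]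
    (f : O →+* algClosureK p)
    (hf : f.comp (algebraMap ℤ_[p] O) = (algebraMap (unramRing p) _).comp (padicIntToR p)) :
    ∃ (M : Subalgebra (unramRing p) (algClosureK p)) (g : O →+* M), (∀ y, (g y : algClosureK p) = f y) ∧
      Module.Finite (unramRing p) M ∧ Algebra.adjoin (unramRing p) (Set.range g) = ⊤ := by
  obtain ⟨s, hs⟩ := Module.Finite.fg_top (R := ℤ_[p]) (M := O)
  set M := Algebra.adjoin (unramRing p) (f '' s) with hM
  have hmem : ∀ y, f y ∈ M := by
    intro y
    have hy : y ∈ Submodule.span ℤ_[p] (s : Set O) := hs ▸ Submodule.mem_top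
    induction hy using Submodule.span_induction with
    | mem y hy => exact Algebra.subset_adjoin ⟨y, hy, rfl⟩
    | zero => rw [map_zero]; exact zero_mem _
    | add x y _ _ hx hy => rw [map_add]; exact add_mem hx hy
    | smul z y _ hy =>
      rw [Algebra.smul_def, map_mul, ← RingHom.comp_apply, hf]
      exact mul_mem (Subalgebra.algebraMap_mem _ _) hy
  refine ⟨M, f.codRestrict M hmem, fun y => rfl, ?_, ?_⟩
  · have hfg : (Subalgebra.toSubmodule M).FG := by
      refine fg_adjoin_of_finite (s.finite_toSet.image f) ?_
      rintro _ ⟨y, -, rfl⟩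
      exact (Algebra.IsIntegral.isIntegral (R := ℤ_[p]) y).map_of_comp_eq (padicIntToR p) f hf.symm
    exact Module.Finite.iff_fg.2 hfg
  · refine Subalgebra.map_injective (f := M.val) Subtype.val_injective ?_
    rw [AlgHom.map_adjoin, Algebra.map_top, Subalgebra.range_val, ← Set.range_comp]
    refine le_antisymm (Algebra.adjoin_le ?_) (Algebra.adjoin_mono ?_)
    · rintro _ ⟨y, rfl⟩
      exact hmem y
    · rintro _ ⟨y, -, rfl⟩
      exact ⟨y, rfl⟩

variable {E : Type*} [Field E] [Algebra ℚ_[p] E] [Algebra ℤ_[p] E]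
  [IsScalarTower ℤ_[p] ℚ_[p] E] [FiniteDimensional ℚ_[p] E]

/-- The residue map of `R_π`. -/
theorem ramRing_exists_residueMap (ϖ : integralClosure ℤ_[p] E) (hϖ : Prime ϖ)
    (ι : E →+* algClosureK p) (hι : ∀ x : ℚ_[p], ι (algebraMap ℚ_[p] E x) = padicEmbedding p x)
    (b : algClosureK p) (hb : b = ι ϖ) :
    IsNoetherianRing (ramRing b) ∧ ∃ r : ramRing b →+* resField p, IsResidueMap p (ramPi b) r ∧
      (∀ a, r (teichPi b a) = a) ∧ IsLocalHom r := by
  have := padicIntegralClosure_finite (p := p) (E := E)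
  obtain ⟨M, g, hg, hfin, hgen⟩ := exists_finite_subalgebra
    (O := integralClosure ℤ_[p] E) (ι.comp (algebraMap _ E)) (by
      ext z
      rw [RingHom.comp_apply, RingHom.comp_apply, ← IsScalarTower.algebraMap_apply,
        IsScalarTower.algebraMap_apply ℤ_[p] ℚ_[p] E, hι, padicEmbedding_intCoe]
      rfl)
  have hgb : (g ϖ : algClosureK p) = b := (hg ϖ).trans hb.symm
  have : FaithfulSMul (unramRing p) M := by
    rw [faithfulSMul_iff_algebraMap_injective]
    refine Function.Injective.of_comp (f := M.val) ?_
    exact FaithfulSMul.algebraMap_injective (unramRing p) (algClosureK p)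
  obtain ⟨r, hr, hrt, hloc⟩ := exists_residueMap_of_adjoin g hgen
    (padicIntegralClosure_eq_unit_mul_pow hϖ) (padicIntegralClosure_exists_card hϖ)
  -- The ring generated over `R` by all integers of `E` is already `R[π]`, so the residue map
  -- constructed on `M` is one on `ramRing b`.
  have hMb : Algebra.adjoin (unramRing p) {b} = M := by
    have h1 := congrArg (Subalgebra.map M.val) (hr.adjoin_eq_top hrt)
    rw [AlgHom.map_adjoin, Algebra.map_top, Subalgebra.range_val, Set.image_singleton] at h1
    rw [← h1, ← hgb]
    rfl
  have hgϖ : g ϖ = ⟨b, hMb ▸ Algebra.subset_adjoin rfl⟩ := Subtype.ext hgb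
  rw [hgϖ] at hr
  subst hMb
  exact ⟨isNoetherian_of_tower (unramRing p) inferInstance, r, hr, hrt, hloc⟩

instance ramRing_charZero (b : algClosureK p) : CharZero (ramRing b) := by
  have h1 : Function.Injective ((algebraMap (unramRing p) (algClosureK p)).comp (padicIntToR p)) :=
    (FaithfulSMul.algebraMap_injective (unramRing p) _).comp (padicIntToR_injective p)
  have := charZero_of_injective_ringHom h1
  exact ⟨fun m n h => Nat.cast_injective (R := algClosureK p)
    (by simpa using congrArg (Algebra.adjoin (unramRing p) {b}).val h)⟩

end Setting

/-! ### Assembly of the two halves of the theorem -/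

theorem mainTheorem2 (p : ℕ) [Fact p.Prime] (hp2 : p ≠ 2)
    {E : Type*} [Field E] [Algebra ℚ_[p] E] [Algebra ℤ_[p] E] [IsScalarTower ℤ_[p] ℚ_[p] E]
    [FiniteDimensional ℚ_[p] E] [IsGalois ℚ_[p] E]
    (ϖ : integralClosure ℤ_[p] E) (hϖ : Prime ϖ)
    (ι : E →+* algClosureK p) (hι : ∀ x : ℚ_[p], ι (algebraMap ℚ_[p] E x) = padicEmbedding p x)
    (b : algClosureK p) (hb : b = ι ϖ)
    (c n : ℕ) (hc : 0 < c) (W : WeilMonoid p (ramPi b) c n)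
    (hW : ∀ k i j : Fin n, W.lieSymbol c k i j = 0) :
    (∀ (q : ℕ → Matrix (Fin n) (Fin n) (ramRing b)) (hq : ∀ s, IsDeg c s → IsMetric (q s))
      (L : ℕ → TorsionSymbol p (ramRing b) n) (D : GradedConnection W (AGL p (ramRing b) n)),
      D.IsLeviCivita q hq L → (L c).VanishesAtOne →
      ∀ i j : Fin n, (∃ k l : Fin n, ¬ ramPi b ∣ W.kulkarniNomizu (q c) i j k l) →
        D.NonTrivial (maxIdealOne p (ramPi b)) (mem_maxIdealOne p (ramPi b)) (IsDeg.self hc) i j) ∧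
    (2 ≤ n →
      (∀ q : Matrix (Fin n) (Fin n) (ramRing b), IsMetric q →
        ∃! d : Matrix (Fin n) (Fin n) (resField p) × Matrix (Fin n) (Fin n) (resField p),
          HasCoeffs q d.1 d.2) ∧
      (∀ c₀ c₁ : Matrix (Fin n) (Fin n) (resField p),
        (∃ q : Matrix (Fin n) (Fin n) (ramRing b), IsMetric q ∧ HasCoeffs q c₀ c₁) ↔
          IsMetric c₀ ∧ c₁.IsSymm) ∧
      ∃ (ε : Matrix (Fin n) (Fin n) (resField p))
        (V : Submodule (resField p) (Matrix (Fin n) (Fin n) (resField p))),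
        (∀ i j, ε i j ≠ 0 ∧ ramPi b ∣ teichPi b (ε i j) ^ p ^ (2 * c) -
          piDer p c (ramPi b) (W.frob c i) (ramPi b) *
            piDer p c (ramPi b) (W.frob c j) (ramPi b) ^ p ^ c) ∧
        (∀ a, a ∈ V ↔ ∀ i j k l,
          ε j l * a i k - ε j k * a i l - ε i l * a j k + ε i k * a j l = 0) ∧
        (∃ a : Matrix (Fin n) (Fin n) (resField p), a.IsSymm ∧ a ∉ V) ∧
        (∀ (q : Matrix (Fin n) (Fin n) (ramRing b)) (c₀ c₁ : Matrix (Fin n) (Fin n) (resField p)),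
          IsMetric q → HasCoeffs q c₀ c₁ →
          ((∃ i j k l : Fin n, ¬ ramPi b ∣ W.kulkarniNomizu q i j k l) ↔ c₁ ∉ V)) ∧
        (∀ (q : ℕ → Matrix (Fin n) (Fin n) (ramRing b)) (hq : ∀ s, IsDeg c s → IsMetric (q s))
          (L : ℕ → TorsionSymbol p (ramRing b) n) (D : GradedConnection W (AGL p (ramRing b) n))
          (c₀ c₁ : Matrix (Fin n) (Fin n) (resField p)),
          D.IsLeviCivita q hq L → (L c).VanishesAtOne → HasCoeffs (q c) c₀ c₁ → c₁ ∉ V →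
          ∃ i j : Fin n, D.NonTrivial (maxIdealOne p (ramPi b)) (mem_maxIdealOne p (ramPi b))
            (IsDeg.self hc) i j)) := by
  obtain ⟨_, r, hr, hrt, hloc⟩ := ramRing_exists_residueMap ϖ hϖ ι hι b hb
  have hcc : IsDeg c c := IsDeg.self hc
  have hA : ∀ (q : ℕ → Matrix (Fin n) (Fin n) (ramRing b)) (hq : ∀ s, IsDeg c s → IsMetric (q s))
      (L : ℕ → TorsionSymbol p (ramRing b) n) (D : GradedConnection W (AGL p (ramRing b) n)),
      D.IsLeviCivita q hq L → (L c).VanishesAtOne →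
      ∀ i j : Fin n, (∃ k l : Fin n, ¬ ramPi b ∣ W.kulkarniNomizu (q c) i j k l) →
        D.NonTrivial (maxIdealOne p (ramPi b)) (mem_maxIdealOne p (ramPi b)) (IsDeg.self hc) i j :=
    fun q hq L D hD hL i j h => GradedConnection.IsLeviCivita.nonTrivial D hr hcc hW hD hL h
  refine ⟨hA, fun hn => ?_⟩
  let t : resField p →* ramRing b :=
    (algebraMap (unramRing p) (ramRing b)).toMonoidHom.comp (WittVector.teichmuller p)
  have ht : ∀ a, r (t a) = a := hrt
  have hpos : 0 < p ^ (2 * c) := pow_pos (Fact.out : p.Prime).pos _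
  -- `ε` consists of `p ^ (2c)`-th roots in `k`, chosen so that the residue of the obstruction
  -- becomes a pure `p ^ (2c)`-th power.
  choose ε hε using fun i j => IsAlgClosed.exists_pow_nat_eq
    (r (piDer p c (ramPi b) (W.frob c i) (ramPi b)) *
      r (piDer p c (ramPi b) (W.frob c j) (ramPi b)) ^ p ^ c) hpos
  have hε0 : ∀ i j, ε i j ≠ 0 := by
    intro i j h0
    have h1 := hε i j
    rw [h0, zero_pow hpos.ne'] at h1
    exact mul_ne_zero (hr.piDer_unif_ne hc (W.isFrobLift c hcc i))
      (pow_ne_zero _ (hr.piDer_unif_ne hc (W.isFrobLift c hcc j))) h1.symm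
  have hiff : ∀ (q : Matrix (Fin n) (Fin n) (ramRing b)) (c₀ c₁ : Matrix (Fin n) (Fin n)
      (resField p)), HasCoeffs q c₀ c₁ →
      ((∃ i j k l : Fin n, ¬ ramPi b ∣ W.kulkarniNomizu q i j k l) ↔
        c₁ ∉ knSubspace (Matrix.of ε)) :=
    fun q c₀ c₁ h => W.exists_not_dvd_kulkarniNomizu_iff hcc hr ht hε h
  refine ⟨fun q _ => ?_, fun c₀ c₁ => ⟨?_, ?_⟩, Matrix.of ε, knSubspace (Matrix.of ε),
    fun i j => ⟨hε0 i j, ?_⟩, fun a => Iff.rfl, exists_symm_notMem_knSubspace hn hε0,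
    fun q c₀ c₁ _ h => hiff q c₀ c₁ h, fun q hq L D c₀ c₁ hD hL h hV => ?_⟩
  · choose c₀ c₁ h using fun i j => hr.exists_coeffs ht (q i j)
    refine ⟨(Matrix.of c₀, Matrix.of c₁), h, fun d hd => ?_⟩
    have h2 := fun i j => hr.coeffs_unique ht (hd i j) (h i j)
    exact Prod.ext (Matrix.ext fun i j => (h2 i j).1) (Matrix.ext fun i j => (h2 i j).2)
  · rintro ⟨q, hq, h⟩
    exact hq.coeffs hr ht h
  · rintro ⟨h₀, h₁⟩
    refine ⟨_, IsMetric.of_coeffs hr ht hloc h₀ h₁, fun i j => ?_⟩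
    exact (sub_self (t (c₀ i j) + t (c₁ i j) * ramPi b)).symm ▸ dvd_zero _
  · refine (hr.eq_iff _ _).1 ?_
    rw [map_pow, map_mul, map_pow, hrt]
    exact hε i j
  · obtain ⟨i, j, k, l, hkl⟩ := (hiff _ _ _ h).2 hV
    exact ⟨i, j, hA q hq L D hD hL i j ⟨k, l, hkl⟩⟩
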